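/- Let $(C,o)$ be a reduced complex-analytic curve germ with local ring $(\mathcal O,\mathfrak m)$, i.e. $\mathcal O$ is a reduced one-dimensional $\mathbb C$-algebra isomorphic to a quotient of some convergent power series ring $\mathbb C\{x_1,\dots,x_N\}$. Let $\overline{\mathcal O}$ be the integral closure of $\mathcal O$ in its total ring of fractions; writing $r$ for the number of branches of $(C,o)$, we have $\overline{\mathcal O}\cong\prod_{i=1}^r\mathbb C\{t_i\}$. Write $\mathfrak v_i$ for the order of vanishing in $t_i$. For $\ell\in\mathbb N^r$ set $$\overline{\mathcal F}(\ell)=\{f\in\overline{\mathcal O}\mid \mathfrak v_i(f)\ge\ell_i\text{ for all }i\},\qquad \mathcal F(\ell)=\overline{\mathcal F}(\ell)\cap\mathcal O,$$ $$w_0^C(\ell)=\dim_{\mathbb C}\mathcal O/\mathcal F(\ell)-\dim_{\mathbb C}\overline{\mathcal O}/(\overline{\mathcal F}(\ell)+\mathcal O)\in\mathbb Z.$$ The multiplicity of $(C,o)$ is the leading coefficient $e$ of its Hilbert--Samuel polynomial: $\dim_{\mathbb C}\mathcal O/\mathfrak m^n=en+c$ for all large $n$, with $c\in\mathbb Z$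 constant. For $n\ge 0$, a germ is of type $A_n$ if its local ring is isomorphic, as a $\mathbb C$-algebra, to $\mathbb C\{x,y\}/(x^{n+1}+y^2)$ (so $A_0$ is the smooth germ). A reduced curve germ with local ring $\mathcal O'$ birationally dominates a reduced curve germ with local ring $\mathcal O''$ if the inclusion $\mathcal O''\hookrightarrow\overline{\mathcal O''}$ factors as $\mathcal O''\hookrightarrow\mathcal O'\hookrightarrow\overline{\mathcal O''}$ with injective $\mathbb C$-algebra homomorphisms. Then the following are equivalent: (1) $(C,o)$ has multiplicity at most $2$; (2) $\min_{\ell\in\mathbb N^r}w_0^C(\ell)=0$; (3) $(C,o)$ birationally dominates a germ of type $A_n$ for some $n\ge0$; (4) $(C,o)$ is a germ of type $A_n$ for some $n\ge 0$. -/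

import Mathlib

namespace CurveGerm

noncomputable section

/-- A formal power series over `ℂ` in `N` variables is convergent if it converges absolutely on
some polydisc of positive radius around the origin. -/
def IsConvergent {N : ℕ} (f : MvPowerSeries (Fin N) ℂ) : Prop :=
  ∃ r : ℝ, 0 < r ∧ Summable fun d : Fin N →₀ ℕ => ‖MvPowerSeries.coeff d f‖ * r ^ d.degree

theorem IsConvergent.mono {N : ℕ} {f : MvPowerSeries (Fin N) ℂ} {r s : ℝ} (hs : 0 < s)
    (hsr : s ≤ r)
    (h : Summable fun d : Fin N →₀ ℕ => ‖MvPowerSeries.coeff d f‖ * r ^ d.degree) :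
    Summable fun d : Fin N →₀ ℕ => ‖MvPowerSeries.coeff d f‖ * s ^ d.degree := by
  refine Summable.of_nonneg_of_le (fun d => by positivity) (fun d => ?_) h
  gcongr

theorem isConvergent_C {N : ℕ} (a : ℂ) :
    IsConvergent (MvPowerSeries.C (σ := Fin N) a) := by
  classical
  refine ⟨1, one_pos, summable_of_ne_finset_zero (s := {0}) fun d hd => ?_⟩
  rw [Finset.mem_singleton] at hd
  simp [MvPowerSeries.coeff_C, hd]

theorem isConvergent_X {N : ℕ} (i : Fin N) :
    IsConvergent (MvPowerSeries.X i : MvPowerSeries (Fin N) ℂ) := by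
  classical
  refine ⟨1, one_pos, summable_of_ne_finset_zero (s := {Finsupp.single i 1}) fun d hd => ?_⟩
  rw [Finset.mem_singleton] at hd
  simp [MvPowerSeries.coeff_X, hd]

theorem IsConvergent.add {N : ℕ} {f g : MvPowerSeries (Fin N) ℂ}
    (hf : IsConvergent f) (hg : IsConvergent g) : IsConvergent (f + g) := by
  obtain ⟨r, hr, hf⟩ := hf
  obtain ⟨s, hs, hg⟩ := hg
  have ht : 0 < min r s := lt_min hr hs
  refine ⟨min r s, ht, Summable.of_nonneg_of_le (fun d => by positivity) (fun d => ?_)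
    ((IsConvergent.mono ht (min_le_left r s) hf).add
      (IsConvergent.mono ht (min_le_right r s) hg))⟩
  rw [← add_mul, map_add]
  gcongr
  exact norm_add_le _ _

theorem IsConvergent.mul {N : ℕ} {f g : MvPowerSeries (Fin N) ℂ}
    (hf : IsConvergent f) (hg : IsConvergent g) : IsConvergent (f * g) := by
  classical
  obtain ⟨r, hr, hf⟩ := hf
  obtain ⟨s, hs, hg⟩ := hg
  have ht : 0 < min r s := lt_min hr hs
  have key := summable_sum_mul_antidiagonal_of_summable_mul
    (Summable.mul_of_nonneg (IsConvergent.mono ht (min_le_left r s) hf)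
      (IsConvergent.mono ht (min_le_right r s) hg)
      (fun d => by positivity) (fun d => by positivity))
  refine ⟨min r s, ht, Summable.of_nonneg_of_le (fun d => by positivity) (fun d => ?_) key⟩
  rw [MvPowerSeries.coeff_mul]
  calc _ ≤ (∑ p ∈ Finset.HasAntidiagonal.antidiagonal d,
          ‖MvPowerSeries.coeff p.1 f * MvPowerSeries.coeff p.2 g‖) * min r s ^ d.degree := by
        gcongr
        exact norm_sum_le _ _
    _ = _ := by
        rw [Finset.sum_mul]
        refine Finset.sum_congr rfl fun p hp => ?_
        rw [← Finset.HasAntidiagonal.mem_antidiagonal.mp hp, map_add, pow_add, norm_mul]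
        ring

/-- The ring `ℂ{x₁, …, x_N}` of convergent power series. -/
def ConvergentSeries (N : ℕ) : Subalgebra ℂ (MvPowerSeries (Fin N) ℂ) where
  carrier := {f | IsConvergent f}
  mul_mem' := IsConvergent.mul
  add_mem' := IsConvergent.add
  algebraMap_mem' := isConvergent_C

/-- The coordinate `x_i` in `ℂ{x₁, …, x_N}`. -/
def coord {N : ℕ} (i : Fin N) : ConvergentSeries N := ⟨MvPowerSeries.X i, isConvergent_X i⟩

/-- `O` is (isomorphic to) the local ring of a reduced complex-analytic curve germ. A reduced local
ring of dimension one is automatically equidimensional. -/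
structure IsReducedCurveGerm (O : Type*) [CommRing O] [Algebra ℂ O] : Prop where
  analytic : ∃ (N : ℕ) (I : Ideal (ConvergentSeries N)),
    Nonempty (O ≃ₐ[ℂ] (ConvergentSeries N ⧸ I))
  reduced : IsReduced O
  dim_one : ringKrullDim O = 1

/-- The integral closure of `O` in its total ring of fractions. -/
abbrev Normalization (O : Type*) [CommRing O] : Type _ :=
  integralClosure O (FractionRing O)

/-- The local ring of dimension one `O` has multiplicity `e`: its Hilbert--Samuel function
`n ↦ dim_ℂ O / 𝔪 ^ n` agrees for large `n` with a polynomial `e * n + c`. -/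
def HasMultiplicity (O : Type*) [CommRing O] [IsLocalRing O] [Algebra ℂ O] (e : ℕ) : Prop :=
  ∃ c : ℤ, ∀ᶠ n : ℕ in Filter.atTop,
    (Module.finrank ℂ (O ⧸ IsLocalRing.maximalIdeal O ^ n) : ℤ) = e * n + c

/-- The lattice `ℕ ^ r`. The branches of the germ are indexed by the points of the normalization
over `o`, that is, by the (finitely many) maximal ideals of `Normalization O`. -/
abbrev Lattice (O : Type*) [CommRing O] : Type _ :=
  MaximalSpectrum (Normalization O) →₀ ℕ

/-- The lattice filtration on the normalization. As the normalization is a product of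
discrete valuation rings, one for each maximal ideal `M`, the elements of `M ^ k` are those whose
order of vanishing on the branch of `M` is at least `k`. -/
def normFiltration (O : Type*) [CommRing O] (l : Lattice O) : Ideal (Normalization O) :=
  ⨅ M : MaximalSpectrum (Normalization O), M.asIdeal ^ l M

/-- The lattice filtration on `O`. -/
def filtration (O : Type*) [CommRing O] (l : Lattice O) : Ideal O :=
  (normFiltration O l).comap (algebraMap O (Normalization O))

/-- The Hilbert function `ℓ ↦ dim_ℂ O / F(ℓ)`. -/
def hilbert (O : Type*) [CommRing O] [Algebra ℂ O] (l : Lattice O) : ℕ :=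
  Module.finrank ℂ (O ⧸ filtration O l)

/-- The Hilbert function `ℓ ↦ dim_ℂ Ō / (F̄(ℓ) + O)`, with `Ō` the normalization of `O`. -/
def normHilbert (O : Type*) [CommRing O] [Algebra ℂ O] (l : Lattice O) : ℕ :=
  Module.finrank ℂ (Normalization O ⧸
    ((normFiltration O l).restrictScalars ℂ ⊔
      LinearMap.range (IsScalarTower.toAlgHom ℂ O (Normalization O)).toLinearMap))

/-- The weight function. -/
def weight (O : Type*) [CommRing O] [Algebra ℂ O] (l : Lattice O) : ℤ :=
  (hilbert O l : ℤ) - (normHilbert O l : ℤ)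

/-- The germ with local ring `O'` birationally dominates the germ with local ring `O`: the
inclusion of `O` into its normalization factors through injections `O → O'` and
`O' → Normalization O` of `ℂ`-algebras. -/
def BirationallyDominates (O' O : Type*) [CommRing O'] [Algebra ℂ O'] [CommRing O] [Algebra ℂ O] :
    Prop :=
  ∃ (φ : O →ₐ[ℂ] O') (ψ : O' →ₐ[ℂ] Normalization O),
    Function.Injective φ ∧ Function.Injective ψ ∧
      ψ.comp φ = IsScalarTower.toAlgHom ℂ O (Normalization O)

/-- The local ring `ℂ{x, y} / (x ^ (n + 1) + y ^ 2)` of the normal form of type `A_n`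
(a smooth germ for `n = 0`). -/
abbrev AType (n : ℕ) : Type :=
  ConvergentSeries 2 ⧸
    (Ideal.span {coord 0 ^ (n + 1) + coord 1 ^ 2} : Ideal (ConvergentSeries 2))

/-- The germ with local ring `O` is a germ of type `A_n`. -/
def IsAType (O : Type*) [CommRing O] [Algebra ℂ O] (n : ℕ) : Prop :=
  Nonempty (O ≃ₐ[ℂ] AType n)

end

end CurveGerm

/-!
An element `x ∈ 𝔪` with `x Ō = 𝔪 Ō`, where `Ō` is the normalization, makes `O` a finite algebra over
`ℂ{x}`, and the multiplicity of `O` is `dim O / x O = dim Ō / x Ō`. The weight at the lattice point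
of `x` is `2 - dim O / x O`, so a nonnegative weight forces multiplicity at most `2`. Conversely, if
`Ō` is generated over `ℂ{x}` by `1` and one more element, then multiplication by that element
bounds `dim Ō / (F̄(ℓ) + O)` by `dim O / F(ℓ)`. If `O` dominates a germ of type `A_n`, its
coordinate `x` satisfies `dim O / x O = dim Ō / x Ō ≤ 2`. Finally, if the multiplicity is at most
`2`, then `O = ℂ{x} + ℂ{x} y`, completing the square gives `y ^ 2 ∈ ℂ{x}`, and extracting a square
root of a unit turns this into `y ^ 2 = -x ^ (n + 1)`.

Finiteness over `ℂ{x}` comes from division in `ℂ{x₁, …, x_N}`, which converges by estimates in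
weighted `ℓ¹`-norms. It also shows by induction on `N` that `ℂ{x₁, …, x_N}` is Noetherian: after a
linear change of coordinates, `ℂ{x₁, …, x_N} / (g)` is finite over `ℂ{x₁, …, x_{N-1}}`.
-/

namespace CurveGerm

noncomputable section

open MvPowerSeries IsLocalRing Filter
open scoped ENNReal NNReal nonZeroDivisors Topology

section WeightedNorm

variable {σ τ A : Type*} [NormedCommRing A]

/-- The weighted `ℓ¹`-norm of a power series, with weight `r ^ |d|` on the monomial `d`. It takes
the value `∞` when the series does not converge absolutely on the polydisc of radius `r`. -/
def weightedNorm (r : ℝ≥0) (f : MvPowerSeries σ A) : ℝ≥0∞ :=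
  ∑' d : σ →₀ ℕ, ‖coeff d f‖ₑ * (r : ℝ≥0∞) ^ d.degree

theorem weightedNorm_mono {r s : ℝ≥0} (h : r ≤ s) (f : MvPowerSeries σ A) :
    weightedNorm r f ≤ weightedNorm s f := by
  unfold weightedNorm
  gcongr

theorem weightedNorm_zero (r : ℝ≥0) : weightedNorm r (0 : MvPowerSeries σ A) = 0 := by
  simp [weightedNorm]

theorem enorm_coeff_mul_le_weightedNorm (r : ℝ≥0) (f : MvPowerSeries σ A) (d : σ →₀ ℕ) :
    ‖coeff d f‖ₑ * (r : ℝ≥0∞) ^ d.degree ≤ weightedNorm r f :=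
  ENNReal.le_tsum d

theorem weightedNorm_add_le (r : ℝ≥0) (f g : MvPowerSeries σ A) :
    weightedNorm r (f + g) ≤ weightedNorm r f + weightedNorm r g := by
  unfold weightedNorm
  rw [← ENNReal.tsum_add]
  refine ENNReal.tsum_le_tsum fun d => ?_
  rw [← add_mul, map_add]
  gcongr
  exact enorm_add_le _ _

theorem weightedNorm_sum_le {ι : Type*} (r : ℝ≥0) (s : Finset ι) (f : ι → MvPowerSeries σ A) :
    weightedNorm r (∑ i ∈ s, f i) ≤ ∑ i ∈ s, weightedNorm r (f i) :=
  Finset.le_sum_of_subadditive _ (weightedNorm_zero r).le (weightedNorm_add_le r) s f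

theorem weightedNorm_mul_le (r : ℝ≥0) (f g : MvPowerSeries σ A) :
    weightedNorm r (f * g) ≤ weightedNorm r f * weightedNorm r g := by
  classical
  let term (h : MvPowerSeries σ A) (d : σ →₀ ℕ) : ℝ≥0∞ := ‖coeff d h‖ₑ * (r : ℝ≥0∞) ^ d.degree
  have coeff_le (d : σ →₀ ℕ) : term (f * g) d ≤
      ∑ p ∈ Finset.HasAntidiagonal.antidiagonal d, term f p.1 * term g p.2 := by
    calc term (f * g) d
        ≤ (∑ p ∈ Finset.HasAntidiagonal.antidiagonal d, ‖coeff p.1 f‖ₑ * ‖coeff p.2 g‖ₑ) *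
            (r : ℝ≥0∞) ^ d.degree := by
          simp only [term, coeff_mul]
          gcongr
          exact (enorm_sum_le _ _).trans (Finset.sum_le_sum fun p _ => enorm_smul_le)
      _ = _ := by
          rw [Finset.sum_mul]
          refine Finset.sum_congr rfl fun p hp => ?_
          rw [← Finset.HasAntidiagonal.mem_antidiagonal.mp hp, map_add, pow_add]
          ring
  calc ∑' d, term (f * g) d
      ≤ ∑' d, ∑ p ∈ Finset.HasAntidiagonal.antidiagonal d, term f p.1 * term g p.2 :=
        ENNReal.tsum_le_tsum coeff_le
    _ = ∑' p : (σ →₀ ℕ) × (σ →₀ ℕ), term f p.1 * term g p.2 := by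
        rw [← Finset.HasAntidiagonal.sigmaAntidiagonalEquivProd.tsum_eq, ENNReal.tsum_sigma']
        refine tsum_congr fun d => ?_
        rw [tsum_fintype]
        exact (Finset.sum_attach _ _).symm
    _ = (∑' d, term f d) * ∑' d, term g d := by
        rw [← ENNReal.tsum_mul_right]
        simp only [← ENNReal.tsum_mul_left]
        exact ENNReal.tsum_prod (f := fun d e => term f d * term g e)

theorem weightedNorm_smul_le (r : ℝ≥0) (c : A) (f : MvPowerSeries σ A) :
    weightedNorm r (c • f) ≤ ‖c‖ₑ * weightedNorm r f := by
  unfold weightedNorm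
  rw [← ENNReal.tsum_mul_left]
  refine ENNReal.tsum_le_tsum fun d => ?_
  rw [coeff_smul, ← mul_assoc]
  gcongr
  exact enorm_smul_le

theorem weightedNorm_monomial (r : ℝ≥0) (d : σ →₀ ℕ) (c : A) :
    weightedNorm r (monomial d c) = ‖c‖ₑ * (r : ℝ≥0∞) ^ d.degree := by
  classical
  unfold weightedNorm
  rw [tsum_eq_single d fun e he => by simp [coeff_monomial_ne he], coeff_monomial_same]

theorem weightedNorm_le_of_forall_enorm_coeff_le {f g : MvPowerSeries σ A}
    (h : ∀ d, ‖coeff d f‖ₑ ≤ ‖coeff d g‖ₑ) (r : ℝ≥0) : weightedNorm r f ≤ weightedNorm r g := by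
  unfold weightedNorm
  gcongr with d
  exact h d

theorem weightedNorm_X_pow_mul (r : ℝ≥0) (i : σ) (n : ℕ) (f : MvPowerSeries σ A) :
    weightedNorm r (X i ^ n * f) = (r : ℝ≥0∞) ^ n * weightedNorm r f := by
  classical
  unfold weightedNorm
  rw [← ENNReal.tsum_mul_left,
    ← (add_left_injective (Finsupp.single i n)).tsum_eq (f := fun d : σ →₀ ℕ => _)]
  · refine tsum_congr fun d => ?_
    rw [X_pow_eq, coeff_monomial_mul, if_pos le_add_self, add_tsub_cancel_right, one_mul,
      map_add, Finsupp.degree_single, pow_add]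
    ring
  · refine Function.support_subset_iff'.2 fun d hd => ?_
    have not_le : ¬ Finsupp.single i n ≤ d := fun h =>
      hd ⟨d - Finsupp.single i n, tsub_add_cancel_of_le h⟩
    rw [X_pow_eq, coeff_monomial_mul, if_neg not_le, enorm_zero, zero_mul]

theorem weightedNorm_le_of_constantCoeff_eq_zero {r R : ℝ≥0} (hr : r ≤ R) (hR : 0 < R)
    {f : MvPowerSeries σ A} (h0 : constantCoeff f = 0) :
    weightedNorm r f ≤ ((r / R : ℝ≥0) : ℝ≥0∞) * weightedNorm R f := by
  unfold weightedNorm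
  rw [← ENNReal.tsum_mul_left]
  refine ENNReal.tsum_le_tsum fun d => ?_
  rcases eq_or_ne d 0 with rfl | hd
  · simp [h0]
  · obtain ⟨n, hn⟩ := Nat.exists_eq_succ_of_ne_zero ((Finsupp.degree_eq_zero_iff d).not.2 hd)
    have pow_le : r ^ d.degree ≤ r / R * R ^ d.degree :=
      calc r ^ d.degree = r ^ n * r := by rw [hn, pow_succ]
        _ ≤ R ^ n * r := by gcongr
        _ = r / R * R ^ d.degree := by rw [hn, pow_succ]; field_simp
    calc ‖coeff d f‖ₑ * (r : ℝ≥0∞) ^ d.degree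
        ≤ ‖coeff d f‖ₑ * ((r / R * R ^ d.degree : ℝ≥0) : ℝ≥0∞) := by
          gcongr
          exact_mod_cast pow_le
      _ = _ := by push_cast; ring

section NormOneClass

variable [NormOneClass A]

theorem weightedNorm_one (r : ℝ≥0) : weightedNorm r (1 : MvPowerSeries σ A) = 1 := by
  rw [← monomial_zero_one, weightedNorm_monomial]
  simp

theorem weightedNorm_prod_le {ι : Type*} (r : ℝ≥0) (s : Finset ι) (f : ι → MvPowerSeries σ A) :
    weightedNorm r (∏ i ∈ s, f i) ≤ ∏ i ∈ s, weightedNorm r (f i) :=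
  Finset.le_prod_of_submultiplicative _ (weightedNorm_one r).le (weightedNorm_mul_le r) s f

theorem weightedNorm_pow_le (r : ℝ≥0) (f : MvPowerSeries σ A) (n : ℕ) :
    weightedNorm r (f ^ n) ≤ weightedNorm r f ^ n := by
  simpa only [Finset.prod_const, Finset.card_range]
    using weightedNorm_prod_le r (Finset.range n) fun _ => f

theorem weightedNorm_prod_pow_le {r : ℝ≥0} {ρ : ℝ≥0∞} {a : σ → MvPowerSeries τ A}
    (ha : ∀ i, weightedNorm r (a i) ≤ ρ) (d : σ →₀ ℕ) :
    weightedNorm r (d.prod fun i n => a i ^ n) ≤ ρ ^ d.degree := by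
  unfold Finsupp.prod
  refine (weightedNorm_prod_le _ _ _).trans ?_
  rw [Finsupp.degree_apply, ← Finset.prod_pow_eq_pow_sum]
  gcongr with i _
  exact (weightedNorm_pow_le _ _ _).trans (by gcongr; exact ha i)

theorem weightedNorm_subst_le [Finite σ] {r ρ : ℝ≥0} {a : σ → MvPowerSeries τ A}
    (h0 : ∀ i, constantCoeff (a i) = 0) (ha : ∀ i, weightedNorm r (a i) ≤ ρ)
    (f : MvPowerSeries σ A) :
    weightedNorm r (subst a f) ≤ weightedNorm ρ f := by
  have hs : HasSubst a := hasSubst_of_constantCoeff_zero h0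
  have coeff_le (e : τ →₀ ℕ) : ‖coeff e (subst a f)‖ₑ ≤
      ∑' d : σ →₀ ℕ, ‖coeff d f‖ₑ * ‖coeff e (d.prod fun i n => a i ^ n)‖ₑ := by
    have hfin := coeff_subst_finite hs f e
    rw [coeff_subst hs, finsum_eq_sum _ hfin]
    calc _ ≤ ∑ d ∈ hfin.toFinset, ‖coeff d f • coeff e (d.prod fun i n => a i ^ n)‖ₑ :=
          enorm_sum_le _ _
      _ ≤ ∑ d ∈ hfin.toFinset, ‖coeff d f‖ₑ * ‖coeff e (d.prod fun i n => a i ^ n)‖ₑ :=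
          Finset.sum_le_sum fun d _ => enorm_smul_le
      _ ≤ _ := ENNReal.sum_le_tsum _
  calc weightedNorm r (subst a f)
      ≤ ∑' e : τ →₀ ℕ, (∑' d : σ →₀ ℕ, ‖coeff d f‖ₑ * ‖coeff e (d.prod fun i n => a i ^ n)‖ₑ) *
          (r : ℝ≥0∞) ^ e.degree := by
        unfold weightedNorm
        gcongr with e
        exact coeff_le e
    _ = ∑' d : σ →₀ ℕ, ‖coeff d f‖ₑ * weightedNorm r (d.prod fun i n => a i ^ n) := by
        simp only [weightedNorm, ← ENNReal.tsum_mul_right, ← ENNReal.tsum_mul_left, mul_assoc]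
        exact ENNReal.tsum_comm
    _ ≤ weightedNorm ρ f := by
        unfold weightedNorm
        gcongr with d
        exact weightedNorm_prod_pow_le ha d

end NormOneClass

/-- A power series, in arbitrarily many variables, that converges absolutely on some polydisc of
positive radius. -/
def HasRadius (f : MvPowerSeries σ A) : Prop := ∃ r : ℝ≥0, 0 < r ∧ weightedNorm r f ≠ ⊤

theorem isConvergent_iff_hasRadius {N : ℕ} (f : MvPowerSeries (Fin N) ℂ) :
    IsConvergent f ↔ HasRadius f := by
  have summable_iff (r : ℝ≥0) :
      (Summable fun d : Fin N →₀ ℕ => ‖coeff d f‖ * (r : ℝ) ^ d.degree) ↔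
        weightedNorm r f ≠ ⊤ := by
    have coe_eq : (fun d : Fin N →₀ ℕ => ‖coeff d f‖ * (r : ℝ) ^ d.degree) =
        fun d => ((‖coeff d f‖₊ * r ^ d.degree : ℝ≥0) : ℝ) := by
      ext d; simp
    rw [coe_eq, NNReal.summable_coe, ← ENNReal.tsum_coe_ne_top_iff_summable]
    simp [weightedNorm, enorm_eq_nnnorm]
  constructor
  · rintro ⟨r, hr, h⟩
    exact ⟨⟨r, hr.le⟩, hr, (summable_iff ⟨r, hr.le⟩).1 h⟩
  · rintro ⟨r, hr, h⟩
    exact ⟨r, hr, (summable_iff r).2 h⟩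

theorem hasRadius_X_pow_mul_iff {i : σ} {n : ℕ} {f : MvPowerSeries σ A} :
    HasRadius (X i ^ n * f) ↔ HasRadius f := by
  refine exists_congr fun r => and_congr_right fun hr => ?_
  have : (r : ℝ≥0∞) ^ n ≠ 0 := by positivity
  rw [weightedNorm_X_pow_mul, Ne, ENNReal.mul_eq_top]
  simp [this]

theorem HasRadius.of_forall_enorm_coeff_le {f g : MvPowerSeries σ A} (hg : HasRadius g)
    (h : ∀ d, ‖coeff d f‖ₑ ≤ ‖coeff d g‖ₑ) : HasRadius f :=
  let ⟨r, hr, hg⟩ := hg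
  ⟨r, hr, ne_top_of_le_ne_top hg (weightedNorm_le_of_forall_enorm_coeff_le h r)⟩

theorem HasRadius.eventually_weightedNorm_ne_top {f : MvPowerSeries σ A} (hf : HasRadius f) :
    ∀ᶠ r in 𝓝[>] (0 : ℝ≥0), weightedNorm r f ≠ ⊤ := by
  obtain ⟨R, hR, hf⟩ := hf
  filter_upwards [Ioc_mem_nhdsGT hR] with r hr
  exact ne_top_of_le_ne_top hf (weightedNorm_mono hr.2 f)

theorem HasRadius.eventually_weightedNorm_le {f : MvPowerSeries σ A} (hf : HasRadius f)
    (h0 : constantCoeff f = 0) {ε : ℝ≥0} (hε : 0 < ε) :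
    ∀ᶠ r in 𝓝[>] (0 : ℝ≥0), weightedNorm r f ≤ ε := by
  obtain ⟨R, hR, hf⟩ := hf
  lift weightedNorm R f to ℝ≥0 using hf with B hB
  filter_upwards [Ioc_mem_nhdsGT (lt_min hR (by positivity : 0 < R * ε / (B + 1)))] with r hr
  obtain ⟨hrR, hrB⟩ := le_min_iff.1 hr.2
  refine (weightedNorm_le_of_constantCoeff_eq_zero hrR hR h0).trans ?_
  rw [← hB, ← ENNReal.coe_mul, ENNReal.coe_le_coe]
  calc r / R * B ≤ R * ε / (B + 1) / R * (B + 1) := by gcongr; exact le_self_add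
    _ = ε := by field_simp

theorem HasRadius.subst [NormOneClass A] [Finite σ] {a : σ → MvPowerSeries τ A}
    {f : MvPowerSeries σ A} (hf : HasRadius f) (ha : ∀ i, HasRadius (a i))
    (h0 : ∀ i, constantCoeff (a i) = 0) : HasRadius (subst a f) := by
  obtain ⟨ρ, hρ, hf⟩ := hf
  obtain ⟨r, hr, hr0⟩ := ((eventually_all.2 fun i =>
    (ha i).eventually_weightedNorm_le (h0 i) hρ).and self_mem_nhdsWithin).exists
  exact ⟨r, hr0, ne_top_of_le_ne_top hf (weightedNorm_subst_le h0 hr f)⟩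

end WeightedNorm

section BoxDecomposition

variable {σ A : Type*} [Fintype σ] [LinearOrder σ]

/-- The part of `f` made of the monomials `X ^ d` for which `i` is the first index with `K ≤ d i`,
divided by `X i ^ K`: the `i`-th quotient in the division of `f` by the powers `X j ^ K`. -/
def divXPow [Semiring A] (K : ℕ) (i : σ) (f : MvPowerSeries σ A) : MvPowerSeries σ A :=
  fun e => if ∀ j < i, e j < K then coeff (e + Finsupp.single i K) f else 0

/-- The exponent with entries `e j < K`, for `e` in a cube of side length `K`. -/
def boxExponent {K : ℕ} (e : σ → Fin K) : σ →₀ ℕ :=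
  Finsupp.equivFunOnFinite.symm fun j => (e j : ℕ)

theorem coeff_divXPow [Semiring A] (K : ℕ) (i : σ) (f : MvPowerSeries σ A) (d : σ →₀ ℕ) :
    coeff d (divXPow K i f) =
      if ∀ j < i, d j < K then coeff (d + Finsupp.single i K) f else 0 := rfl

theorem coeff_X_pow_mul_divXPow [Semiring A] (K : ℕ) (i : σ) (f : MvPowerSeries σ A)
    (d : σ →₀ ℕ) :
    coeff d (X i ^ K * divXPow K i f) = if K ≤ d i ∧ ∀ j < i, d j < K then coeff d f else 0 := by
  have single_le : Finsupp.single i K ≤ d ↔ K ≤ d i := by simp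
  rw [X_pow_eq, coeff_monomial_mul, one_mul]
  by_cases h : K ≤ d i
  · have lt_iff : (∀ j < i, (d - Finsupp.single i K) j < K) ↔ ∀ j < i, d j < K :=
      forall₂_congr fun j hj => by simp [Finsupp.tsub_apply, Finsupp.single_eq_of_ne hj.ne]
    rw [if_pos (single_le.2 h), coeff_divXPow, tsub_add_cancel_of_le (single_le.2 h)]
    simp only [lt_iff, h, true_and]
  · rw [if_neg (single_le.not.2 h), if_neg fun h' => h h'.1]

theorem coeff_sum_monomial_boxExponent [Semiring A] (K : ℕ) (f : MvPowerSeries σ A)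
    (d : σ →₀ ℕ) :
    coeff d (∑ e : σ → Fin K, monomial (boxExponent e) (coeff (boxExponent e) f)) =
      if ∀ j, d j < K then coeff d f else 0 := by
  classical
  rw [map_sum]
  simp only [coeff_monomial]
  split_ifs with h
  · rw [Finset.sum_eq_single_of_mem (fun j => (⟨d j, h j⟩ : Fin K)) (Finset.mem_univ _)]
    · have : boxExponent (fun j => (⟨d j, h j⟩ : Fin K)) = d := Finsupp.ext fun j => rfl
      rw [this, if_pos rfl]
    · rintro e - he
      refine if_neg ?_
      rintro rfl
      exact he rfl
  · refine Finset.sum_eq_zero fun e _ => if_neg ?_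
    rintro rfl
    exact h fun j => (e j).2

theorem coeff_sum_X_pow_mul_divXPow [Semiring A] (K : ℕ) (f : MvPowerSeries σ A)
    (d : σ →₀ ℕ) :
    coeff d (∑ i, X i ^ K * divXPow K i f) = if ∀ j, d j < K then 0 else coeff d f := by
  rw [map_sum]
  simp only [coeff_X_pow_mul_divXPow]
  split_ifs with h
  · exact Finset.sum_eq_zero fun i _ => if_neg fun h' => (h i).not_ge h'.1
  · push Not at h
    obtain ⟨i, hi, first⟩ := WellFounded.has_min wellFounded_lt {j | K ≤ d j} h
    have lt_of_lt (j : σ) (hj : j < i) : d j < K := not_le.1 fun hK => first j hK hj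
    rw [Finset.sum_eq_single_of_mem i (Finset.mem_univ i), if_pos ⟨hi, lt_of_lt⟩]
    rintro j - hne
    refine if_neg fun ⟨hj, hlt⟩ => ?_
    rcases hne.lt_or_gt with hji | hij
    · exact (lt_of_lt j hji).not_ge hj
    · exact (hlt i hij).not_ge hi

theorem eq_sum_monomial_add_sum_X_pow_mul_divXPow [Semiring A] (K : ℕ)
    (f : MvPowerSeries σ A) :
    f = ∑ e : σ → Fin K, monomial (boxExponent e) (coeff (boxExponent e) f) +
      ∑ i, X i ^ K * divXPow K i f := by
  ext d
  rw [map_add, coeff_sum_monomial_boxExponent, coeff_sum_X_pow_mul_divXPow]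
  split_ifs <;> simp

variable [NormedCommRing A]

theorem enorm_coeff_X_pow_mul_divXPow_le (K : ℕ) (i : σ) (f : MvPowerSeries σ A) (d : σ →₀ ℕ) :
    ‖coeff d (X i ^ K * divXPow K i f)‖ₑ ≤ ‖coeff d f‖ₑ := by
  rw [coeff_X_pow_mul_divXPow]
  split_ifs <;> simp

theorem pow_mul_weightedNorm_divXPow_le (r : ℝ≥0) (K : ℕ) (i : σ) (f : MvPowerSeries σ A) :
    (r : ℝ≥0∞) ^ K * weightedNorm r (divXPow K i f) ≤ weightedNorm r f := by
  rw [← weightedNorm_X_pow_mul r i K]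
  exact weightedNorm_le_of_forall_enorm_coeff_le (enorm_coeff_X_pow_mul_divXPow_le K i f) r

theorem HasRadius.divXPow {f : MvPowerSeries σ A} (hf : HasRadius f) (K : ℕ) (i : σ) :
    HasRadius (divXPow K i f) :=
  hasRadius_X_pow_mul_iff.1 (hf.of_forall_enorm_coeff_le (enorm_coeff_X_pow_mul_divXPow_le K i f))

end BoxDecomposition

section BinomialSeries

theorem hasRadius_binomialSeries (a : ℂ) :
    HasRadius (PowerSeries.binomialSeries ℂ a : MvPowerSeries Unit ℂ) := by
  have half_lt : ((1 / 2 : ℝ≥0) : ℝ≥0∞) < (_root_.binomialSeries ℂ a).radius :=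
    lt_of_lt_of_le (by norm_num) binomialSeries_radius_ge_one
  have summable := (_root_.binomialSeries ℂ a).summable_norm_mul_pow half_lt
  simp only [_root_.binomialSeries, FormalMultilinearSeries.ofScalars_norm] at summable
  refine ⟨1 / 2, by positivity, ?_⟩
  have sum_eq : weightedNorm (1 / 2) (PowerSeries.binomialSeries ℂ a : MvPowerSeries Unit ℂ) =
      ∑' n : ℕ, ((‖Ring.choose a n‖₊ * (1 / 2) ^ n : ℝ≥0) : ℝ≥0∞) := by
    unfold weightedNorm
    rw [← (Finsupp.uniqueEquiv (M := ℕ) ()).symm.tsum_eq]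
    refine tsum_congr fun n => ?_
    have index_eq : (Finsupp.uniqueEquiv (M := ℕ) ()).symm n = Finsupp.single () n := by
      ext; simp
    rw [index_eq, Finsupp.degree_single, ENNReal.coe_mul, ENNReal.coe_pow, ← enorm_eq_nnnorm]
    congr 2
    exact (PowerSeries.binomialSeries_coeff a n).trans (by simp)
  rw [sum_eq, ENNReal.tsum_coe_ne_top_iff_summable, ← NNReal.summable_coe]
  exact summable.congr fun n => by simp

end BinomialSeries

namespace ConvergentSeries

variable {N k : ℕ}

theorem hasRadius (f : ConvergentSeries N) : HasRadius f.1 :=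
  (isConvergent_iff_hasRadius _).1 f.2

/-- A formal power series with a positive radius of convergence, as a convergent power series. -/
def ofHasRadius {f : MvPowerSeries (Fin N) ℂ} (hf : HasRadius f) : ConvergentSeries N :=
  ⟨f, (isConvergent_iff_hasRadius f).2 hf⟩

/-- The value at the origin of a convergent power series. -/
def evalZero : ConvergentSeries N →ₐ[ℂ] ℂ where
  toRingHom := (constantCoeff (σ := Fin N) (R := ℂ)).comp (ConvergentSeries N).val.toRingHom
  commutes' c := constantCoeff_C (σ := Fin N) c

theorem evalZero_apply (f : ConvergentSeries N) : evalZero f = constantCoeff f.1 := rfl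

@[simp]
theorem evalZero_coord (i : Fin N) : evalZero (coord i) = 0 := constantCoeff_X i

/-- The `i`-th quotient `divXPow` in the division of a convergent power series by the powers
`x_j ^ K`. -/
def divCoordPow (K : ℕ) (i : Fin N) (f : ConvergentSeries N) : ConvergentSeries N :=
  ofHasRadius ((hasRadius f).divXPow K i)

/-- The monomial with exponent `d`. -/
def monomial (d : Fin N →₀ ℕ) : ConvergentSeries N := d.prod fun i n => coord i ^ n

theorem coe_monomial (d : Fin N →₀ ℕ) :
    (monomial d : MvPowerSeries (Fin N) ℂ) = MvPowerSeries.monomial d 1 := by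
  rw [monomial_one_eq]
  change (ConvergentSeries N).val (d.prod fun i n => coord i ^ n) = _
  simp only [map_finsuppProd, map_pow]
  rfl

theorem eq_sum_monomial_add_sum_coord_pow_mul_divCoordPow (K : ℕ) (f : ConvergentSeries N) :
    f = ∑ e : Fin N → Fin K, coeff (boxExponent e) f.1 • monomial (boxExponent e) +
      ∑ i, coord i ^ K * divCoordPow K i f := by
  apply Subtype.ext
  conv_lhs => rw [eq_sum_monomial_add_sum_X_pow_mul_divXPow K f.1]
  rw [Subalgebra.coe_add, AddSubmonoidClass.coe_finsetSum, AddSubmonoidClass.coe_finsetSum]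
  congr 1
  refine Finset.sum_congr rfl fun e _ => ?_
  rw [Subalgebra.coe_smul, coe_monomial, ← map_smul, smul_eq_mul, mul_one]

theorem eq_algebraMap_add_sum_coord_mul (f : ConvergentSeries N) :
    f = algebraMap ℂ _ (evalZero f) + ∑ i, coord i * divCoordPow 1 i f := by
  conv_lhs => rw [eq_sum_monomial_add_sum_coord_pow_mul_divCoordPow 1 f]
  have box_eq_zero : boxExponent (default : Fin N → Fin 1) = 0 := by
    ext j; simp [boxExponent]
  simp only [pow_one, Fintype.sum_unique, box_eq_zero]
  rw [Algebra.algebraMap_eq_smul_one]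
  simp [monomial, evalZero_apply]

theorem ker_evalZero :
    RingHom.ker (evalZero : ConvergentSeries N →ₐ[ℂ] ℂ) = Ideal.span (Set.range coord) := by
  apply le_antisymm
  · intro f hf
    rw [eq_algebraMap_add_sum_coord_mul f, RingHom.mem_ker.1 hf, map_zero, zero_add]
    exact Ideal.sum_mem _ fun i _ => Ideal.mul_mem_right _ _ (Ideal.subset_span ⟨i, rfl⟩)
  · rw [Ideal.span_le]
    rintro _ ⟨i, rfl⟩
    exact evalZero_coord i

instance : IsDomain (ConvergentSeries N) :=
  have : IsDomain (MvPowerSeries (Fin N) ℂ) := NoZeroDivisors.to_isDomain _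
  (Subtype.val_injective (p := fun f => f ∈ ConvergentSeries N)).isDomain
    (ConvergentSeries N).val.toRingHom

theorem coord_dvd_iff {i : Fin N} {f : ConvergentSeries N} :
    coord i ∣ f ↔ ∀ d : Fin N →₀ ℕ, d i = 0 → coeff d f.1 = 0 := by
  refine ⟨fun ⟨g, hg⟩ => X_dvd_iff.1 ⟨g.1, congrArg Subtype.val hg⟩, fun h => ?_⟩
  obtain ⟨g, hg⟩ := X_dvd_iff.2 h
  have hasRadius_g : HasRadius g :=
    hasRadius_X_pow_mul_iff (i := i) (n := 1).1 (by rw [pow_one, ← hg]; exact hasRadius f)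
  exact ⟨ofHasRadius hasRadius_g, Subtype.ext hg⟩

/-- Substitution of convergent power series vanishing at the origin. -/
def substHom (b : Fin k → ConvergentSeries N) (hb : ∀ i, evalZero (b i) = 0) :
    ConvergentSeries k →ₐ[ℂ] ConvergentSeries N :=
  AlgHom.codRestrict
    ((substAlgHom (R := ℂ) (hasSubst_of_constantCoeff_zero (a := fun i => (b i).1) hb)).comp
      (ConvergentSeries k).val) _ fun f => by
    change IsConvergent _
    rw [AlgHom.comp_apply, substAlgHom_apply, isConvergent_iff_hasRadius]
    exact (hasRadius f).subst (fun i => hasRadius (b i)) hb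

theorem coe_substHom (b : Fin k → ConvergentSeries N) (hb : ∀ i, evalZero (b i) = 0)
    (f : ConvergentSeries k) :
    (substHom b hb f : MvPowerSeries (Fin N) ℂ) = subst (fun i => (b i).1) f.1 := by
  change substAlgHom (hasSubst_of_constantCoeff_zero (a := fun i => (b i).1) hb) f.1 = _
  rw [substAlgHom_apply]

@[simp]
theorem substHom_coord (b : Fin k → ConvergentSeries N) (hb : ∀ i, evalZero (b i) = 0)
    (i : Fin k) : substHom b hb (coord i) = b i :=
  Subtype.ext ((coe_substHom _ _ _).trans
    (subst_X (hasSubst_of_constantCoeff_zero (a := fun i => (b i).1) hb) i))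

/-- The power `(1 + g) ^ a`, defined by the binomial series, of a convergent power series with
constant term `1`. -/
def oneAddPow (a : ℂ) (g : ConvergentSeries N) (hg : evalZero g = 0) : ConvergentSeries N :=
  ofHasRadius ((hasRadius_binomialSeries a).subst (a := fun _ => g.1) (fun _ => hasRadius g)
    fun _ => hg)

theorem oneAddPow_add (a b : ℂ) (g : ConvergentSeries N) (hg : evalZero g = 0) :
    oneAddPow (a + b) g hg = oneAddPow a g hg * oneAddPow b g hg :=
  Subtype.ext <| (congrArg (PowerSeries.subst g.1) (PowerSeries.binomialSeries_add a b)).trans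
    (PowerSeries.subst_mul (PowerSeries.HasSubst.of_constantCoeff_zero hg) _ _)

theorem oneAddPow_natCast (n : ℕ) (g : ConvergentSeries N) (hg : evalZero g = 0) :
    oneAddPow n g hg = (1 + g) ^ n := by
  have hs : PowerSeries.HasSubst g.1 := PowerSeries.HasSubst.of_constantCoeff_zero hg
  apply Subtype.ext
  change PowerSeries.subst g.1 (PowerSeries.binomialSeries ℂ (n : ℂ)) = _
  rw [PowerSeries.binomialSeries_nat, ← PowerSeries.coe_substAlgHom hs, map_pow, map_add, map_one,
    PowerSeries.substAlgHom_X]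
  rfl

theorem isUnit_iff {f : ConvergentSeries N} : IsUnit f ↔ evalZero f ≠ 0 := by
  refine ⟨fun h => (h.map evalZero).ne_zero, fun h => ?_⟩
  let g := algebraMap ℂ (ConvergentSeries N) (evalZero f)⁻¹ * f - 1
  have hg : evalZero g = 0 := by simp [g, h]
  have inverse : (1 + g) * oneAddPow (-1) g hg = 1 := by
    have one_eq := oneAddPow_natCast 1 g hg
    have zero_eq := oneAddPow_natCast 0 g hg
    push_cast at one_eq zero_eq
    rw [← pow_one (1 + g), ← one_eq, ← oneAddPow_add, add_neg_cancel, zero_eq, pow_zero]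
  have isUnit_mul : IsUnit (algebraMap ℂ (ConvergentSeries N) (evalZero f)⁻¹ * f) := by
    have := IsUnit.of_mul_eq_one _ inverse
    rwa [add_sub_cancel] at this
  exact (IsUnit.mul_iff.1 isUnit_mul).2

theorem exists_sq_eq_of_isUnit {u : ConvergentSeries N} (hu : IsUnit u) :
    ∃ s : ConvergentSeries N, s ^ 2 = u := by
  have h0 := isUnit_iff.1 hu
  obtain ⟨c, hc⟩ := IsAlgClosed.exists_pow_nat_eq (evalZero u) two_pos
  let g := algebraMap ℂ (ConvergentSeries N) (evalZero u)⁻¹ * u - 1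
  have hg : evalZero g = 0 := by simp [g, h0]
  have sqrt_sq : oneAddPow (1 / 2) g hg ^ 2 = 1 + g := by
    have one_eq := oneAddPow_natCast 1 g hg
    rw [sq, ← oneAddPow_add, add_halves, ← Nat.cast_one, one_eq, pow_one]
  refine ⟨algebraMap ℂ _ c * oneAddPow (1 / 2) g hg, ?_⟩
  rw [mul_pow, sqrt_sq, add_sub_cancel, ← map_pow, hc, ← mul_assoc, ← map_mul,
    mul_inv_cancel₀ h0, map_one, one_mul]

instance : IsLocalRing (ConvergentSeries N) :=
  IsLocalRing.of_nonunits_add fun a b ha hb => by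
    simp only [mem_nonunits_iff, isUnit_iff, not_not] at *
    rw [map_add, ha, hb, add_zero]

theorem mem_maximalIdeal_iff {f : ConvergentSeries N} :
    f ∈ maximalIdeal (ConvergentSeries N) ↔ evalZero f = 0 := by
  rw [mem_maximalIdeal, mem_nonunits_iff, isUnit_iff, not_not]

theorem maximalIdeal_eq_span :
    maximalIdeal (ConvergentSeries N) = Ideal.span (Set.range coord) := by
  rw [← ker_evalZero]
  ext f
  exact mem_maximalIdeal_iff

end ConvergentSeries

section FormalSum

variable {σ A : Type*}

/-- The sum of a sequence of power series `F n` of order at least `n`, for which only the terms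
`F 0, …, F |d|` contribute to the coefficient at `d`. -/
def formalSum [Semiring A] (F : ℕ → MvPowerSeries σ A) : MvPowerSeries σ A :=
  fun d => ∑ n ∈ Finset.range (d.degree + 1), coeff d (F n)

theorem coeff_formalSum [Semiring A] (F : ℕ → MvPowerSeries σ A) (d : σ →₀ ℕ) :
    coeff d (formalSum F) = ∑ n ∈ Finset.range (d.degree + 1), coeff d (F n) := rfl

theorem le_order_formalSum_sub [Ring A] {F : ℕ → MvPowerSeries σ A}
    (hF : ∀ n : ℕ, n ≤ (F n).order) (m : ℕ) :
    m ≤ (formalSum F - ∑ n ∈ Finset.range m, F n).order := by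
  refine nat_le_order fun d hd => ?_
  rw [map_sub, map_sum, coeff_formalSum, sub_eq_zero]
  refine Finset.sum_subset (Finset.range_subset_range.2 hd) fun n _ hn => coeff_of_lt_order ?_
  rw [Finset.mem_range] at hn
  exact lt_of_lt_of_le (by exact_mod_cast (by omega : d.degree < n)) (hF n)

theorem weightedNorm_formalSum_le [NormedCommRing A] (r : ℝ≥0) (F : ℕ → MvPowerSeries σ A) :
    weightedNorm r (formalSum F) ≤ ∑' n, weightedNorm r (F n) := by
  unfold weightedNorm
  rw [ENNReal.tsum_comm]
  refine ENNReal.tsum_le_tsum fun d => ?_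
  rw [ENNReal.tsum_mul_right, coeff_formalSum]
  gcongr
  exact (enorm_sum_le _ _).trans (ENNReal.sum_le_tsum _)

theorem hasRadius_formalSum_of_geometric [NormedCommRing A] {r : ℝ≥0} (hr : 0 < r)
    {F : ℕ → MvPowerSeries σ A} {x L : ℝ≥0} (hx : x < 1)
    (hF : ∀ n, weightedNorm r (F n) ≤ (x : ℝ≥0∞) ^ n * L) : HasRadius (formalSum F) := by
  refine ⟨r, hr, ne_top_of_le_ne_top ?_
    ((weightedNorm_formalSum_le r F).trans (ENNReal.tsum_le_tsum hF))⟩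
  rw [ENNReal.tsum_mul_right, ENNReal.tsum_geometric]
  refine ENNReal.mul_ne_top (ENNReal.inv_ne_top.2 (tsub_pos_of_lt ?_).ne') ENNReal.coe_ne_top
  exact_mod_cast hx

end FormalSum

namespace ConvergentSeries

section Order

variable {N k : ℕ}

/-- The ideal of convergent power series of order at least `m`. -/
def orderIdeal (N m : ℕ) : Ideal (ConvergentSeries N) where
  carrier := {f | (m : ℕ∞) ≤ f.1.order}
  zero_mem' := by simp
  add_mem' hf hg := (le_min hf hg).trans min_order_le_add
  smul_mem' f _ hg := (hg.trans le_add_self).trans (le_order_mul (f := f.1))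

theorem mem_orderIdeal {m : ℕ} {f : ConvergentSeries N} :
    f ∈ orderIdeal N m ↔ (m : ℕ∞) ≤ f.1.order := Iff.rfl

theorem eq_zero_of_forall_mem_orderIdeal {f : ConvergentSeries N}
    (h : ∀ m, f ∈ orderIdeal N m) : f = 0 :=
  Subtype.ext (order_eq_top_iff.1 (ENat.eq_top_iff_forall_ge.2 h))

theorem mul_mem_orderIdeal {m n : ℕ} {f g : ConvergentSeries N} (hf : f ∈ orderIdeal N m)
    (hg : g ∈ orderIdeal N n) : f * g ∈ orderIdeal N (m + n) := by
  rw [mem_orderIdeal, Nat.cast_add]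
  exact (add_le_add hf hg).trans le_order_mul

theorem mem_orderIdeal_one {f : ConvergentSeries N} : f ∈ orderIdeal N 1 ↔ evalZero f = 0 :=
  one_le_order_iff_constCoeff_eq_zero

theorem prod_mem_orderIdeal {n : ℕ} {g : Fin n → ConvergentSeries N}
    (hg : ∀ i, evalZero (g i) = 0) : ∏ i, g i ∈ orderIdeal N n := by
  induction n with
  | zero => simp [mem_orderIdeal]
  | succ n ih =>
    rw [Fin.prod_univ_castSucc]
    exact mul_mem_orderIdeal (ih fun i => hg i.castSucc) (mem_orderIdeal_one.2 (hg _))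

theorem substHom_mem_orderIdeal (b : Fin k → ConvergentSeries N) (hb : ∀ i, evalZero (b i) = 0)
    {m : ℕ} {f : ConvergentSeries k} (hf : f ∈ orderIdeal k m) :
    substHom b hb f ∈ orderIdeal N m := by
  have one_le : (1 : ℕ∞) ≤ ⨅ i, (b i).1.order :=
    le_iInf fun i => one_le_order_iff_constCoeff_eq_zero.2 (hb i)
  rw [mem_orderIdeal, coe_substHom]
  calc (m : ℕ∞) ≤ 1 * f.1.order := by rwa [one_mul]
    _ ≤ (⨅ i, (b i).1.order) * f.1.order := by gcongr
    _ ≤ _ := le_order_subst (hasSubst_of_constantCoeff_zero hb) f.1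

theorem exists_forall_sub_sum_mem_orderIdeal {F : ℕ → ConvergentSeries N}
    (hF : ∀ n, F n ∈ orderIdeal N n) {r : ℝ≥0} (hr : 0 < r) {x L : ℝ≥0} (hx : x < 1)
    (hbound : ∀ n, weightedNorm r (F n).1 ≤ (x : ℝ≥0∞) ^ n * L) :
    ∃ g, ∀ m, g - ∑ n ∈ Finset.range m, F n ∈ orderIdeal N m := by
  refine ⟨ofHasRadius (hasRadius_formalSum_of_geometric hr hx hbound), fun m => ?_⟩
  rw [mem_orderIdeal, Subalgebra.coe_sub, AddSubmonoidClass.coe_finsetSum]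
  exact le_order_formalSum_sub hF m

end Order

section Division

variable {N k : ℕ} (q : Fin N → Fin k → ConvergentSeries N) (K : ℕ)

/-- When `x i ^ K = ∑ j, b j * q i j` up to an error term, the quotient of `f` by `b j`. -/
def quotientBy (j : Fin k) (f : ConvergentSeries N) : ConvergentSeries N :=
  ∑ i, q i j * divCoordPow K i f

/-- The iterated quotient of `f` by `b (w (n - 1))`, …, `b (w 0)`. -/
def iteratedQuotient (f : ConvergentSeries N) : (n : ℕ) → (Fin n → Fin k) → ConvergentSeries N
  | 0, _ => f
  | n + 1, w => quotientBy q K (w 0) (iteratedQuotient f n (Fin.tail w))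

/-- The homogeneous part of degree `n` of the `e`-th coefficient, a power series in the `b j`, of
the remainder. -/
def remainderPart (f : ConvergentSeries N) (e : Fin N →₀ ℕ) (n : ℕ) : ConvergentSeries k :=
  ∑ w : Fin n → Fin k, coeff e (iteratedQuotient q K f n w).1 • ∏ i, coord (w i)

/-- The contribution of the `n`-th division step to the factor of the `i`-th error term. -/
def errorPart (b : Fin k → ConvergentSeries N) (f : ConvergentSeries N) (i : Fin N) (n : ℕ) :
    ConvergentSeries N :=
  ∑ w : Fin n → Fin k, (∏ l, b (w l)) * divCoordPow K i (iteratedQuotient q K f n w)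

theorem sum_prod_mul_iteratedQuotient_succ (b : Fin k → ConvergentSeries N)
    (f : ConvergentSeries N) (n : ℕ) :
    ∑ w : Fin (n + 1) → Fin k, (∏ i, b (w i)) * iteratedQuotient q K f (n + 1) w =
      ∑ w : Fin n → Fin k,
        (∏ i, b (w i)) * ∑ j, b j * quotientBy q K j (iteratedQuotient q K f n w) := by
  rw [← (Fin.consEquiv fun _ : Fin (n + 1) => Fin k).sum_comp, Fintype.sum_prod_type,
    Finset.sum_comm]
  refine Finset.sum_congr rfl fun w _ => ?_
  rw [Finset.mul_sum]
  refine Finset.sum_congr rfl fun j _ => ?_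
  rw [Fin.prod_univ_succ]
  change b j * (∏ i, b (w i)) * quotientBy q K j (iteratedQuotient q K f n w) = _
  ring

theorem eq_sum_monomial_add_sum_mul_quotientBy {q} {K} {b : Fin k → ConvergentSeries N}
    {c : Fin N → ConvergentSeries N} (hq : ∀ i, coord i ^ K = ∑ j, b j * q i j + c i)
    (f : ConvergentSeries N) :
    f = ∑ e : Fin N → Fin K,
          algebraMap ℂ _ (coeff (boxExponent e) f.1) * monomial (boxExponent e) +
        ∑ i, c i * divCoordPow K i f + ∑ j, b j * quotientBy q K j f := by
  have sum_coord_pow : ∑ i, coord i ^ K * divCoordPow K i f =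
      ∑ i, c i * divCoordPow K i f + ∑ j, b j * quotientBy q K j f := by
    simp only [hq, quotientBy, add_mul, Finset.sum_add_distrib, Finset.mul_sum, Finset.sum_mul,
      mul_assoc]
    rw [add_comm, Finset.sum_comm]
  rw [add_assoc, ← sum_coord_pow]
  simpa only [Algebra.smul_def] using eq_sum_monomial_add_sum_coord_pow_mul_divCoordPow K f

theorem eq_sum_remainderPart_add_errorPart {q} {K} {b : Fin k → ConvergentSeries N}
    (hb : ∀ i, evalZero (b i) = 0) {c : Fin N → ConvergentSeries N}
    (hq : ∀ i, coord i ^ K = ∑ j, b j * q i j + c i) (f : ConvergentSeries N) (m : ℕ) :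
    f = ∑ n ∈ Finset.range m, (∑ e : Fin N → Fin K,
          substHom b hb (remainderPart q K f (boxExponent e) n) * monomial (boxExponent e) +
          ∑ i, c i * errorPart q K b f i n) +
        ∑ w : Fin m → Fin k, (∏ i, b (w i)) * iteratedQuotient q K f m w := by
  induction m with
  | zero => simp [iteratedQuotient]
  | succ m ih =>
    have division_step : ∑ w : Fin m → Fin k, (∏ i, b (w i)) * iteratedQuotient q K f m w =
        ∑ e : Fin N → Fin K,
          substHom b hb (remainderPart q K f (boxExponent e) m) * monomial (boxExponent e) +
        ∑ i, c i * errorPart q K b f i m +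
        ∑ w : Fin (m + 1) → Fin k, (∏ i, b (w i)) * iteratedQuotient q K f (m + 1) w := by
      rw [sum_prod_mul_iteratedQuotient_succ]
      simp only [remainderPart, errorPart, map_sum, map_smul, map_prod, substHom_coord,
        Finset.sum_mul, Finset.mul_sum (s := (Finset.univ : Finset (Fin m → Fin k)))]
      rw [Finset.sum_comm, Finset.sum_comm (s := (Finset.univ : Finset (Fin N))),
        ← Finset.sum_add_distrib, ← Finset.sum_add_distrib]
      refine Finset.sum_congr rfl fun w _ => ?_
      conv_lhs => rw [eq_sum_monomial_add_sum_mul_quotientBy hq (iteratedQuotient q K f m w)]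
      simp only [mul_add, Finset.mul_sum, Algebra.smul_def, mul_left_comm, mul_assoc]
    rw [Finset.sum_range_succ, add_assoc, ← division_step]
    exact ih

theorem remainderPart_mem_orderIdeal (f : ConvergentSeries N) (e : Fin N →₀ ℕ) (n : ℕ) :
    remainderPart q K f e n ∈ orderIdeal k n :=
  Ideal.sum_mem _ fun w _ => by
    rw [Algebra.smul_def]
    exact Ideal.mul_mem_left _ _ (prod_mem_orderIdeal fun i => evalZero_coord _)

theorem errorPart_mem_orderIdeal {b : Fin k → ConvergentSeries N} (hb : ∀ i, evalZero (b i) = 0)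
    (f : ConvergentSeries N) (i : Fin N) (n : ℕ) : errorPart q K b f i n ∈ orderIdeal N n :=
  Ideal.sum_mem _ fun _ _ => Ideal.mul_mem_right _ _ (prod_mem_orderIdeal fun _ => hb _)

theorem weightedNorm_coord (r : ℝ≥0) (i : Fin N) : weightedNorm r (coord i).1 = r :=
  (weightedNorm_monomial r (Finsupp.single i 1) 1).trans (by simp)

theorem weightedNorm_prod_le_pow {n : ℕ} {r : ℝ≥0} {ρ : ℝ≥0∞} {g : Fin n → ConvergentSeries N}
    (hg : ∀ i, weightedNorm r (g i).1 ≤ ρ) : weightedNorm r (∏ i, g i).1 ≤ ρ ^ n := by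
  rw [show (∏ i, g i).1 = ∏ i, (g i).1 from map_prod (ConvergentSeries N).val g Finset.univ]
  calc weightedNorm r (∏ i, (g i).1) ≤ ∏ i, weightedNorm r (g i).1 := weightedNorm_prod_le _ _ _
    _ ≤ ∏ _i : Fin n, ρ := Finset.prod_le_prod' fun i _ => hg i
    _ = ρ ^ n := by simp

theorem weightedNorm_divCoordPow_le {r : ℝ≥0} (hr : 0 < r) (i : Fin N) (f : ConvergentSeries N) :
    weightedNorm r (divCoordPow K i f).1 ≤ ((r : ℝ≥0∞) ^ K)⁻¹ * weightedNorm r f.1 := by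
  have pow_ne_zero : (r : ℝ≥0∞) ^ K ≠ 0 := by positivity
  rw [mul_comm, ← div_eq_mul_inv,
    ENNReal.le_div_iff_mul_le (Or.inl pow_ne_zero) (Or.inl (by finiteness)), mul_comm]
  exact pow_mul_weightedNorm_divXPow_le r K i f.1

theorem exists_weightedNorm_quotientBy_le {r : ℝ≥0} (hr : 0 < r)
    (hq : ∀ i j, weightedNorm r (q i j).1 ≠ ⊤) :
    ∃ C : ℝ≥0, ∀ (j : Fin k) (f : ConvergentSeries N),
      weightedNorm r (quotientBy q K j f).1 ≤ C * weightedNorm r f.1 := by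
  let C : ℝ≥0∞ := ∑ i, ∑ j, weightedNorm r (q i j).1 * ((r : ℝ≥0∞) ^ K)⁻¹
  have C_ne_top : C ≠ ⊤ := ENNReal.sum_ne_top.2 fun i _ => ENNReal.sum_ne_top.2 fun j _ =>
    ENNReal.mul_ne_top (hq i j) (ENNReal.inv_ne_top.2 (by positivity))
  refine ⟨C.toNNReal, fun j f => ?_⟩
  rw [ENNReal.coe_toNNReal C_ne_top, quotientBy, AddSubmonoidClass.coe_finsetSum, Finset.sum_mul]
  refine (weightedNorm_sum_le _ _ _).trans (Finset.sum_le_sum fun i _ => ?_)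
  calc weightedNorm r (q i j * divCoordPow K i f).1
      ≤ weightedNorm r (q i j).1 * (((r : ℝ≥0∞) ^ K)⁻¹ * weightedNorm r f.1) :=
        (weightedNorm_mul_le _ _ _).trans (by gcongr; exact weightedNorm_divCoordPow_le K hr i f)
    _ = (weightedNorm r (q i j).1 * ((r : ℝ≥0∞) ^ K)⁻¹) * weightedNorm r f.1 := by ring
    _ ≤ _ := by
        gcongr
        exact Finset.single_le_sum (f := fun j => weightedNorm r (q i j).1 * ((r : ℝ≥0∞) ^ K)⁻¹)
          (fun _ _ => zero_le) (Finset.mem_univ j)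

theorem exists_weightedNorm_iteratedQuotient_le (f : ConvergentSeries N) :
    ∃ r C L : ℝ≥0, 0 < r ∧ ∀ (n : ℕ) (w : Fin n → Fin k),
      weightedNorm r (iteratedQuotient q K f n w).1 ≤ (C : ℝ≥0∞) ^ n * L := by
  obtain ⟨r, ⟨hq, hf⟩, hr⟩ := (((eventually_all.2 fun i => eventually_all.2 fun j =>
    (hasRadius (q i j)).eventually_weightedNorm_ne_top).and
    (hasRadius f).eventually_weightedNorm_ne_top).and self_mem_nhdsWithin).exists
  obtain ⟨C, hC⟩ := exists_weightedNorm_quotientBy_le q K hr hq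
  refine ⟨r, C, (weightedNorm r f.1).toNNReal, hr, fun n w => ?_⟩
  rw [ENNReal.coe_toNNReal hf]
  induction n with
  | zero => simp [iteratedQuotient]
  | succ n ih =>
    rw [iteratedQuotient, pow_succ', mul_assoc]
    exact (hC _ _).trans (by gcongr; exact ih _)

theorem weightedNorm_sum_words_le {n : ℕ} {r : ℝ≥0} {C ρ L : ℝ≥0}
    {g : (Fin n → Fin k) → ConvergentSeries N}
    (hg : ∀ w, weightedNorm r (g w).1 ≤ (C : ℝ≥0∞) ^ n * L * (ρ : ℝ≥0∞) ^ n) :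
    weightedNorm r (∑ w, g w).1 ≤ ((k * C * ρ : ℝ≥0) : ℝ≥0∞) ^ n * L := by
  rw [AddSubmonoidClass.coe_finsetSum]
  calc weightedNorm r (∑ w, (g w).1) ≤ ∑ w, weightedNorm r (g w).1 := weightedNorm_sum_le _ _ _
    _ ≤ Fintype.card (Fin n → Fin k) • ((C : ℝ≥0∞) ^ n * L * (ρ : ℝ≥0∞) ^ n) :=
        Finset.sum_le_card_nsmul _ _ _ fun w _ => hg w
    _ = _ := by
        rw [Fintype.card_fun, Fintype.card_fin, Fintype.card_fin, nsmul_eq_mul]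
        push_cast
        ring

theorem eventually_mul_lt_one (a : ℝ≥0) : ∀ᶠ ρ in 𝓝[>] (0 : ℝ≥0), a * ρ < 1 := by
  have tendsto_zero : Tendsto (fun ρ : ℝ≥0 => a * ρ) (𝓝 0) (𝓝 0) :=
    Continuous.tendsto' (by fun_prop) _ _ (mul_zero a)
  exact (tendsto_zero.mono_left nhdsWithin_le_nhds).eventually_lt_const one_pos

theorem exists_forall_sub_sum_remainderPart_mem (f : ConvergentSeries N) (e : Fin N →₀ ℕ) :
    ∃ A, ∀ m, A - ∑ n ∈ Finset.range m, remainderPart q K f e n ∈ orderIdeal k m := by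
  obtain ⟨r, C, L, hr, bound⟩ := exists_weightedNorm_iteratedQuotient_le q K f
  obtain ⟨ρ, hρ, hρ₀⟩ := ((eventually_mul_lt_one (k * C)).and self_mem_nhdsWithin).exists
  refine exists_forall_sub_sum_mem_orderIdeal (L := L * (r ^ e.degree)⁻¹)
    (remainderPart_mem_orderIdeal q K f e) hρ₀ hρ fun n =>
    weightedNorm_sum_words_le fun w => ?_
  rw [Subalgebra.coe_smul, ENNReal.coe_mul, ENNReal.coe_inv (by positivity), ← mul_assoc]
  refine (weightedNorm_smul_le _ _ _).trans ?_
  gcongr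
  · rw [← div_eq_mul_inv,
      ENNReal.le_div_iff_mul_le (Or.inl (by positivity)) (Or.inl (by finiteness))]
    exact_mod_cast (enorm_coeff_mul_le_weightedNorm _ _ _).trans (bound n w)
  · exact weightedNorm_prod_le_pow fun i => (weightedNorm_coord _ _).le

theorem exists_forall_sub_sum_errorPart_mem {b : Fin k → ConvergentSeries N}
    (hb : ∀ i, evalZero (b i) = 0) (f : ConvergentSeries N) (i : Fin N) :
    ∃ D, ∀ m, D - ∑ n ∈ Finset.range m, errorPart q K b f i n ∈ orderIdeal N m := by
  obtain ⟨r, C, L, hr, bound⟩ := exists_weightedNorm_iteratedQuotient_le q K f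
  obtain ⟨ρ, hρ, hρ₀ : 0 < ρ⟩ := ((eventually_mul_lt_one (k * C)).and self_mem_nhdsWithin).exists
  obtain ⟨s, ⟨hbs, hsr⟩, hs⟩ := (((eventually_all.2 fun j =>
    (hasRadius (b j)).eventually_weightedNorm_le (hb j) hρ₀).and
    (Ioc_mem_nhdsGT hr)).and self_mem_nhdsWithin).exists
  refine exists_forall_sub_sum_mem_orderIdeal (L := (r ^ K)⁻¹ * L)
    (errorPart_mem_orderIdeal q K hb f i) hs hρ fun n => weightedNorm_sum_words_le fun w => ?_
  calc _ ≤ (ρ : ℝ≥0∞) ^ n * (((r : ℝ≥0∞) ^ K)⁻¹ * ((C : ℝ≥0∞) ^ n * L)) := by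
        refine (weightedNorm_mul_le _ _ _).trans ?_
        gcongr
        · exact weightedNorm_prod_le_pow fun i => hbs _
        · refine (weightedNorm_mono hsr.2 _).trans ((weightedNorm_divCoordPow_le K hr _ _).trans ?_)
          gcongr
          exact bound n w
    _ = _ := by
        rw [ENNReal.coe_mul, ENNReal.coe_inv (by positivity), ENNReal.coe_pow]
        ring

/-- Quasi-finite analytic maps are finite: a form of the Weierstrass preparation theorem. -/
theorem exists_sub_sum_substHom_mul_monomial_mem {K} {b : Fin k → ConvergentSeries N}
    (hb : ∀ i, evalZero (b i) = 0) {I : Ideal (ConvergentSeries N)}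
    (hI : ∀ i, coord i ^ K ∈ Ideal.span (Set.range b) ⊔ I) (f : ConvergentSeries N) :
    ∃ A : (Fin N → Fin K) → ConvergentSeries k,
      f - ∑ e, substHom b hb (A e) * monomial (boxExponent e) ∈ I := by
  have coord_pow_eq : ∀ i, ∃ (q : Fin k → ConvergentSeries N) (c : ConvergentSeries N),
      c ∈ I ∧ coord i ^ K = ∑ j, b j * q j + c := by
    intro i
    obtain ⟨g, hg, c, hc, h⟩ := Submodule.mem_sup.1 (hI i)
    obtain ⟨q, hq⟩ := Ideal.mem_span_range_iff_exists_fun.1 hg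
    exact ⟨q, c, hc, by simp only [← h, ← hq, mul_comm]⟩
  choose q c hc hq using coord_pow_eq
  choose A hA using fun e : Fin N → Fin K =>
    exists_forall_sub_sum_remainderPart_mem q K f (boxExponent e)
  choose D hD using exists_forall_sub_sum_errorPart_mem q K hb f
  refine ⟨A, ?_⟩
  suffices h : f - ∑ e, substHom b hb (A e) * monomial (boxExponent e) - ∑ i, c i * D i = 0 by
    rw [sub_eq_zero.1 h]
    exact Ideal.sum_mem _ fun i _ => Ideal.mul_mem_right _ _ (hc i)
  refine eq_zero_of_forall_mem_orderIdeal fun m => ?_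
  have truncation : f - ∑ e, substHom b hb (A e) * monomial (boxExponent e) - ∑ i, c i * D i =
      (∑ w : Fin m → Fin k, (∏ i, b (w i)) * iteratedQuotient q K f m w)
      - ∑ e, substHom b hb (A e - ∑ n ∈ Finset.range m, remainderPart q K f (boxExponent e) n) *
          monomial (boxExponent e)
      - ∑ i, c i * (D i - ∑ n ∈ Finset.range m, errorPart q K b f i n) := by
    conv_lhs => rw [eq_sum_remainderPart_add_errorPart hb hq f m]
    simp only [map_sub, map_sum, sub_mul, mul_sub, Finset.sum_sub_distrib, Finset.sum_add_distrib,
      Finset.sum_mul, Finset.mul_sum]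
    rw [Finset.sum_comm, Finset.sum_comm (s := Finset.range m)]
    ring
  rw [truncation]
  refine sub_mem (sub_mem (sum_mem fun w _ => ?_) (sum_mem fun e _ => ?_)) (sum_mem fun i _ => ?_)
  · exact Ideal.mul_mem_right _ _ (prod_mem_orderIdeal fun i => hb _)
  · exact Ideal.mul_mem_right _ _ (substHom_mem_orderIdeal b hb (hA e m))
  · exact Ideal.mul_mem_left _ _ (hD i m)

end Division

end ConvergentSeries

section CommRing

variable {R : Type*} [CommRing R]

theorem aeval_smul_eq_eval_smul_pow {σ A : Type*} [CommRing A] [Algebra R A]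
    {F : MvPolynomial σ R} {m : ℕ} (hF : F.IsHomogeneous m) (c : σ → R) (s : A) :
    MvPolynomial.aeval (fun i => c i • s) F = MvPolynomial.eval c F • s ^ m := by
  rw [MvPolynomial.aeval_def, MvPolynomial.eval₂_eq, MvPolynomial.eval_eq, Finset.sum_smul]
  refine Finset.sum_congr rfl fun d hd => ?_
  have hdeg : ∑ i ∈ d.support, d i = m := by
    rw [← Finsupp.degree_apply, Finsupp.degree_eq_weight_one]
    exact hF (MvPolynomial.mem_support_iff.1 hd)
  simp only [smul_pow, Finset.prod_smul, Finset.prod_pow_eq_pow_sum, hdeg, ← Algebra.smul_def,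
    mul_smul]

theorem sup_pow_le_sup_pow (I J : Ideal R) (m : ℕ) : (I ⊔ J) ^ m ≤ I ⊔ J ^ m := by
  induction m with
  | zero => simp
  | succ m ih =>
    calc (I ⊔ J) ^ (m + 1) ≤ (I ⊔ J ^ m) * (I ⊔ J) := Ideal.mul_mono_left ih
      _ = I * (I ⊔ J) ⊔ (J ^ m * I ⊔ J ^ (m + 1)) := by
        rw [Ideal.sup_mul, Ideal.mul_sup (J ^ m), pow_succ]
      _ ≤ I ⊔ J ^ (m + 1) := sup_le (Ideal.mul_le_left.trans le_sup_left)
        (sup_le_sup_right Ideal.mul_le_right _)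

theorem isNoetherianRing_of_forall_quotient_span_singleton
    (h : ∀ g : R, g ≠ 0 → ¬IsUnit g → IsNoetherianRing (R ⧸ Ideal.span {g})) :
    IsNoetherianRing R := by
  refine (isNoetherianRing_iff_ideal_fg R).2 fun I => ?_
  rcases eq_or_ne I ⊥ with rfl | hI
  · exact Submodule.fg_bot
  obtain ⟨g, hgI, hg⟩ := Submodule.exists_mem_ne_zero_of_ne_bot hI
  by_cases hu : IsUnit g
  · rw [Ideal.eq_top_of_isUnit_mem I hgI hu]
    exact Ideal.fg_top R
  have := h g hg hu
  refine Ideal.fg_of_fg_map_of_fg_inf_ker_of_surjective (f := Ideal.Quotient.mk (Ideal.span {g}))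
    (IsNoetherian.noetherian _) ?_ Ideal.Quotient.mk_surjective
  rw [Ideal.mk_ker, inf_eq_right.2 ((Ideal.span_singleton_le_iff_mem I).2 hgI)]
  exact Submodule.fg_span_singleton g

theorem exists_maximalIdeal_pow_le_span_singleton [IsLocalRing R] [IsNoetherianRing R]
    (hdim : ringKrullDim R ≤ 1) :
    ∃ x ∈ maximalIdeal R, ∃ K, maximalIdeal R ^ K ≤ Ideal.span {x} := by
  obtain ⟨s, hs, hcard⟩ :=
    (maximalIdeal R).exists_finset_card_eq_height_of_isNoetherianRing
  have hcard_le : s.card ≤ 1 := by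
    rw [← maximalIdeal_height_eq_ringKrullDim, ← hcard] at hdim
    exact_mod_cast hdim
  have hradical : (Ideal.span (s : Set R)).radical = maximalIdeal R := by
    rw [Ideal.radical_eq_sInf]
    refine le_antisymm (sInf_le ⟨hs.1.2, inferInstance⟩) (le_sInf fun P hP => ?_)
    exact hs.2 ⟨hP.2, hP.1⟩ (le_maximalIdeal hP.2.ne_top)
  obtain ⟨K, hK⟩ := Ideal.exists_radical_pow_le_of_fg (Ideal.span (s : Set R))
    (IsNoetherian.noetherian _)
  rw [hradical] at hK
  obtain ⟨x, hx⟩ := Finset.card_le_one_iff_subset_singleton.1 hcard_le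
  rcases Finset.subset_singleton_iff.1 hx with rfl | rfl
  · exact ⟨0, zero_mem _, K, hK.trans (Ideal.span_mono (by simp))⟩
  · exact ⟨x, hs.1.2 (Ideal.subset_span (by simp)), K, by simpa using hK⟩

end CommRing

namespace ConvergentSeries

variable {N k n : ℕ}

section InitialForm

theorem coe_aeval_coord (p : MvPolynomial (Fin N) ℂ) :
    (MvPolynomial.aeval coord p : ConvergentSeries N).1 = p := by
  have h : (ConvergentSeries N).val.comp (MvPolynomial.aeval coord) =
      MvPolynomial.coeToMvPowerSeries.algHom ℂ := by
    refine MvPolynomial.algHom_ext fun i => ?_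
    simp [coord]
  simpa using DFunLike.congr_fun h p

theorem sub_aeval_truncTotal_mem_orderIdeal (m : ℕ) (f : ConvergentSeries N) :
    f - MvPolynomial.aeval coord (truncTotal m f.1) ∈ orderIdeal N m := by
  refine nat_le_order fun d hd => ?_
  rw [Subalgebra.coe_sub, coe_aeval_coord, map_sub, MvPolynomial.coeff_coe, coeff_truncTotal _ hd,
    sub_self]

theorem orderIdeal_le_maximalIdeal_pow (N m : ℕ) :
    orderIdeal N m ≤ maximalIdeal (ConvergentSeries N) ^ m := by
  induction m with
  | zero => simp
  | succ m ih =>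
    intro f hf
    have h0 : evalZero f = 0 := by
      refine one_le_order_iff_constCoeff_eq_zero.1 (le_trans ?_ (mem_orderIdeal.1 hf))
      exact_mod_cast Nat.succ_pos m
    rw [eq_algebraMap_add_sum_coord_mul f, h0, map_zero, zero_add, pow_succ']
    refine Ideal.sum_mem _ fun i _ => Ideal.mul_mem_mul
      (mem_maximalIdeal_iff.2 (evalZero_coord i)) (ih (nat_le_order fun d hd => ?_))
    change coeff d (divXPow 1 i f.1) = 0
    rw [coeff_divXPow]
    split_ifs
    · refine coeff_of_lt_order (lt_of_lt_of_le ?_ (mem_orderIdeal.1 hf))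
      rw [map_add, Finsupp.degree_single]
      exact_mod_cast Nat.succ_lt_succ hd
    · rfl

theorem sub_aeval_truncTotal_mem_maximalIdeal_pow (m : ℕ) (f : ConvergentSeries N) :
    f - MvPolynomial.aeval coord (truncTotal m f.1) ∈ maximalIdeal (ConvergentSeries N) ^ m :=
  orderIdeal_le_maximalIdeal_pow N m (sub_aeval_truncTotal_mem_orderIdeal m f)

theorem exists_isHomogeneous_sub_aeval_mem {f : ConvergentSeries N} (hf : f ≠ 0) :
    ∃ (K : ℕ) (F : MvPolynomial (Fin N) ℂ), F.IsHomogeneous K ∧ F ≠ 0 ∧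
      f - MvPolynomial.aeval coord F ∈ maximalIdeal (ConvergentSeries N) ^ (K + 1) := by
  obtain ⟨K, hK⟩ := ENat.ne_top_iff_exists.1 (mt order_eq_top_iff.1 fun h => hf (Subtype.ext h))
  refine ⟨K, truncTotal (K + 1) f.1, fun d hd => ?_, fun h => ?_,
    sub_aeval_truncTotal_mem_maximalIdeal_pow _ f⟩
  · rw [coeff_truncTotal_eq_ite, ne_eq, ite_eq_right_iff, Classical.not_imp] at hd
    have order_le : K ≤ d.degree := by
      by_contra! hlt
      exact hd.2 (coeff_of_lt_order (by rw [← hK]; exact_mod_cast hlt))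
    change Finsupp.weight (fun _ => 1) d = K
    rw [← Finsupp.degree_eq_weight_one]
    exact le_antisymm (Nat.lt_succ_iff.1 hd.1) order_le
  · obtain ⟨d, hd, hdK⟩ := exists_coeff_ne_zero_and_order (f := f.1) (by rw [← hK]; rfl)
    rw [← hK, Nat.cast_inj] at hdK
    have hcoeff := congrArg (MvPolynomial.coeff d) h
    rw [coeff_truncTotal _ (by omega)] at hcoeff
    exact hd hcoeff

end InitialForm

section LinearForms

theorem exists_coord_sub_smul_mem_span_range {c : Fin (n + 1) → ℂ} (hc : c ≠ 0) :
    ∃ (l : Fin n → ConvergentSeries (n + 1)) (s : ConvergentSeries (n + 1)),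
      (∀ j, evalZero (l j) = 0) ∧ ∀ i, coord i - c i • s ∈ Ideal.span (Set.range l) := by
  obtain ⟨i₀, hi₀⟩ := Function.ne_iff.1 hc
  rw [Pi.zero_apply] at hi₀
  refine ⟨fun j => coord (i₀.succAbove j) - c (i₀.succAbove j) • (c i₀)⁻¹ • coord i₀,
    (c i₀)⁻¹ • coord i₀, fun j => by simp, fun i => ?_⟩
  rcases Fin.eq_self_or_eq_succAbove i₀ i with rfl | ⟨j, rfl⟩
  · simp [smul_smul, hi₀]
  · exact Ideal.subset_span ⟨j, rfl⟩

variable {c : Fin N → ℂ} {s : ConvergentSeries N} {J : Ideal (ConvergentSeries N)}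

theorem maximalIdeal_le_sup_span_singleton (hJ : ∀ i, coord i - c i • s ∈ J) :
    maximalIdeal (ConvergentSeries N) ≤ J ⊔ Ideal.span {s} := by
  rw [maximalIdeal_eq_span, Ideal.span_le]
  rintro _ ⟨i, rfl⟩
  rw [← sub_add_cancel (coord i) (c i • s)]
  refine Submodule.add_mem_sup (hJ i) ?_
  rw [Algebra.smul_def]
  exact Ideal.mul_mem_left _ _ (Ideal.mem_span_singleton_self s)

theorem aeval_coord_sub_eval_smul_pow_mem (hJ : ∀ i, coord i - c i • s ∈ J)
    {F : MvPolynomial (Fin N) ℂ} {m : ℕ} (hF : F.IsHomogeneous m) :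
    MvPolynomial.aeval coord F - MvPolynomial.eval c F • s ^ m ∈ J := by
  rw [← aeval_smul_eq_eval_smul_pow hF, ← Ideal.Quotient.eq]
  have h : (Ideal.Quotient.mkₐ ℂ J).comp (MvPolynomial.aeval coord) =
      (Ideal.Quotient.mkₐ ℂ J).comp (MvPolynomial.aeval fun i => c i • s) := by
    refine MvPolynomial.algHom_ext fun i => ?_
    simp only [AlgHom.comp_apply, MvPolynomial.aeval_X]
    exact Ideal.Quotient.eq.2 (hJ i)
  exact DFunLike.congr_fun h F

theorem maximalIdeal_pow_le_sup_span_singleton (hJ : ∀ i, coord i - c i • s ∈ J)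
    {F : MvPolynomial (Fin N) ℂ} {m : ℕ} (hF : F.IsHomogeneous m)
    (hFc : MvPolynomial.eval c F ≠ 0) {g : ConvergentSeries N}
    (hg : g - MvPolynomial.aeval coord F ∈ maximalIdeal (ConvergentSeries N) ^ (m + 1)) :
    maximalIdeal (ConvergentSeries N) ^ m ≤ J ⊔ Ideal.span {g} := by
  have hfg : (maximalIdeal (ConvergentSeries N)).FG := by
    rw [maximalIdeal_eq_span]
    exact Submodule.fg_span (Set.finite_range _)
  have smul_mem : MvPolynomial.eval c F • s ^ m ∈ J ⊔ Ideal.span {g} ⊔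
      maximalIdeal (ConvergentSeries N) ^ (m + 1) := by
    have h : MvPolynomial.eval c F • s ^ m =
        (-(MvPolynomial.aeval coord F - MvPolynomial.eval c F • s ^ m) + g) +
          -(g - MvPolynomial.aeval coord F) := by ring
    rw [h]
    exact Submodule.add_mem_sup (Submodule.add_mem_sup
      (neg_mem (aeval_coord_sub_eval_smul_pow_mem hJ hF)) (Ideal.mem_span_singleton_self g))
      (neg_mem hg)
  have pow_mem : s ^ m ∈ J ⊔ Ideal.span {g} ⊔ maximalIdeal (ConvergentSeries N) ^ (m + 1) := by
    rw [← inv_smul_smul₀ hFc (s ^ m), Algebra.smul_def]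
    exact Ideal.mul_mem_left _ _ smul_mem
  refine Submodule.le_of_le_smul_of_le_jacobson_bot hfg.pow (maximalIdeal_le_jacobson _) ?_
  calc maximalIdeal (ConvergentSeries N) ^ m ≤ (J ⊔ Ideal.span {s}) ^ m :=
        Ideal.pow_right_mono (maximalIdeal_le_sup_span_singleton hJ) m
    _ ≤ J ⊔ Ideal.span {s ^ m} := by
        rw [← Ideal.span_singleton_pow]
        exact sup_pow_le_sup_pow _ _ m
    _ ≤ J ⊔ Ideal.span {g} ⊔ maximalIdeal (ConvergentSeries N) ^ (m + 1) :=
        sup_le (le_sup_left.trans le_sup_left) ((Ideal.span_singleton_le_iff_mem _).2 pow_mem)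
    _ = _ := by rw [smul_eq_mul, pow_succ']

theorem exists_maximalIdeal_pow_le_span_range_sup {g : ConvergentSeries (n + 1)} (hg : g ≠ 0)
    (hg0 : evalZero g = 0) :
    ∃ l : Fin n → ConvergentSeries (n + 1), (∀ j, evalZero (l j) = 0) ∧
      ∃ K, maximalIdeal (ConvergentSeries (n + 1)) ^ K ≤
        Ideal.span (Set.range l) ⊔ Ideal.span {g} := by
  obtain ⟨K, F, hF, hF0, hgF⟩ := exists_isHomogeneous_sub_aeval_mem hg
  obtain ⟨c, hFc⟩ : ∃ c, MvPolynomial.eval c F ≠ 0 := by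
    by_contra! h
    exact hF0 (hF.eq_zero_of_forall_eval_eq_zero h)
  have hc : c ≠ 0 := by
    rintro rfl
    have hF0 := mem_maximalIdeal_iff.1 (Ideal.pow_le_self (Nat.succ_ne_zero K) hgF)
    rw [map_sub, hg0, zero_sub, neg_eq_zero, ← AlgHom.comp_apply, MvPolynomial.comp_aeval] at hF0
    simp only [evalZero_coord] at hF0
    exact hFc hF0
  obtain ⟨l, s, hl, hls⟩ := exists_coord_sub_smul_mem_span_range hc
  exact ⟨l, hl, K, maximalIdeal_pow_le_sup_span_singleton hls hF hFc hgF⟩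

end LinearForms

section Noetherian

variable {O : Type*} [CommRing O] [Algebra ℂ O]

theorem finite_comp_substHom {π : ConvergentSeries N →ₐ[ℂ] O} (hπ : Function.Surjective π)
    {b : Fin k → ConvergentSeries N} (hb : ∀ i, evalZero (b i) = 0) {K : ℕ}
    (hK : maximalIdeal (ConvergentSeries N) ^ K ≤ Ideal.span (Set.range b) ⊔ RingHom.ker π) :
    (π.comp (substHom b hb)).toRingHom.Finite := by
  algebraize [(π.comp (substHom b hb)).toRingHom]
  refine ⟨Submodule.fg_def.2 ⟨Set.range fun e : Fin N → Fin K => π (monomial (boxExponent e)),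
    Set.finite_range _, eq_top_iff.2 ?_⟩⟩
  rintro x -
  obtain ⟨f, rfl⟩ := hπ x
  obtain ⟨A, hA⟩ := exists_sub_sum_substHom_mul_monomial_mem hb
    (fun i => hK (Ideal.pow_mem_pow (mem_maximalIdeal_iff.2 (evalZero_coord i)) K)) f
  rw [RingHom.mem_ker, map_sub, sub_eq_zero] at hA
  rw [hA, map_sum]
  refine Submodule.sum_mem _ fun e _ => ?_
  have h : π (substHom b hb (A e) * monomial (boxExponent e)) =
      A e • π (monomial (boxExponent e)) := by
    rw [map_mul, Algebra.smul_def]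
    rfl
  rw [h]
  exact Submodule.smul_mem _ _ (Submodule.subset_span ⟨e, rfl⟩)

theorem isNoetherianRing_of_map_eq_zero [IsNoetherianRing (ConvergentSeries n)]
    {π : ConvergentSeries (n + 1) →ₐ[ℂ] O} (hπ : Function.Surjective π)
    {g : ConvergentSeries (n + 1)} (hg : g ≠ 0) (hg0 : evalZero g = 0) (hπg : π g = 0) :
    IsNoetherianRing O := by
  obtain ⟨l, hl, K, hK⟩ := exists_maximalIdeal_pow_le_span_range_sup hg hg0
  have hker : Ideal.span {g} ≤ RingHom.ker π := (Ideal.span_singleton_le_iff_mem _).2 hπg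
  obtain ⟨φ, hφ⟩ : ∃ φ : ConvergentSeries n →+* O, φ.Finite :=
    ⟨_, finite_comp_substHom hπ hl (hK.trans (sup_le_sup_left hker _))⟩
  algebraize [φ]
  exact IsNoetherianRing.of_finite (ConvergentSeries n) O

instance : IsNoetherianRing (ConvergentSeries N) := by
  induction N with
  | zero =>
    refine isNoetherianRing_of_forall_quotient_span_singleton fun g hg hu => absurd ?_ hg
    rw [isUnit_iff, not_not] at hu
    rw [eq_algebraMap_add_sum_coord_mul g, hu]
    simp
  | succ n ih =>
    refine isNoetherianRing_of_forall_quotient_span_singleton fun g hg hu => ?_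
    rw [isUnit_iff, not_not] at hu
    exact isNoetherianRing_of_map_eq_zero
      (Ideal.Quotient.mkₐ_surjective ℂ _) hg hu
      (Ideal.Quotient.eq_zero_iff_mem.2 (Ideal.mem_span_singleton_self g))

end Noetherian

section DiscreteValuationRing

theorem coord_ne_zero (i : Fin N) : (coord i : ConvergentSeries N) ≠ 0 := by
  intro h
  have h1 : coeff (Finsupp.single i 1) (X i : MvPowerSeries (Fin N) ℂ) = 0 := by
    rw [show (X i : MvPowerSeries (Fin N) ℂ) = 0 from congrArg Subtype.val h, map_zero]
  rw [coeff_index_single_self_X] at h1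
  exact one_ne_zero h1

theorem maximalIdeal_eq_span_singleton :
    maximalIdeal (ConvergentSeries 1) = Ideal.span {coord 0} := by
  rw [maximalIdeal_eq_span, Set.range_unique]
  rfl

instance : IsDiscreteValuationRing (ConvergentSeries 1) := by
  have hfield : ¬IsField (ConvergentSeries 1) := by
    rw [IsLocalRing.isField_iff_maximalIdeal_eq, maximalIdeal_eq_span_singleton,
      Ideal.span_singleton_eq_bot]
    exact coord_ne_zero 0
  refine ((IsDiscreteValuationRing.TFAE (ConvergentSeries 1) hfield).out 0 4).2 ?_
  exact ⟨⟨coord 0, maximalIdeal_eq_span_singleton⟩⟩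

theorem irreducible_coord : Irreducible (coord 0 : ConvergentSeries 1) :=
  IsDiscreteValuationRing.irreducible_of_span_eq_maximalIdeal _ (coord_ne_zero 0)
    maximalIdeal_eq_span_singleton

end DiscreteValuationRing

end ConvergentSeries

open ConvergentSeries

section Analytic

/-- A `ℂ`-algebra is analytic if it is a quotient of a ring of convergent power series. -/
def IsAnalytic (O : Type*) [CommRing O] [Algebra ℂ O] : Prop :=
  ∃ (N : ℕ) (π : ConvergentSeries N →ₐ[ℂ] O), Function.Surjective π

theorem map_maximalIdeal_eq_span {N : ℕ} {A : Type*} [CommRing A] [Algebra ℂ A]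
    (φ : ConvergentSeries N →ₐ[ℂ] A) :
    (maximalIdeal (ConvergentSeries N)).map φ = Ideal.span (Set.range fun i => φ (coord i)) := by
  rw [maximalIdeal_eq_span, Ideal.map_span, ← Set.range_comp]
  rfl

namespace IsAnalytic

theorem isNoetherianRing {A : Type*} [CommRing A] [Algebra ℂ A] (hA : IsAnalytic A) :
    IsNoetherianRing A := by
  obtain ⟨N, π, hπ⟩ := hA
  exact isNoetherianRing_of_surjective _ _ π.toRingHom hπ

variable {N : ℕ} {O : Type*} [CommRing O] [IsLocalRing O] [Algebra ℂ O]

theorem exists_sub_mem (hO : IsAnalytic O) (x : O) :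
    ∃ c : ℂ, x - algebraMap ℂ O c ∈ maximalIdeal O := by
  obtain ⟨N, π, hπ⟩ := hO
  obtain ⟨f, rfl⟩ := hπ x
  refine ⟨evalZero f, ?_⟩
  rw [← π.commutes, ← map_sub, ← map_maximalIdeal_of_surjective π.toRingHom hπ]
  exact Ideal.mem_map_of_mem π.toRingHom (mem_maximalIdeal_iff.2 (by simp))

theorem map_mem_maximalIdeal_iff (hO : IsAnalytic O) {φ : ConvergentSeries N →ₐ[ℂ] O}
    {f : ConvergentSeries N} : φ f ∈ maximalIdeal O ↔ evalZero f = 0 := by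
  constructor
  · contrapose!
    exact fun hf h => h ((isUnit_iff.2 hf).map φ)
  · intro hf
    obtain ⟨c, hc⟩ := hO.exists_sub_mem (φ f)
    rw [← φ.commutes, ← map_sub] at hc
    rcases eq_or_ne c 0 with rfl | hc0
    · simpa using hc
    · have hunit : IsUnit (f - algebraMap ℂ _ c) := isUnit_iff.2 (by simp [hf, hc0])
      exact absurd (hunit.map φ) hc

theorem map_coord_mem (hO : IsAnalytic O) (φ : ConvergentSeries N →ₐ[ℂ] O) (i : Fin N) :
    φ (coord i) ∈ maximalIdeal O :=
  hO.map_mem_maximalIdeal_iff.2 (evalZero_coord i)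

theorem algHom_ext (hO : IsAnalytic O) {φ ψ : ConvergentSeries N →ₐ[ℂ] O}
    (h : ∀ i, φ (coord i) = ψ (coord i)) : φ = ψ := by
  have := hO.isNoetherianRing
  ext f
  rw [← sub_eq_zero, ← Ideal.mem_bot,
    ← Ideal.iInf_pow_eq_bot_of_isLocalRing (maximalIdeal O) Ideal.IsPrime.ne_top', Ideal.mem_iInf]
  intro m
  have sub_mem (χ : ConvergentSeries N →ₐ[ℂ] O) :
      χ f - MvPolynomial.aeval (fun i => χ (coord i)) (truncTotal m f.1) ∈
        maximalIdeal O ^ m := by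
    have hχ : (maximalIdeal (ConvergentSeries N)).map χ ≤ maximalIdeal O := by
      rw [map_maximalIdeal_eq_span, Ideal.span_le]
      rintro _ ⟨i, rfl⟩
      exact hO.map_coord_mem χ i
    have hf := Ideal.mem_map_of_mem χ (sub_aeval_truncTotal_mem_maximalIdeal_pow m f)
    rw [map_sub, ← AlgHom.comp_apply, MvPolynomial.comp_aeval, Ideal.map_pow] at hf
    exact Ideal.pow_right_mono hχ m hf
  simpa [h] using Ideal.sub_mem _ (sub_mem φ) (sub_mem ψ)

theorem exists_algHom_coord_eq (hO : IsAnalytic O) (a : Fin N → O)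
    (ha : ∀ i, a i ∈ maximalIdeal O) :
    ∃ φ : ConvergentSeries N →ₐ[ℂ] O, ∀ i, φ (coord i) = a i := by
  obtain ⟨M, π, hπ⟩ := id hO
  choose b hb using fun i => hπ (a i)
  have hb0 : ∀ i, evalZero (b i) = 0 := fun i =>
    hO.map_mem_maximalIdeal_iff.1 (by rw [hb]; exact ha i)
  exact ⟨π.comp (substHom b hb0), fun i => by rw [AlgHom.comp_apply, substHom_coord, hb]⟩

theorem finite_of_maximalIdeal_pow_le (hO : IsAnalytic O) (φ : ConvergentSeries N →ₐ[ℂ] O) {K : ℕ}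
    (hK : maximalIdeal O ^ K ≤ Ideal.span (Set.range fun i => φ (coord i))) :
    φ.toRingHom.Finite := by
  obtain ⟨M, π, hπ⟩ := id hO
  choose b hb using fun i => hπ (φ (coord i))
  have hb0 : ∀ i, evalZero (b i) = 0 := fun i =>
    hO.map_mem_maximalIdeal_iff.1 (by rw [hb]; exact hO.map_coord_mem φ i)
  have hφ : φ = π.comp (substHom b hb0) :=
    hO.algHom_ext fun i => by rw [AlgHom.comp_apply, substHom_coord, hb]
  rw [hφ]
  refine finite_comp_substHom hπ hb0 (K := K) ?_
  change _ ≤ _ ⊔ (⊥ : Ideal O).comap π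
  rw [← Ideal.comap_map_of_surjective π hπ, ← Ideal.map_le_iff_le_comap, Ideal.map_pow,
    Ideal.map_span, ← Set.range_comp]
  simp only [Function.comp_def, hb]
  refine (Ideal.pow_right_mono ?_ K).trans hK
  exact (map_maximalIdeal_of_surjective π.toRingHom hπ).le

theorem exists_finite_algebra (hO : IsAnalytic O) {x : O} {K : ℕ} (hx : x ∈ maximalIdeal O)
    (hK : maximalIdeal O ^ K ≤ Ideal.span {x}) :
    ∃ (_ : Algebra (ConvergentSeries 1) O) (_ : IsScalarTower ℂ (ConvergentSeries 1) O),
      Module.Finite (ConvergentSeries 1) O ∧ algebraMap (ConvergentSeries 1) O (coord 0) = x := by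
  obtain ⟨φ, hφ⟩ := hO.exists_algHom_coord_eq (fun _ : Fin 1 => x) fun _ => hx
  have hfinite : φ.toRingHom.Finite :=
    hO.finite_of_maximalIdeal_pow_le φ (by simpa only [hφ, Set.range_const] using hK)
  let := φ.toRingHom.toAlgebra
  exact ⟨this, .of_algebraMap_eq fun c => (φ.commutes c).symm, hfinite, hφ 0⟩

end IsAnalytic

end Analytic

section FiniteDimensional

theorem finite_of_coord_pow_smul_eq_zero {N : ℕ} {M : Type*} [AddCommGroup M] [Module ℂ M]
    [Module (ConvergentSeries N) M] [IsScalarTower ℂ (ConvergentSeries N) M]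
    [Module.Finite (ConvergentSeries N) M] (K : ℕ)
    (h : ∀ (i : Fin N) (m : M), (coord i ^ K : ConvergentSeries N) • m = 0) :
    Module.Finite ℂ M := by
  obtain ⟨n, s, hs⟩ := Module.Finite.exists_fin (R := ConvergentSeries N) (M := M)
  let v : (Fin N → Fin K) × Fin n → M := fun p =>
    (monomial (boxExponent p.1) : ConvergentSeries N) • s p.2
  refine ⟨Submodule.fg_def.2 ⟨Set.range v, Set.finite_range v, eq_top_iff.2 ?_⟩⟩
  rintro m -
  have hm : m ∈ Submodule.span (ConvergentSeries N) (Set.range s) := hs ▸ Submodule.mem_top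
  obtain ⟨c, rfl⟩ := (Submodule.mem_span_range_iff_exists_fun _).1 hm
  refine Submodule.sum_mem _ fun j _ => ?_
  rw [eq_sum_monomial_add_sum_coord_pow_mul_divCoordPow K (c j), add_smul, Finset.sum_smul,
    Finset.sum_smul]
  simp only [mul_smul, h, Finset.sum_const_zero, add_zero, smul_assoc]
  exact Submodule.sum_mem _ fun e _ =>
    Submodule.smul_mem _ _ (Submodule.subset_span ⟨(e, j), rfl⟩)

variable {A : Type*} [CommRing A] [Algebra ℂ A] [Algebra (ConvergentSeries 1) A]
  [IsScalarTower ℂ (ConvergentSeries 1) A] [Module.Finite (ConvergentSeries 1) A]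

theorem finite_quotient_of_coord_pow_mem {J : Ideal A} {K : ℕ}
    (h : algebraMap (ConvergentSeries 1) A (coord 0) ^ K ∈ J) : Module.Finite ℂ (A ⧸ J) := by
  have : Module.Finite (ConvergentSeries 1) (A ⧸ J) :=
    Module.Finite.of_surjective (Ideal.Quotient.mkₐ (ConvergentSeries 1) J).toLinearMap
      Ideal.Quotient.mk_surjective
  refine finite_of_coord_pow_smul_eq_zero (N := 1) K fun i m => ?_
  obtain ⟨a, rfl⟩ := Ideal.Quotient.mk_surjective m
  change Ideal.Quotient.mk J ((coord i ^ K : ConvergentSeries 1) • a) = 0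
  rw [Ideal.Quotient.eq_zero_iff_mem, Algebra.smul_def, map_pow, Subsingleton.elim i 0]
  exact Ideal.mul_mem_right _ _ h

theorem finite_quotient_of_coord_pow_mul_mem {W : Submodule ℂ A} {K : ℕ}
    (h : ∀ a, algebraMap (ConvergentSeries 1) A (coord 0) ^ K * a ∈ W) :
    Module.Finite ℂ (A ⧸ W) := by
  set y := algebraMap (ConvergentSeries 1) A (coord 0) ^ K
  have := finite_quotient_of_coord_pow_mem (Ideal.mem_span_singleton_self y)
  have : Module.Finite ℂ (A ⧸ (Ideal.span {y}).restrictScalars ℂ) :=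
    Module.Finite.equiv (Submodule.Quotient.restrictScalarsEquiv ℂ (Ideal.span {y})).symm
  have hle : (Ideal.span {y}).restrictScalars ℂ ≤ W := by
    intro a ha
    obtain ⟨b, rfl⟩ := Ideal.mem_span_singleton.1 ha
    exact h b
  exact Module.Finite.of_surjective _ (Submodule.factor_surjective hle)

end FiniteDimensional

section Codimension

variable {K V W : Type*} [Field K] [AddCommGroup V] [Module K V] [AddCommGroup W] [Module K W]

theorem finrank_quotient_eq_add (f : W →ₗ[K] V) (A : Submodule K V) [Module.Finite K (V ⧸ A)] :
    Module.finrank K (V ⧸ A) =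
      Module.finrank K (V ⧸ (A ⊔ LinearMap.range f)) + Module.finrank K (W ⧸ A.comap f) := by
  have range_eq : LinearMap.range (A.mkQ ∘ₗ f) = (A ⊔ LinearMap.range f).map A.mkQ := by
    rw [LinearMap.range_comp, Submodule.map_sup, Submodule.mkQ_map_self, bot_sup_eq]
  have finrank_range : Module.finrank K (LinearMap.range (A.mkQ ∘ₗ f)) =
      Module.finrank K (W ⧸ A.comap f) := by
    rw [← (LinearMap.quotKerEquivRange (A.mkQ ∘ₗ f)).finrank_eq, LinearMap.ker_comp,
      Submodule.ker_mkQ]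
  rw [← Submodule.finrank_quotient_add_finrank (LinearMap.range (A.mkQ ∘ₗ f)), finrank_range,
    range_eq,
    (Submodule.quotientQuotientEquivQuotient A (A ⊔ LinearMap.range f) le_sup_left).finrank_eq]

theorem finrank_quotient_le_of_le {R : Type*} [CommRing R] [Algebra K R] [Module R V]
    [IsScalarTower K R V] {A B : Submodule R V} (h : A ≤ B) [Module.Finite K (V ⧸ A)] :
    Module.finrank K (V ⧸ B) ≤ Module.finrank K (V ⧸ A) :=
  LinearMap.finrank_le_finrank_of_surjective (f := (Submodule.factor h).restrictScalars K)
    (Submodule.factor_surjective h)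

theorem finrank_quotient_map_eq_add {f : V →ₗ[K] V} (hf : Function.Injective f)
    (A : Submodule K V) [Module.Finite K (V ⧸ A.map f)] :
    Module.finrank K (V ⧸ A.map f) =
      Module.finrank K (V ⧸ LinearMap.range f) + Module.finrank K (V ⧸ A) := by
  rw [finrank_quotient_eq_add f (A.map f), Submodule.comap_map_eq_of_injective hf,
    sup_eq_right.2 LinearMap.map_le_range]

end Codimension

section Semilocal

variable {R : Type*} [CommRing R]

theorem isIntegral_of_forall_mul_mem [IsNoetherianRing R] {A : Type*} [CommRing A] [Algebra R A]
    {N : Submodule R A} (hN : N.FG) {a : A} (haN : a ∈ N) (ha : a ∈ A⁰) {z : A}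
    (hz : ∀ n ∈ N, z * n ∈ N) : IsIntegral R z := by
  have adjoin_mul_mem : ∀ w ∈ Algebra.adjoin R {z}, ∀ n ∈ N, w * n ∈ N := by
    intro w hw
    induction hw using Algebra.adjoin_induction with
    | mem w hw => rwa [Set.mem_singleton_iff.1 hw]
    | algebraMap r => exact fun n hn => by simpa only [Algebra.smul_def] using N.smul_mem r hn
    | add u v _ _ hu hv =>
      exact fun n hn => by simpa only [add_mul] using add_mem (hu n hn) (hv n hn)
    | mul u v _ _ hu hv => exact fun n hn => by simpa only [mul_assoc] using hu _ (hv n hn)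
  have : Module.Finite R N := Module.Finite.iff_fg.2 hN
  let mulRight : Algebra.adjoin R {z} →ₗ[R] N :=
    LinearMap.codRestrict N
      (LinearMap.mulRight R a ∘ₗ (Subalgebra.toSubmodule (Algebra.adjoin R {z})).subtype)
      fun w => adjoin_mul_mem w w.2 a haN
  have mulRight_injective : Function.Injective mulRight := fun u v h =>
    Subtype.ext ((mul_cancel_right_mem_nonZeroDivisors ha).1 (congrArg Subtype.val h))
  have : Module.Finite R (Algebra.adjoin R {z}) :=
    Module.Finite.of_injective mulRight mulRight_injective
  exact IsIntegral.of_mem_of_fg (Algebra.adjoin R {z}) (Module.Finite.iff_fg.1 this) z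
    (Algebra.self_mem_adjoin_singleton R z)

theorem exists_not_dvd_forall_dvd_mul [IsNoetherianRing R] {x : R}
    (hx : ∀ P : Ideal R, P.IsPrime → x ∈ P → P.IsMaximal) {M : Ideal R} [M.IsMaximal]
    (hM : x ∈ M) : ∃ y, ¬ x ∣ y ∧ ∀ a ∈ M, x ∣ y * a := by
  have M_minimal : M ∈ (Module.annihilator R (R ⧸ Ideal.span {x})).minimalPrimes := by
    rw [Ideal.annihilator_quotient]
    refine ⟨⟨inferInstance, (Ideal.span_singleton_le_iff_mem M).2 hM⟩, fun P hP hPM => ?_⟩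
    exact ((hx P hP.1 ((Ideal.span_singleton_le_iff_mem P).1 hP.2)).eq_of_le
      Ideal.IsPrime.ne_top' hPM).ge
  have M_associated := Module.associatedPrimes.minimalPrimes_annihilator_subset_associatedPrimes R
    (R ⧸ Ideal.span {x}) M_minimal
  obtain ⟨-, y', hy'⟩ := isAssociatedPrime_iff.1 (AssociatedPrimes.mem_iff.1 M_associated)
  obtain ⟨y, rfl⟩ := Ideal.Quotient.mk_surjective y'
  have mem_iff_dvd (a : R) : a ∈ M ↔ x ∣ y * a := by
    rw [hy', Submodule.mem_colon_singleton, Submodule.mem_bot, ← Ideal.mem_span_singleton,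
      ← Ideal.Quotient.eq_zero_iff_mem, mul_comm]
    rfl
  refine ⟨y, fun h => ?_, fun a ha => (mem_iff_dvd a).1 ha⟩
  exact (Ideal.ne_top_iff_one M).1 Ideal.IsPrime.ne_top' ((mem_iff_dvd 1).2 (by rwa [mul_one]))

theorem exists_mul_eq_mul_of_not_dvd [IsNoetherianRing R] {L : Type*} [CommRing L] [Algebra R L]
    [IsIntegrallyClosedIn R L] {x : R} (hxL : IsUnit (algebraMap R L x)) {M : Ideal R}
    (hxM : x ∈ M) {y : R} (hy : ¬ x ∣ y) (hyM : ∀ a ∈ M, x ∣ y * a) :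
    ∃ p ∈ M, ∃ s ∉ M, y * p = x * s := by
  have hinj := IsIntegralClosure.algebraMap_injective R R L
  -- Otherwise multiplication by `y / x` preserves `M`, so `y / x` is integral over `R`.
  by_contra! hcon
  obtain ⟨u, hu⟩ := hxL
  have mul_mem : ∀ n ∈ Submodule.map (Algebra.linearMap R L) M,
      algebraMap R L y * ↑u⁻¹ * n ∈ Submodule.map (Algebra.linearMap R L) M := by
    rintro _ ⟨a, ha, rfl⟩
    obtain ⟨s, hs⟩ := hyM a ha
    refine ⟨s, by_contra fun h => hcon a ha s h hs, ?_⟩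
    rw [Algebra.linearMap_apply, Algebra.linearMap_apply, mul_right_comm, ← map_mul, hs,
      map_mul, ← hu, mul_comm (u : L), mul_assoc, Units.mul_inv, mul_one]
  have integral : IsIntegral R (algebraMap R L y * ↑u⁻¹) :=
    isIntegral_of_forall_mul_mem (Submodule.FG.map _ (IsNoetherian.noetherian M))
      ⟨x, hxM, rfl⟩ (hu ▸ u.isUnit.mem_nonZeroDivisors) mul_mem
  obtain ⟨r, hr⟩ := IsIntegrallyClosedIn.isIntegral_iff.1 integral
  refine hy ⟨r, hinj ?_⟩
  rw [map_mul, hr, ← hu, mul_comm (u : L), mul_assoc, Units.inv_mul, mul_one]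

theorem le_span_sup_sq_of_mul_mem {M : Ideal R} [M.IsMaximal] {p s : R} (hs : s ∉ M)
    (h : ∀ a ∈ M, s * a ∈ Ideal.span {p}) : M ≤ Ideal.span {p} ⊔ M ^ 2 := by
  intro a ha
  obtain ⟨s', m, hm, hs'⟩ := Ideal.IsMaximal.exists_inv ‹M.IsMaximal› hs
  have ha_eq : a = s' * (s * a) + m * a := by rw [← mul_assoc, ← add_mul, hs', one_mul]
  rw [ha_eq, sq]
  exact Submodule.add_mem_sup (Ideal.mul_mem_left _ _ (h a ha)) (Ideal.mul_mem_mul hm ha)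

theorem exists_le_span_sup_sq [IsNoetherianRing R] {L : Type*} [CommRing L] [Algebra R L]
    [IsIntegrallyClosedIn R L] {x : R} (hxL : IsUnit (algebraMap R L x))
    (hx : ∀ P : Ideal R, P.IsPrime → x ∈ P → P.IsMaximal) {M : Ideal R} [M.IsMaximal]
    (hM : x ∈ M) : ∃ p ∈ M, M ≤ Ideal.span {p} ⊔ M ^ 2 := by
  have mul_left_cancel {a b : R} (h : x * a = x * b) : a = b :=
    IsIntegralClosure.algebraMap_injective R R L
      (hxL.mul_left_cancel (by rw [← map_mul, ← map_mul, h]))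
  obtain ⟨y, hy, hyM⟩ := exists_not_dvd_forall_dvd_mul hx hM
  obtain ⟨p, hp, s, hs, hps⟩ := exists_mul_eq_mul_of_not_dvd hxL hM hy hyM
  refine ⟨p, hp, le_span_sup_sq_of_mul_mem hs fun a ha => ?_⟩
  obtain ⟨b, hb⟩ := hyM a ha
  refine Ideal.mem_span_singleton.2 ⟨b, mul_left_cancel ?_⟩
  calc x * (s * a) = (y * p) * a := by rw [hps, mul_assoc]
    _ = p * (y * a) := by ring
    _ = x * (p * b) := by rw [hb]; ring

theorem pow_le_span_pow_sup_pow_succ {M : Ideal R} {p : R} (hp : p ∈ M)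
    (h : M ≤ Ideal.span {p} ⊔ M ^ 2) (i : ℕ) : M ^ i ≤ Ideal.span {p ^ i} ⊔ M ^ (i + 1) := by
  induction i with
  | zero => simp
  | succ i ih =>
    have hpi : Ideal.span {p ^ i} ≤ M ^ i :=
      (Ideal.span_singleton_le_iff_mem _).2 (Ideal.pow_mem_pow hp i)
    calc M ^ (i + 1) = M ^ i * M := pow_succ _ _
      _ ≤ (Ideal.span {p ^ i} ⊔ M ^ (i + 1)) * M := Ideal.mul_mono_left ih
      _ = Ideal.span {p ^ i} * M ⊔ M ^ (i + 2) := by rw [Ideal.sup_mul, ← pow_succ]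
      _ ≤ Ideal.span {p ^ i} * (Ideal.span {p} ⊔ M ^ 2) ⊔ M ^ (i + 2) :=
        sup_le_sup_right (Ideal.mul_mono_right h) _
      _ = Ideal.span {p ^ (i + 1)} ⊔ (Ideal.span {p ^ i} * M ^ 2 ⊔ M ^ (i + 2)) := by
        rw [Ideal.mul_sup, Ideal.span_singleton_mul_span_singleton, ← pow_succ, sup_assoc]
      _ ≤ Ideal.span {p ^ (i + 1)} ⊔ M ^ (i + 2) :=
        sup_le_sup_left (sup_le (pow_add M i 2 ▸ Ideal.mul_mono_left hpi) le_rfl) _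

theorem pow_le_span_sup_pow_succ {M : Ideal R} [M.IsMaximal] {p : R} (hp : p ∈ M)
    (h : M ≤ Ideal.span {p} ⊔ M ^ 2) {f : R} {j : ℕ} (hf : f ∈ M ^ j) (hf' : f ∉ M ^ (j + 1)) :
    M ^ j ≤ Ideal.span {f} ⊔ M ^ (j + 1) := by
  have hj := pow_le_span_pow_sup_pow_succ hp h j
  obtain ⟨_, hg, m, hm, hgm⟩ := Submodule.mem_sup.1 (hj hf)
  obtain ⟨r, rfl⟩ := Ideal.mem_span_singleton'.1 hg
  have mul_pow_mem {b : R} (hb : b ∈ M) : b * p ^ j ∈ M ^ (j + 1) := by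
    rw [pow_succ']
    exact Ideal.mul_mem_mul hb (Ideal.pow_mem_pow hp j)
  have hr : r ∉ M := fun hr => hf' (hgm ▸ add_mem (mul_pow_mem hr) hm)
  obtain ⟨s, m', hm', hs⟩ := Ideal.IsMaximal.exists_inv ‹M.IsMaximal› hr
  refine hj.trans (sup_le ((Ideal.span_singleton_le_iff_mem _).2 ?_) le_sup_right)
  have hpj : p ^ j = s * f + (m' * p ^ j - s * m) := by
    calc p ^ j = (s * r + m') * p ^ j := by rw [hs, one_mul]
      _ = s * (r * p ^ j + m) + (m' * p ^ j - s * m) := by ring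
      _ = s * f + (m' * p ^ j - s * m) := by rw [hgm]
  rw [hpj]
  exact Submodule.add_mem_sup (Ideal.mul_mem_left _ _ (Ideal.mem_span_singleton_self f))
    (sub_mem (mul_pow_mem hm') (Ideal.mul_mem_left _ _ hm))

theorem pow_le_sup_pow_of_pow_le_sup_pow_succ {I M : Ideal R} {j : ℕ}
    (h : M ^ j ≤ I ⊔ M ^ (j + 1)) (k : ℕ) : M ^ j ≤ I ⊔ M ^ k := by
  induction k with
  | zero => simp
  | succ k ih =>
    rcases le_or_gt k j with hkj | hjk
    · exact h.trans (sup_le_sup_left (Ideal.pow_le_pow_right (by omega)) _)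
    · refine ih.trans (sup_le le_sup_left ?_)
      obtain ⟨i, rfl⟩ := Nat.exists_eq_add_of_le hjk.le
      calc M ^ (j + i) = M ^ j * M ^ i := pow_add _ _ _
        _ ≤ (I ⊔ M ^ (j + 1)) * M ^ i := Ideal.mul_mono_left h
        _ = I * M ^ i ⊔ M ^ (j + i + 1) := by
          rw [Ideal.sup_mul, ← pow_add, add_right_comm]
        _ ≤ I ⊔ M ^ (j + i + 1) := sup_le_sup_right Ideal.mul_le_left _

theorem exists_one_sub_mul_mem [IsNoetherianRing R] {I M : Ideal R} {f : R}
    (h : ∀ i, f ∈ I ⊔ M ^ i) : ∃ r ∈ M, (1 - r) * f ∈ I := by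
  have mem_iInf : Ideal.Quotient.mk I f ∈ (⨅ i : ℕ, M ^ i • ⊤ : Submodule R (R ⧸ I)) := by
    rw [Submodule.mem_iInf]
    intro i
    obtain ⟨g, hg, m, hm, rfl⟩ := Submodule.mem_sup.1 (h i)
    rw [map_add, Ideal.Quotient.eq_zero_iff_mem.2 hg, zero_add, ← Ideal.Quotient.algebraMap_eq,
      Algebra.algebraMap_eq_smul_one]
    exact Submodule.smul_mem_smul hm Submodule.mem_top
  obtain ⟨r, hr⟩ := (Ideal.mem_iInf_smul_pow_eq_bot_iff M _).1 mem_iInf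
  refine ⟨r, r.2, ?_⟩
  rw [Algebra.smul_def, Ideal.Quotient.algebraMap_eq] at hr
  rw [← Ideal.Quotient.eq_zero_iff_mem, map_mul, map_sub, map_one, sub_mul, one_mul, hr, sub_self]

theorem exists_le_pow_not_le_pow_succ [IsNoetherianRing R] {I M : Ideal R} (hM : M ≠ ⊤) {x : R}
    (hx : x ∈ R⁰) (hxI : x ∈ I) : ∃ j, I ≤ M ^ j ∧ ¬ I ≤ M ^ (j + 1) := by
  by_contra! hcon
  have le_pow (j : ℕ) : I ≤ M ^ j := by
    induction j with
    | zero => simp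
    | succ j ih => exact hcon j ih
  obtain ⟨r, hr, hrx⟩ := exists_one_sub_mul_mem (I := ⊥) fun i =>
    Submodule.mem_sup_right (le_pow i hxI)
  rw [Ideal.mem_bot, mul_right_mem_nonZeroDivisors_eq_zero_iff hx, sub_eq_zero] at hrx
  exact (Ideal.ne_top_iff_one M).1 hM (hrx ▸ hr)

theorem finite_maximalSpectrum [IsNoetherianRing R] {x : R}
    (hx : ∀ P : Ideal R, P.IsPrime → x ∈ P → P.IsMaximal)
    (hM : ∀ M : Ideal R, M.IsMaximal → x ∈ M) : Finite (MaximalSpectrum R) := by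
  have := (Ideal.finite_minimalPrimes_of_isNoetherianRing R (Ideal.span {x})).to_subtype
  have mem_minimalPrimes (M : MaximalSpectrum R) :
      M.asIdeal ∈ (Ideal.span {x}).minimalPrimes :=
    ⟨⟨M.isMaximal.isPrime, (Ideal.span_singleton_le_iff_mem _).2 (hM _ M.isMaximal)⟩,
      fun P hP hPM => ((hx P hP.1 ((Ideal.span_singleton_le_iff_mem P).1 hP.2)).eq_of_le
        M.isMaximal.ne_top hPM).ge⟩
  exact Finite.of_injective (fun M => (⟨M.asIdeal, mem_minimalPrimes M⟩ :
    (Ideal.span {x}).minimalPrimes)) fun M M' h => MaximalSpectrum.ext (congrArg Subtype.val h)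

theorem iInf_pow_le_span_singleton [IsNoetherianRing R]
    (hp : ∀ M : Ideal R, M.IsMaximal → ∃ p ∈ M, M ≤ Ideal.span {p} ⊔ M ^ 2) {x : R}
    {l : MaximalSpectrum R → ℕ} (hx : ∀ M, x ∈ M.asIdeal ^ l M)
    (hx' : ∀ M, x ∉ M.asIdeal ^ (l M + 1)) :
    ⨅ M : MaximalSpectrum R, M.asIdeal ^ l M ≤ Ideal.span {x} := by
  intro f hf
  rw [Ideal.mem_iInf] at hf
  by_contra hfx
  have colon_ne_top : (Ideal.span {x}).colon {f} ≠ ⊤ := by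
    rwa [Ideal.ne_top_iff_one, Submodule.mem_colon_singleton, one_smul]
  obtain ⟨M, hM, hcolon⟩ := Ideal.exists_le_maximal _ colon_ne_top
  obtain ⟨p, hpM, hMp⟩ := hp M hM
  have hsucc := pow_le_span_sup_pow_succ hpM hMp (hx ⟨M, hM⟩) (hx' ⟨M, hM⟩)
  obtain ⟨r, hr, hrf⟩ := exists_one_sub_mul_mem fun i =>
    pow_le_sup_pow_of_pow_le_sup_pow_succ hsucc i (hf ⟨M, hM⟩)
  have one_sub_mem : 1 - r ∈ M := hcolon (Submodule.mem_colon_singleton.2 hrf)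
  exact (Ideal.ne_top_iff_one M).1 hM.ne_top (by simpa using add_mem one_sub_mem hr)

theorem exists_forall_notMem {k ι : Type*} [Field k] [Infinite k] [Algebra k R] [Finite ι]
    (V : Submodule k R) {I : ι → Ideal R} (hI : ∀ i, ¬ Ideal.span (V : Set R) ≤ I i) :
    ∃ v ∈ V, ∀ i, v ∉ I i := by
  by_contra! hcon
  obtain ⟨i, hi⟩ := Subspace.exists_eq_top_of_iUnion_eq_univ (k := k)
    (p := fun i => ((I i).restrictScalars k).comap V.subtype)
    (Set.eq_univ_of_forall fun v => Set.mem_iUnion.2 (hcon v v.2))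
  refine hI i (Ideal.span_le.2 fun v hv => ?_)
  exact (hi ▸ Submodule.mem_top : (⟨v, hv⟩ : V) ∈ ((I i).restrictScalars k).comap V.subtype)

theorem exists_generic_generator [IsNoetherianRing R] {k : Type*} [Field k] [Infinite k]
    [Algebra k R] {x : R} (hx0 : x ∈ R⁰)
    (hx : ∀ P : Ideal R, P.IsPrime → x ∈ P → P.IsMaximal)
    (hM : ∀ M : Ideal R, M.IsMaximal → x ∈ M)
    (hp : ∀ M : Ideal R, M.IsMaximal → ∃ p ∈ M, M ≤ Ideal.span {p} ⊔ M ^ 2)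
    (V : Submodule k R) (hV : x ∈ V) :
    ∃ y ∈ V, ∃ l : MaximalSpectrum R →₀ ℕ,
      Ideal.span {y} = ⨅ M : MaximalSpectrum R, M.asIdeal ^ l M ∧
        Ideal.span (V : Set R) = Ideal.span {y} := by
  have := finite_maximalSpectrum hx hM
  choose l hl hl' using fun M : MaximalSpectrum R =>
    exists_le_pow_not_le_pow_succ M.isMaximal.ne_top hx0 (Ideal.subset_span hV)
  obtain ⟨y, hyV, hy⟩ := exists_forall_notMem V hl'
  have iInf_le := iInf_pow_le_span_singleton hp (fun M => hl M (Ideal.subset_span hyV)) hy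
  have span_le : Ideal.span {y} ≤ Ideal.span (V : Set R) :=
    (Ideal.span_singleton_le_iff_mem _).2 (Ideal.subset_span hyV)
  exact ⟨y, hyV, Finsupp.equivFunOnFinite.symm l,
    le_antisymm (span_le.trans (le_iInf hl)) iInf_le,
    le_antisymm ((le_iInf hl).trans iInf_le) span_le⟩

end Semilocal

section FiniteNormalization

theorem finite_integralClosure_fractionRing {D B : Type*} [CommRing D] [IsDomain D]
    [IsIntegrallyClosed D] [IsNoetherianRing D] [CharZero D] [CommRing B] [IsDomain B]
    [Algebra D B] [Module.Finite D B] (hinj : Function.Injective (algebraMap D B)) :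
    Module.Finite D (integralClosure D (FractionRing B)) := by
  have : FaithfulSMul D B := (faithfulSMul_iff_algebraMap_injective D B).2 hinj
  have : FaithfulSMul D (FractionRing B) := (faithfulSMul_iff_algebraMap_injective _ _).2 <| by
    rw [IsScalarTower.algebraMap_eq D B]
    exact (IsFractionRing.injective B _).comp hinj
  let := FractionRing.liftAlgebra D (FractionRing B)
  have := FractionRing.isScalarTower_liftAlgebra D (FractionRing B)
  have : Algebra.IsAlgebraic D B := inferInstance
  have : FiniteDimensional (FractionRing D) (FractionRing B) := .of_isLocalization D B D⁰
  have : CharZero (FractionRing D) := IsFractionRing.charZero_of_isFractionRing D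
  exact IsIntegralClosure.finite D (FractionRing D) (FractionRing B) _

section MinimalPrimes

variable {O : Type*} [CommRing O]

theorem isUnit_algebraMap_fractionRing_quotient (p : minimalPrimes O) [p.1.IsPrime] (s : O⁰) :
    IsUnit (algebraMap O (FractionRing (O ⧸ p.1)) s) := by
  rw [isUnit_iff_ne_zero, IsScalarTower.algebraMap_apply O (O ⧸ p.1), Ne,
    FaithfulSMul.algebraMap_eq_zero_iff, Ideal.Quotient.algebraMap_eq,
    Ideal.Quotient.eq_zero_iff_mem]
  exact fun h => notMem_nonZeroDivisors_of_mem_mem_minimalPrimes h p.2 s.2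

/-- The projection of the total ring of fractions of `O` onto the fraction field of an irreducible
component of `Spec O`. -/
def fractionRingProj (p : minimalPrimes O) [p.1.IsPrime] :
    FractionRing O →ₐ[O] FractionRing (O ⧸ p.1) :=
  IsLocalization.liftAlgHom (M := O⁰) (f := Algebra.ofId O (FractionRing (O ⧸ p.1)))
    (isUnit_algebraMap_fractionRing_quotient p)

theorem eq_zero_of_forall_fractionRingProj_eq_zero [IsReduced O]
    [∀ p : minimalPrimes O, p.1.IsPrime] {z : FractionRing O}
    (hz : ∀ p, fractionRingProj p z = 0) : z = 0 := by
  obtain ⟨a, s, rfl⟩ := IsLocalization.exists_mk'_eq O⁰ z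
  have ha : a ∈ sInf (minimalPrimes O) := by
    rw [Ideal.mem_sInf]
    intro p hp
    have hpa : fractionRingProj ⟨p, hp⟩ (algebraMap O _ a) = 0 := by
      rw [← IsLocalization.mk'_spec (FractionRing O) a s, map_mul, hz ⟨p, hp⟩, zero_mul]
    rwa [AlgHom.commutes, IsScalarTower.algebraMap_apply O (O ⧸ p),
      FaithfulSMul.algebraMap_eq_zero_iff, Ideal.Quotient.algebraMap_eq,
      Ideal.Quotient.eq_zero_iff_mem] at hpa
  rw [minimalPrimes, Ideal.sInf_minimalPrimes] at ha
  rw [(show IsNilpotent a from ha).eq_zero, IsLocalization.mk'_zero]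

end MinimalPrimes

variable {D : Type*} [CommRing D] {O : Type*} [CommRing O] [Algebra D O]

theorem injective_algebraMap_quotient_minimalPrime
    (hD : ∀ d : D, d ≠ 0 → algebraMap D O d ∈ O⁰) (p : minimalPrimes O) :
    Function.Injective (algebraMap D (O ⧸ p.1)) := by
  rw [injective_iff_map_eq_zero]
  intro d hd
  by_contra hd0
  rw [IsScalarTower.algebraMap_apply D O, Ideal.Quotient.algebraMap_eq,
    Ideal.Quotient.eq_zero_iff_mem] at hd
  exact notMem_nonZeroDivisors_of_mem_mem_minimalPrimes hd p.2 (hD d hd0)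

theorem finite_normalization [IsDomain D] [IsIntegrallyClosed D] [IsNoetherianRing D] [CharZero D]
    [IsReduced O] [Module.Finite D O] (hD : ∀ d : D, d ≠ 0 → algebraMap D O d ∈ O⁰) :
    Module.Finite D (Normalization O) := by
  have : IsNoetherianRing O := IsNoetherianRing.of_finite D O
  have : Finite (minimalPrimes O) := minimalPrimes.finite_of_isNoetherianRing O
  have hprime (p : minimalPrimes O) : p.1.IsPrime := p.2.1.1
  have hfinite (p : minimalPrimes O) :
      Module.Finite D (integralClosure D (FractionRing (O ⧸ p.1))) :=
    finite_integralClosure_fractionRing (injective_algebraMap_quotient_minimalPrime hD p)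
  have isIntegral_proj (p : minimalPrimes O) (z : Normalization O) :
      IsIntegral D (fractionRingProj p z.1) :=
    (isIntegral_trans (R := D) z.1 z.2).map ((fractionRingProj p).restrictScalars D)
  let proj : Normalization O →ₗ[D]
      ∀ p : minimalPrimes O, integralClosure D (FractionRing (O ⧸ p.1)) :=
    LinearMap.pi fun p => LinearMap.codRestrict
      (Subalgebra.toSubmodule (integralClosure D (FractionRing (O ⧸ p.1))))
      (((fractionRingProj p).toLinearMap.restrictScalars D).comp
        ((integralClosure O (FractionRing O)).val.toLinearMap.restrictScalars D))
      (isIntegral_proj p)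
  refine Module.Finite.of_injective proj ((injective_iff_map_eq_zero proj).2 fun z hz => ?_)
  exact Subtype.ext (eq_zero_of_forall_fractionRingProj_eq_zero fun p =>
    congrArg Subtype.val (congrFun hz p))

end FiniteNormalization

section Normalization

variable {O : Type*} [CommRing O]

theorem injective_algebraMap_normalization :
    Function.Injective (algebraMap O (Normalization O)) :=
  Function.Injective.of_comp (f := algebraMap (Normalization O) (FractionRing O))
    (IsFractionRing.injective O (FractionRing O))

theorem algebraMap_normalization_mem_nonZeroDivisors {s : O} (hs : s ∈ O⁰) :
    algebraMap O (Normalization O) s ∈ (Normalization O)⁰ := by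
  rw [mem_nonZeroDivisors_iff_right]
  intro z hz
  have hzs : z.1 * algebraMap O (FractionRing O) s = 0 := congrArg Subtype.val hz
  exact Subtype.ext
    ((IsLocalization.map_units (FractionRing O) (⟨s, hs⟩ : O⁰)).mul_left_eq_zero.1 hzs)

theorem exists_algebraMap_mul_eq (z : Normalization O) :
    ∃ s ∈ O⁰, ∃ a : O,
      algebraMap O (Normalization O) s * z = algebraMap O (Normalization O) a := by
  obtain ⟨⟨a, s⟩, h⟩ := IsLocalization.surj O⁰ z.1
  exact ⟨s, s.2, a, Subtype.ext ((mul_comm _ _).trans h)⟩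

theorem exists_forall_mul_mem_range {D : Type*} [CommRing D] [Algebra D O]
    [Module.Finite D (Normalization O)] :
    ∃ s ∈ O⁰, ∀ z : Normalization O,
      algebraMap O (Normalization O) s * z ∈ (algebraMap O (Normalization O)).range := by
  obtain ⟨n, v, hv⟩ := Module.Finite.exists_fin (R := D) (M := Normalization O)
  choose s hs a ha using fun i => exists_algebraMap_mul_eq (v i)
  refine ⟨∏ i, s i, Submonoid.prod_mem _ fun i _ => hs i, fun z => ?_⟩
  obtain ⟨c, rfl⟩ := (Submodule.mem_span_range_iff_exists_fun D).1
    (hv ▸ Submodule.mem_top : z ∈ Submodule.span D (Set.range v))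
  rw [Finset.mul_sum]
  refine sum_mem fun i _ => ?_
  rw [← Finset.prod_erase_mul _ _ (Finset.mem_univ i), map_mul, mul_smul_comm, mul_assoc, ha,
    Algebra.smul_def, IsScalarTower.algebraMap_apply D O (Normalization O), ← map_mul, ← map_mul]
  exact ⟨_, rfl⟩

theorem algebraMap_mem_of_isMaximal_normalization [IsLocalRing O] {x : O}
    (hx : x ∈ maximalIdeal O) (M : Ideal (Normalization O)) [M.IsMaximal] :
    algebraMap O (Normalization O) x ∈ M := by
  have hM : M.comap (algebraMap O (Normalization O)) = maximalIdeal O :=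
    IsLocalRing.eq_maximalIdeal (Ideal.isMaximal_comap_of_isIntegral_of_isMaximal M)
  rwa [← hM] at hx

end Normalization

section FiniteOverPowerSeries

theorem mem_nonZeroDivisors_of_pow_le {O : Type*} [CommRing O] [IsLocalRing O] [IsReduced O]
    (hdim : ringKrullDim O ≠ 0) {x : O} {K : ℕ} (hK : maximalIdeal O ^ K ≤ Ideal.span {x}) :
    x ∈ O⁰ := by
  rw [mem_nonZeroDivisors_iff_right]
  intro y hyx
  by_contra hy
  have hy' : y ∉ sInf (minimalPrimes O) := by
    rw [minimalPrimes, Ideal.sInf_minimalPrimes]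
    exact fun h : IsNilpotent y => hy h.eq_zero
  obtain ⟨p, hp, hyp⟩ : ∃ p ∈ minimalPrimes O, y ∉ p := by
    by_contra! h
    exact hy' (Ideal.mem_sInf.2 fun {p} hp => h p hp)
  have hprime : p.IsPrime := hp.1.1
  have hxp : x ∈ p := (hprime.mem_or_mem (hyx ▸ p.zero_mem)).resolve_left hyp
  have hle : maximalIdeal O ≤ p :=
    hprime.le_of_pow_le (hK.trans ((Ideal.span_singleton_le_iff_mem p).2 hxp))
  have hmin : maximalIdeal O ∈ minimalPrimes O :=
    (le_maximalIdeal hprime.ne_top).antisymm hle ▸ hp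
  rw [← maximalIdeal_height_eq_ringKrullDim, Ideal.height_eq_zero_iff.2 hmin] at hdim
  exact hdim rfl

instance : CharZero (ConvergentSeries 1) :=
  charZero_of_injective_algebraMap (algebraMap ℂ (ConvergentSeries 1)).injective

variable {O : Type*} [CommRing O] [Algebra (ConvergentSeries 1) O]

theorem algebraMap_mem_nonZeroDivisors
    (hx : algebraMap (ConvergentSeries 1) O (coord 0) ∈ O⁰) {d : ConvergentSeries 1}
    (hd : d ≠ 0) : algebraMap (ConvergentSeries 1) O d ∈ O⁰ := by
  obtain ⟨n, u, rfl⟩ := IsDiscreteValuationRing.eq_unit_mul_pow_irreducible hd irreducible_coord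
  rw [map_mul, map_pow]
  exact mul_mem (u.isUnit.map _).mem_nonZeroDivisors (pow_mem hx n)

variable [Module.Finite (ConvergentSeries 1) O]

theorem exists_dvd_coord_pow {s : O} (hs : s ∈ O⁰) :
    ∃ k, s ∣ algebraMap (ConvergentSeries 1) O (coord 0) ^ k := by
  cases subsingleton_or_nontrivial O
  · exact ⟨0, 0, Subsingleton.elim _ _⟩
  have hs_integral : IsIntegral (ConvergentSeries 1) s := Algebra.IsIntegral.isIntegral s
  obtain ⟨d, hd, hsd⟩ := hs_integral.isAlgebraic.exists_nonzero_dvd hs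
  obtain ⟨n, u, rfl⟩ := IsDiscreteValuationRing.eq_unit_mul_pow_irreducible hd irreducible_coord
  rw [map_mul, map_pow] at hsd
  exact ⟨n, (u.isUnit.map (algebraMap _ O)).dvd_mul_left.1 hsd⟩

variable [IsReduced O]

theorem finite_normalization_of_coord_mem_nonZeroDivisors
    (hx : algebraMap (ConvergentSeries 1) O (coord 0) ∈ O⁰) :
    Module.Finite (ConvergentSeries 1) (Normalization O) :=
  finite_normalization fun _ hd => algebraMap_mem_nonZeroDivisors hx hd

theorem exists_forall_coord_pow_mul_mem_range
    (hx : algebraMap (ConvergentSeries 1) O (coord 0) ∈ O⁰) :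
    ∃ k, ∀ z : Normalization O,
      algebraMap (ConvergentSeries 1) (Normalization O) (coord 0) ^ k * z ∈
        (algebraMap O (Normalization O)).range := by
  have := finite_normalization_of_coord_mem_nonZeroDivisors hx
  obtain ⟨s, hs, h⟩ := exists_forall_mul_mem_range (O := O) (D := ConvergentSeries 1)
  obtain ⟨k, r, hr⟩ := exists_dvd_coord_pow hs
  refine ⟨k, fun z => ?_⟩
  rw [IsScalarTower.algebraMap_apply _ O, ← map_pow, hr, mul_comm s, map_mul, mul_assoc]
  exact Subring.mul_mem _ ⟨_, rfl⟩ (h z)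

theorem exists_dvd_coord_pow_of_normalization_dvd
    (hx : algebraMap (ConvergentSeries 1) O (coord 0) ∈ O⁰) {y : O}
    (hy : algebraMap O (Normalization O) y ∣
      algebraMap (ConvergentSeries 1) (Normalization O) (coord 0)) :
    ∃ k, y ∣ algebraMap (ConvergentSeries 1) O (coord 0) ^ k := by
  obtain ⟨k, hk⟩ := exists_forall_coord_pow_mul_mem_range hx
  obtain ⟨r, hr⟩ := hy
  obtain ⟨a, ha⟩ := hk r
  refine ⟨k + 1, a, injective_algebraMap_normalization ?_⟩
  rw [map_mul, ha, map_pow, ← IsScalarTower.algebraMap_apply, pow_succ]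
  nth_rw 2 [hr]
  ring

theorem isMaximal_of_coord_mem {A : Type*} [CommRing A] [Algebra ℂ A]
    [Algebra (ConvergentSeries 1) A] [IsScalarTower ℂ (ConvergentSeries 1) A]
    [Module.Finite (ConvergentSeries 1) A] {P : Ideal A} [P.IsPrime]
    (hP : algebraMap (ConvergentSeries 1) A (coord 0) ∈ P) : P.IsMaximal := by
  have : Module.Finite ℂ (A ⧸ P) := finite_quotient_of_coord_pow_mem (K := 1) (by rwa [pow_one])
  exact Ideal.Quotient.maximal_of_isField _
    (isField_of_isIntegral_of_isField' (R := ℂ) (Field.toIsField ℂ))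

end FiniteOverPowerSeries

section GoodParameter

/-- A parameter of a one-dimensional local ring `O` which generates the same ideal of the
normalization as the maximal ideal of `O`, and hence computes the multiplicity. The last field says
that this ideal is a member of the lattice filtration. -/
structure IsGoodParameter (O : Type*) [CommRing O] [IsLocalRing O] (x : O) : Prop where
  mem : x ∈ maximalIdeal O
  mem_nonZeroDivisors : x ∈ O⁰
  exists_pow_le : ∃ K, maximalIdeal O ^ K ≤ Ideal.span {x}
  map_eq : (maximalIdeal O).map (algebraMap O (Normalization O)) =
    Ideal.span {algebraMap O (Normalization O) x}
  exists_filtration : ∃ l : Lattice O,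
    normFiltration O l = Ideal.span {algebraMap O (Normalization O) x}

variable {O : Type*} [CommRing O] [Algebra ℂ O]

theorem IsReducedCurveGerm.isAnalytic (hO : IsReducedCurveGerm O) : IsAnalytic O := by
  obtain ⟨N, I, ⟨e⟩⟩ := hO.analytic
  exact ⟨N, e.symm.toAlgHom.comp (Ideal.Quotient.mkₐ ℂ I),
    e.symm.surjective.comp Ideal.Quotient.mk_surjective⟩

variable [IsLocalRing O]

theorem exists_map_maximalIdeal_eq_span [IsReduced O] [Algebra (ConvergentSeries 1) O]
    [IsScalarTower ℂ (ConvergentSeries 1) O] [Module.Finite (ConvergentSeries 1) O]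
    (hx : algebraMap (ConvergentSeries 1) O (coord 0) ∈ O⁰)
    (hxm : algebraMap (ConvergentSeries 1) O (coord 0) ∈ maximalIdeal O) :
    ∃ y ∈ maximalIdeal O,
      (maximalIdeal O).map (algebraMap O (Normalization O)) =
        Ideal.span {algebraMap O (Normalization O) y} ∧
      ∃ l : Lattice O, normFiltration O l = Ideal.span {algebraMap O (Normalization O) y} := by
  set x := algebraMap (ConvergentSeries 1) O (coord 0)
  have := finite_normalization_of_coord_mem_nonZeroDivisors hx
  have : IsNoetherianRing (Normalization O) := IsNoetherianRing.of_finite (ConvergentSeries 1) _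
  have isMaximal_of_mem (P : Ideal (Normalization O)) (_ : P.IsPrime)
      (hxP : algebraMap O (Normalization O) x ∈ P) : P.IsMaximal :=
    isMaximal_of_coord_mem (by rwa [IsScalarTower.algebraMap_apply _ O])
  have mem_of_isMaximal (M : Ideal (Normalization O)) (_ : M.IsMaximal) :
      algebraMap O (Normalization O) x ∈ M :=
    algebraMap_mem_of_isMaximal_normalization hxm M
  obtain ⟨_, ⟨y, hy, rfl⟩, l, hl, hmap⟩ := exists_generic_generator
    (algebraMap_normalization_mem_nonZeroDivisors hx) isMaximal_of_mem mem_of_isMaximal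
    (fun M hM => exists_le_span_sup_sq (R := Normalization O)
      (L := FractionRing O) (x := algebraMap O (Normalization O) x)
      (IsLocalization.map_units (FractionRing O) (⟨x, hx⟩ : O⁰)) isMaximal_of_mem
      (mem_of_isMaximal M hM))
    (((maximalIdeal O).restrictScalars ℂ).map
      (IsScalarTower.toAlgHom ℂ O (Normalization O)).toLinearMap) ⟨x, hxm, rfl⟩
  exact ⟨y, hy, hmap, l, hl.symm⟩

theorem IsReducedCurveGerm.exists_isGoodParameter (hO : IsReducedCurveGerm O) :
    ∃ x, IsGoodParameter O x := by
  have := hO.reduced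
  have := hO.isAnalytic.isNoetherianRing
  have hdim : ringKrullDim O ≠ 0 := by simp [hO.dim_one]
  obtain ⟨x, hxm, K, hK⟩ := exists_maximalIdeal_pow_le_span_singleton hO.dim_one.le
  obtain ⟨_, _, _, coord_eq⟩ := hO.isAnalytic.exists_finite_algebra hxm hK
  have hx := mem_nonZeroDivisors_of_pow_le hdim hK
  obtain ⟨y, hy, hmap, hl⟩ := exists_map_maximalIdeal_eq_span (coord_eq ▸ hx) (coord_eq ▸ hxm)
  obtain ⟨k, hk⟩ := exists_dvd_coord_pow_of_normalization_dvd (coord_eq ▸ hx) (y := y) <| by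
    rw [← Ideal.mem_span_singleton, ← hmap, IsScalarTower.algebraMap_apply _ O, coord_eq]
    exact Ideal.mem_map_of_mem _ hxm
  have hpow : maximalIdeal O ^ (K * k) ≤ Ideal.span {y} := by
    rw [pow_mul]
    refine (Ideal.pow_right_mono hK _).trans ?_
    rwa [Ideal.span_singleton_pow, Ideal.span_singleton_le_span_singleton, ← coord_eq]
  exact ⟨y, hy, mem_nonZeroDivisors_of_pow_le hdim hpow, ⟨_, hpow⟩, hmap, hl⟩

end GoodParameter

section QuotientDimension

variable {k A : Type*} [Field k] [CommRing A] [Algebra k A]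

theorem finrank_restrictScalars_quotient (I : Ideal A) :
    Module.finrank k (A ⧸ I.restrictScalars k) = Module.finrank k (A ⧸ I) :=
  (Submodule.Quotient.restrictScalarsEquiv k I).finrank_eq

theorem map_mulLeft_restrictScalars (x : A) (I : Ideal A) :
    (I.restrictScalars k).map (LinearMap.mulLeft k x) =
      (Ideal.span {x} * I).restrictScalars k := by
  ext a
  simp only [Submodule.mem_map, Submodule.restrictScalars_mem, LinearMap.mulLeft_apply,
    Ideal.mem_span_singleton_mul]

theorem range_mulLeft (x : A) :
    LinearMap.range (LinearMap.mulLeft k x) = (Ideal.span {x}).restrictScalars k := by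
  rw [LinearMap.range_eq_map, ← Submodule.restrictScalars_top k A A, map_mulLeft_restrictScalars,
    Ideal.mul_top]

theorem injective_mulLeft {x : A} (hx : x ∈ A⁰) : Function.Injective (LinearMap.mulLeft k x) :=
  fun _ _ h => (mul_cancel_left_mem_nonZeroDivisors hx).1 h

theorem finrank_quotient_span_singleton_mul {x : A} (hx : x ∈ A⁰) (I : Ideal A)
    [Module.Finite k (A ⧸ Ideal.span {x} * I)] :
    Module.finrank k (A ⧸ Ideal.span {x} * I) =
      Module.finrank k (A ⧸ Ideal.span {x}) + Module.finrank k (A ⧸ I) := by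
  have : Module.Finite k (A ⧸ (I.restrictScalars k).map (LinearMap.mulLeft k x)) := by
    rw [map_mulLeft_restrictScalars]
    exact Module.Finite.equiv (Submodule.Quotient.restrictScalarsEquiv k _).symm
  have codim_eq := finrank_quotient_map_eq_add (injective_mulLeft hx) (I.restrictScalars k)
  rwa [map_mulLeft_restrictScalars, range_mulLeft, finrank_restrictScalars_quotient,
    finrank_restrictScalars_quotient, finrank_restrictScalars_quotient] at codim_eq

theorem finrank_quotient_span_singleton_pow {x : A} (hx : x ∈ A⁰)
    (hfin : ∀ n, Module.Finite k (A ⧸ Ideal.span {x ^ n})) (n : ℕ) :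
    Module.finrank k (A ⧸ Ideal.span {x ^ n}) = n * Module.finrank k (A ⧸ Ideal.span {x}) := by
  induction n with
  | zero =>
    have : Subsingleton (A ⧸ Ideal.span {x ^ 0}) :=
      Ideal.Quotient.subsingleton_iff.2 (by rw [pow_zero, Ideal.span_singleton_one])
    rw [zero_mul, Module.finrank_zero_of_subsingleton]
  | succ n ih =>
    have := hfin (n + 1)
    rw [pow_succ', ← Ideal.span_singleton_mul_span_singleton] at this ⊢
    rw [finrank_quotient_span_singleton_mul hx, ih]
    ring

theorem finrank_quotient_pow_succ_le {I : Ideal A} {x : A} (hxI : x ∈ I) (hx : x ∈ A⁰) (n : ℕ)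
    [Module.Finite k (A ⧸ Ideal.span {x} * I ^ n)] :
    Module.finrank k (A ⧸ I ^ (n + 1)) ≤
      Module.finrank k (A ⧸ Ideal.span {x}) + Module.finrank k (A ⧸ I ^ n) := by
  have hle : Ideal.span {x} * I ^ n ≤ I ^ (n + 1) := by
    rw [pow_succ']
    exact Ideal.mul_mono_left ((Ideal.span_singleton_le_iff_mem I).2 hxI)
  exact (finrank_quotient_le_of_le hle).trans_eq (finrank_quotient_span_singleton_mul hx _)

theorem finrank_quotient_span_singleton_of_injective {B : Type*} [CommRing B] [Algebra k B]
    {ψ : B →ₐ[k] A} (hψ : Function.Injective ψ) {x : B} (hx : ψ x ∈ A⁰)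
    [hfin : Module.Finite k (A ⧸ ((Ideal.span {x}).restrictScalars k).map ψ.toLinearMap)] :
    Module.finrank k (B ⧸ Ideal.span {x}) = Module.finrank k (A ⧸ Ideal.span {ψ x}) := by
  have codim_eq := finrank_quotient_eq_add ψ.toLinearMap
    (((Ideal.span {x}).restrictScalars k).map ψ.toLinearMap)
  rw [Submodule.comap_map_eq_of_injective hψ, sup_eq_right.2 LinearMap.map_le_range,
    finrank_restrictScalars_quotient] at codim_eq
  have map_span : ((Ideal.span {x}).restrictScalars k).map ψ.toLinearMap =
      (LinearMap.range ψ.toLinearMap).map (LinearMap.mulLeft k (ψ x)) := by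
    rw [← range_mulLeft, ← LinearMap.range_comp, ← LinearMap.range_comp]
    congr 1
    ext a
    exact map_mul ψ x a
  rw [map_span] at hfin codim_eq
  rw [finrank_quotient_map_eq_add (injective_mulLeft hx), range_mulLeft,
    finrank_restrictScalars_quotient] at codim_eq
  omega

end QuotientDimension

section Multiplicity

theorem HasMultiplicity.unique {O : Type*} [CommRing O] [IsLocalRing O] [Algebra ℂ O] {e e' : ℕ}
    (h : HasMultiplicity O e) (h' : HasMultiplicity O e') : e = e' := by
  obtain ⟨c, h⟩ := h
  obtain ⟨c', h'⟩ := h'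
  obtain ⟨n, hn⟩ := eventually_atTop.1 (h.and h')
  have eq_at := (hn n le_rfl).1.symm.trans (hn n le_rfl).2
  have eq_at_succ := (hn (n + 1) n.le_succ).1.symm.trans (hn (n + 1) n.le_succ).2
  push_cast at eq_at_succ
  have : (e : ℤ) = e' := by linarith
  exact_mod_cast this

/-- The inclusion of `O` into its normalization, as a `ℂ`-linear map. -/
abbrev normMap (O : Type*) [CommRing O] [Algebra ℂ O] : O →ₗ[ℂ] Normalization O :=
  (IsScalarTower.toAlgHom ℂ O (Normalization O)).toLinearMap

variable {O : Type*} [CommRing O] [Algebra ℂ O]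

theorem finrank_quotient_map_normMap (I : Ideal O)
    [Module.Finite ℂ (Normalization O ⧸ (I.restrictScalars ℂ).map (normMap O))] :
    Module.finrank ℂ (Normalization O ⧸ (I.restrictScalars ℂ).map (normMap O)) =
      Module.finrank ℂ (Normalization O ⧸ LinearMap.range (normMap O)) +
        Module.finrank ℂ (O ⧸ I) := by
  rw [finrank_quotient_eq_add (normMap O), Submodule.comap_map_eq_of_injective
    injective_algebraMap_normalization, sup_eq_right.2 LinearMap.map_le_range,
    finrank_restrictScalars_quotient]

variable [IsReduced O] [Algebra (ConvergentSeries 1) O] [IsScalarTower ℂ (ConvergentSeries 1) O]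
  [Module.Finite (ConvergentSeries 1) O]

theorem finite_quotient_map_normMap (hx : algebraMap (ConvergentSeries 1) O (coord 0) ∈ O⁰)
    {I : Ideal O} {n : ℕ} (hI : algebraMap (ConvergentSeries 1) O (coord 0) ^ n ∈ I) :
    Module.Finite ℂ (Normalization O ⧸ (I.restrictScalars ℂ).map (normMap O)) := by
  have := finite_normalization_of_coord_mem_nonZeroDivisors hx
  obtain ⟨k, hk⟩ := exists_forall_coord_pow_mul_mem_range hx
  refine finite_quotient_of_coord_pow_mul_mem (K := n + k) fun z => ?_
  obtain ⟨a, ha⟩ := hk z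
  refine ⟨algebraMap (ConvergentSeries 1) O (coord 0) ^ n * a, I.mul_mem_right _ hI, ?_⟩
  change algebraMap O (Normalization O) _ = _
  rw [map_mul, ha, map_pow, ← IsScalarTower.algebraMap_apply, pow_add, mul_assoc]

theorem finrank_quotient_span_singleton
    (hx : algebraMap (ConvergentSeries 1) O (coord 0) ∈ O⁰) {y : O} (hy : y ∈ O⁰) :
    Module.finrank ℂ (O ⧸ Ideal.span {y}) =
      Module.finrank ℂ (Normalization O ⧸ Ideal.span {algebraMap O (Normalization O) y}) := by
  obtain ⟨k, hk⟩ := exists_dvd_coord_pow hy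
  have := finite_quotient_map_normMap hx (Ideal.mem_span_singleton.2 hk)
  exact finrank_quotient_span_singleton_of_injective
    (ψ := IsScalarTower.toAlgHom ℂ O (Normalization O)) injective_algebraMap_normalization
    (algebraMap_normalization_mem_nonZeroDivisors hy)

theorem IsGoodParameter.finrank_quotient_le [IsLocalRing O]
    (hx : IsGoodParameter O (algebraMap (ConvergentSeries 1) O (coord 0))) {y : O}
    (hy : y ∈ O⁰) (hym : y ∈ maximalIdeal O) :
    Module.finrank ℂ (O ⧸ Ideal.span {algebraMap (ConvergentSeries 1) O (coord 0)}) ≤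
      Module.finrank ℂ (O ⧸ Ideal.span {y}) := by
  have hx0 := hx.mem_nonZeroDivisors
  have := finite_normalization_of_coord_mem_nonZeroDivisors hx0
  rw [finrank_quotient_span_singleton hx0 hx0, finrank_quotient_span_singleton hx0 hy]
  obtain ⟨k, hk⟩ := exists_dvd_coord_pow hy
  have : Module.Finite ℂ
      (Normalization O ⧸ Ideal.span {algebraMap O (Normalization O) y}) := by
    refine finite_quotient_of_coord_pow_mem (K := k) (Ideal.mem_span_singleton.2 ?_)
    rw [IsScalarTower.algebraMap_apply (ConvergentSeries 1) O (Normalization O), ← map_pow]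
    exact map_dvd _ hk
  refine finrank_quotient_le_of_le ((Ideal.span_singleton_le_iff_mem _).2 ?_)
  rw [← hx.map_eq]
  exact Ideal.mem_map_of_mem _ hym

theorem IsGoodParameter.mul_finrank_le [IsLocalRing O]
    (hx : IsGoodParameter O (algebraMap (ConvergentSeries 1) O (coord 0))) (n : ℕ) :
    n * Module.finrank ℂ (O ⧸ Ideal.span {algebraMap (ConvergentSeries 1) O (coord 0)}) ≤
      Module.finrank ℂ (Normalization O ⧸ LinearMap.range (normMap O)) +
        Module.finrank ℂ (O ⧸ maximalIdeal O ^ n) := by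
  have hx0 := hx.mem_nonZeroDivisors
  have := finite_normalization_of_coord_mem_nonZeroDivisors hx0
  have := finite_quotient_map_normMap hx0 (Ideal.pow_mem_pow hx.mem n)
  have finite_pow (n : ℕ) : Module.Finite ℂ (Normalization O ⧸ Ideal.span
      {algebraMap O (Normalization O) (algebraMap (ConvergentSeries 1) O (coord 0)) ^ n}) := by
    rw [← IsScalarTower.algebraMap_apply]
    exact finite_quotient_of_coord_pow_mem (Ideal.mem_span_singleton_self _)
  rw [finrank_quotient_span_singleton hx0 hx0, ← finrank_quotient_span_singleton_pow
    (algebraMap_normalization_mem_nonZeroDivisors hx0) finite_pow,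
    ← finrank_quotient_map_normMap, ← finrank_restrictScalars_quotient]
  refine finrank_quotient_le_of_le ?_
  rintro _ ⟨a, ha, rfl⟩
  have hmem := Ideal.mem_map_of_mem (algebraMap O (Normalization O)) ha
  rwa [Ideal.map_pow, hx.map_eq, Ideal.span_singleton_pow] at hmem

theorem IsGoodParameter.hasMultiplicity [IsLocalRing O]
    (hx : IsGoodParameter O (algebraMap (ConvergentSeries 1) O (coord 0))) :
    HasMultiplicity O (Module.finrank ℂ
      (O ⧸ Ideal.span {algebraMap (ConvergentSeries 1) O (coord 0)})) := by
  set x := algebraMap (ConvergentSeries 1) O (coord 0)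
  set e := Module.finrank ℂ (O ⧸ Ideal.span {x})
  set δ := Module.finrank ℂ (Normalization O ⧸ LinearMap.range (normMap O))
  have lower (n : ℕ) : n * e ≤ δ + Module.finrank ℂ (O ⧸ maximalIdeal O ^ n) :=
    hx.mul_finrank_le n
  have upper (n : ℕ) : Module.finrank ℂ (O ⧸ maximalIdeal O ^ (n + 1)) ≤
      e + Module.finrank ℂ (O ⧸ maximalIdeal O ^ n) := by
    have : Module.Finite ℂ (O ⧸ Ideal.span {x} * maximalIdeal O ^ n) := by
      refine finite_quotient_of_coord_pow_mem (K := n + 1) ?_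
      rw [pow_succ']
      exact Ideal.mul_mem_mul (Ideal.mem_span_singleton_self x) (Ideal.pow_mem_pow hx.mem n)
    exact finrank_quotient_pow_succ_le hx.mem hx.mem_nonZeroDivisors n
  let b (n : ℕ) : ℕ := δ + Module.finrank ℂ (O ⧸ maximalIdeal O ^ n) - n * e
  have hb : Antitone b := antitone_nat_of_succ_le fun n => by
    have := upper n
    have := lower n
    simp only [b, add_mul, one_mul]
    omega
  obtain ⟨n₀, hn₀⟩ := WellFoundedGT.monotone_chain_condition ⟨OrderDual.toDual ∘ b, hb.dual_right⟩
  refine ⟨b n₀ - δ, eventually_atTop.2 ⟨n₀, fun n hn => ?_⟩⟩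
  have hbn : b n₀ = b n := hn₀ n hn
  have := lower n
  rw [hbn]
  simp only [b]
  push_cast [this]
  ring

end Multiplicity

section TwoGenerators

variable {k A : Type*} [Field k] [CommRing A] [Algebra k A]

theorem exists_forall_sub_mem {I : Ideal A} [Module.Finite k (A ⧸ I)] (hI : I ≠ ⊤)
    (hfinrank : Module.finrank k (A ⧸ I) ≤ 2) :
    ∃ w : A, ∀ a, ∃ c d : k, a - (algebraMap k A c + algebraMap k A d * w) ∈ I := by
  have := Ideal.Quotient.nontrivial_iff.2 hI
  have finrank_add := Submodule.finrank_quotient_add_finrank (k ∙ (1 : A ⧸ I))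
  rw [finrank_span_singleton one_ne_zero] at finrank_add
  obtain ⟨v, hv⟩ := (finrank_le_one_iff (K := k) (V := (A ⧸ I) ⧸ (k ∙ (1 : A ⧸ I)))).1 (by omega)
  obtain ⟨w, rfl⟩ := Submodule.Quotient.mk_surjective _ v
  obtain ⟨w, rfl⟩ := Ideal.Quotient.mk_surjective w
  refine ⟨w, fun a => ?_⟩
  obtain ⟨d, hd⟩ := hv (Submodule.Quotient.mk (Ideal.Quotient.mk I a))
  rw [← Submodule.Quotient.mk_smul, eq_comm, Submodule.Quotient.eq,
    Submodule.mem_span_singleton] at hd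
  obtain ⟨c, hc⟩ := hd
  refine ⟨c, d, ?_⟩
  rw [Algebra.smul_def, Algebra.smul_def, mul_one] at hc
  rw [← Ideal.Quotient.eq_zero_iff_mem, map_sub, map_add, map_mul]
  change _ - (algebraMap k (A ⧸ I) c + algebraMap k (A ⧸ I) d * _) = 0
  rw [hc]
  ring

theorem finrank_quotient_le_two {I : Ideal A} {w : A}
    (hw : ∀ a, ∃ c d : k, a - (algebraMap k A c + algebraMap k A d * w) ∈ I) :
    Module.finrank k (A ⧸ I) ≤ 2 := by
  classical
  let s : Finset (A ⧸ I) := {1, Ideal.Quotient.mk I w}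
  have span_eq_top : Submodule.span k (s : Set (A ⧸ I)) = ⊤ := by
    refine eq_top_iff.2 fun a _ => ?_
    obtain ⟨a, rfl⟩ := Ideal.Quotient.mk_surjective a
    obtain ⟨c, d, hcd⟩ := hw a
    rw [Finset.coe_pair, Submodule.mem_span_pair]
    refine ⟨c, d, ?_⟩
    rw [← Ideal.Quotient.eq_zero_iff_mem, map_sub, sub_eq_zero] at hcd
    rw [hcd, map_add, map_mul, Algebra.smul_def, Algebra.smul_def, mul_one]
    rfl
  have finrank_le := finrank_span_finset_le_card (R := k) s
  rw [Set.finrank, span_eq_top, finrank_top] at finrank_le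
  exact finrank_le.trans Finset.card_le_two

variable {D : Type*} [CommRing D] [Algebra k D] [Algebra D A] [IsScalarTower k D A]

theorem forall_exists_eq_add_mul [IsLocalRing D] [Module.Finite D A] {x : D}
    (hx : x ∈ maximalIdeal D) {w : A}
    (hw : ∀ a, ∃ c d : k, a - (algebraMap k A c + algebraMap k A d * w) ∈
      Ideal.span {algebraMap D A x}) (a : A) :
    ∃ p q : D, a = algebraMap D A p + algebraMap D A q * w := by
  have top_le : (⊤ : Submodule D A) ≤ Submodule.span D {1, w} := by
    refine Submodule.le_of_le_smul_of_le_jacobson_bot (I := maximalIdeal D)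
      Module.Finite.fg_top (IsLocalRing.maximalIdeal_le_jacobson _) ?_
    rintro a -
    obtain ⟨c, d, h⟩ := hw a
    obtain ⟨b, hb⟩ := Ideal.mem_span_singleton'.1 h
    rw [eq_comm, sub_eq_iff_eq_add'] at hb
    rw [hb]
    refine Submodule.add_mem_sup ?_ ?_
    · rw [Submodule.mem_span_pair]
      refine ⟨algebraMap k D c, algebraMap k D d, ?_⟩
      rw [Algebra.smul_def, Algebra.smul_def, ← IsScalarTower.algebraMap_apply,
        ← IsScalarTower.algebraMap_apply, mul_one]
    · rw [mul_comm, ← Algebra.smul_def]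
      exact Submodule.smul_mem_smul hx trivial
  obtain ⟨p, q, rfl⟩ := Submodule.mem_span_pair.1 (top_le (Submodule.mem_top (x := a)))
  exact ⟨p, q, by rw [Algebra.smul_def, Algebra.smul_def, mul_one]⟩

theorem exists_forall_exists_eq_add_mul [IsLocalRing D] [Module.Finite D A] {x : D}
    (hx : x ∈ maximalIdeal D) [Module.Finite k (A ⧸ Ideal.span {algebraMap D A x})]
    (hne : Ideal.span {algebraMap D A x} ≠ ⊤)
    (hfinrank : Module.finrank k (A ⧸ Ideal.span {algebraMap D A x}) ≤ 2) :
    ∃ w : A, ∀ a, ∃ p q : D, a = algebraMap D A p + algebraMap D A q * w :=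
  (exists_forall_sub_mem hne hfinrank).imp fun _ => forall_exists_eq_add_mul hx

theorem finrank_quotient_sup_range_le {w : A}
    (hw : ∀ a, ∃ p q : D, a = algebraMap D A p + algebraMap D A q * w) (F : Ideal A)
    [Module.Finite k (A ⧸ F.restrictScalars k)] :
    Module.finrank k (A ⧸ (F.restrictScalars k ⊔
        LinearMap.range (IsScalarTower.toAlgHom k D A).toLinearMap)) ≤
      Module.finrank k
        (D ⧸ (F.restrictScalars k).comap (IsScalarTower.toAlgHom k D A).toLinearMap) := by
  set F := F.restrictScalars k
  set j := (IsScalarTower.toAlgHom k D A).toLinearMap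
  have : Module.Finite k (D ⧸ F.comap j) :=
    Module.Finite.of_injective ((F.comap j).mapQ F j le_rfl) (by
      rw [← LinearMap.ker_eq_bot, Submodule.ker_mapQ, Submodule.mkQ_map_self])
  have comap_le : F.comap j ≤ (F ⊔ LinearMap.range j).comap (LinearMap.mulRight k w ∘ₗ j) :=
    fun _ hd => Submodule.mem_sup_left (Ideal.mul_mem_right w _ hd)
  refine LinearMap.finrank_le_finrank_of_surjective
    (f := (F.comap j).mapQ (F ⊔ LinearMap.range j) (LinearMap.mulRight k w ∘ₗ j) comap_le) ?_
  intro z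
  obtain ⟨z, rfl⟩ := Submodule.Quotient.mk_surjective _ z
  obtain ⟨p, q, rfl⟩ := hw z
  refine ⟨Submodule.Quotient.mk q, ?_⟩
  rw [Submodule.mapQ_apply, eq_comm, Submodule.Quotient.eq]
  exact Submodule.mem_sup_right ⟨p, (add_sub_cancel_right _ _).symm⟩

end TwoGenerators

section Weight

theorem IsAnalytic.finrank_quotient_maximalIdeal {O : Type*} [CommRing O] [IsLocalRing O]
    [Algebra ℂ O] (hO : IsAnalytic O) : Module.finrank ℂ (O ⧸ maximalIdeal O) = 1 := by
  refine finrank_eq_one_iff'.2 ⟨1, one_ne_zero, fun a => ?_⟩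
  obtain ⟨a, rfl⟩ := Ideal.Quotient.mk_surjective a
  obtain ⟨c, hc⟩ := hO.exists_sub_mem a
  refine ⟨c, ?_⟩
  rw [Algebra.smul_def, mul_one, eq_comm, ← sub_eq_zero]
  exact Ideal.Quotient.eq_zero_iff_mem.2 hc

theorem weight_zero {O : Type*} [CommRing O] [Algebra ℂ O] : weight O 0 = 0 := by
  have normFiltration_zero : normFiltration O 0 = ⊤ := by simp [normFiltration]
  have hilbert_zero : hilbert O 0 = 0 := by
    have : Subsingleton (O ⧸ filtration O 0) :=
      Ideal.Quotient.subsingleton_iff.2 (by rw [filtration, normFiltration_zero, Ideal.comap_top])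
    exact Module.finrank_zero_of_subsingleton
  have normHilbert_zero : normHilbert O 0 = 0 := by
    rw [normHilbert, normFiltration_zero, Submodule.restrictScalars_top, top_sup_eq]
    exact Module.finrank_zero_of_subsingleton
  rw [weight, hilbert_zero, normHilbert_zero, sub_self]

variable {O : Type*} [CommRing O] [IsLocalRing O]

theorem exists_pow_mem_normFiltration {x : O} (hx : x ∈ maximalIdeal O) (l : Lattice O) :
    ∃ k, algebraMap O (Normalization O) x ^ k ∈ normFiltration O l := by
  refine ⟨∑ M ∈ l.support, l M, ?_⟩
  rw [normFiltration, Ideal.mem_iInf]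
  intro M
  have hle : l M ≤ ∑ M ∈ l.support, l M := by
    by_cases hM : M ∈ l.support
    · exact Finset.single_le_sum (f := fun M => l M) (fun _ _ => Nat.zero_le _) hM
    · simp only [Finsupp.notMem_support_iff.1 hM, zero_le]
  exact Ideal.pow_le_pow_right hle
    (Ideal.pow_mem_pow (algebraMap_mem_of_isMaximal_normalization hx M.asIdeal) _)

theorem span_algebraMap_normalization_ne_top {x : O} (hx : x ∈ maximalIdeal O) :
    Ideal.span {algebraMap O (Normalization O) x} ≠ ⊤ := by
  obtain ⟨M, hM⟩ := Ideal.exists_maximal (Normalization O)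
  exact ne_top_of_le_ne_top hM.ne_top
    ((Ideal.span_singleton_le_iff_mem M).2 (algebraMap_mem_of_isMaximal_normalization hx M))

theorem IsGoodParameter.filtration_eq_maximalIdeal {x : O} (hx : IsGoodParameter O x)
    {l : Lattice O} (hl : normFiltration O l = Ideal.span {algebraMap O (Normalization O) x}) :
    filtration O l = maximalIdeal O := by
  rw [filtration, hl, ← hx.map_eq]
  refine le_antisymm (IsLocalRing.le_maximalIdeal fun h => ?_) Ideal.le_comap_map
  rw [Ideal.comap_eq_top_iff, hx.map_eq] at h
  exact span_algebraMap_normalization_ne_top hx.mem h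

variable [Algebra ℂ O] [IsReduced O] [Algebra (ConvergentSeries 1) O]
  [IsScalarTower ℂ (ConvergentSeries 1) O] [Module.Finite (ConvergentSeries 1) O]

theorem finite_quotient_normFiltration (hx : algebraMap (ConvergentSeries 1) O (coord 0) ∈ O⁰)
    (hxm : algebraMap (ConvergentSeries 1) O (coord 0) ∈ maximalIdeal O) (l : Lattice O) :
    Module.Finite ℂ (Normalization O ⧸ (normFiltration O l).restrictScalars ℂ) := by
  have := finite_normalization_of_coord_mem_nonZeroDivisors hx
  obtain ⟨k, hk⟩ := exists_pow_mem_normFiltration hxm l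
  refine finite_quotient_of_coord_pow_mul_mem (K := k) fun a => ?_
  rw [IsScalarTower.algebraMap_apply (ConvergentSeries 1) O (Normalization O)]
  exact Ideal.mul_mem_right _ _ hk

theorem finrank_quotient_normFiltration
    (hx : algebraMap (ConvergentSeries 1) O (coord 0) ∈ O⁰)
    (hxm : algebraMap (ConvergentSeries 1) O (coord 0) ∈ maximalIdeal O) (l : Lattice O) :
    Module.finrank ℂ (Normalization O ⧸ (normFiltration O l).restrictScalars ℂ) =
      normHilbert O l + hilbert O l := by
  have := finite_quotient_normFiltration hx hxm l
  rw [finrank_quotient_eq_add (normMap O), normHilbert, hilbert,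
    ← finrank_restrictScalars_quotient (filtration O l)]
  rfl

theorem IsGoodParameter.weight_eq (hO : IsAnalytic O)
    (hx : IsGoodParameter O (algebraMap (ConvergentSeries 1) O (coord 0))) {l : Lattice O}
    (hl : normFiltration O l = Ideal.span {algebraMap O (Normalization O)
      (algebraMap (ConvergentSeries 1) O (coord 0))}) :
    weight O l = 2 - (Module.finrank ℂ
      (O ⧸ Ideal.span {algebraMap (ConvergentSeries 1) O (coord 0)}) : ℤ) := by
  have hilbert_eq : hilbert O l = 1 := by
    rw [hilbert, hx.filtration_eq_maximalIdeal hl, hO.finrank_quotient_maximalIdeal]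
  have finrank_eq := finrank_quotient_normFiltration hx.mem_nonZeroDivisors hx.mem l
  rw [hl, finrank_restrictScalars_quotient,
    ← finrank_quotient_span_singleton hx.mem_nonZeroDivisors hx.mem_nonZeroDivisors] at finrank_eq
  rw [weight, finrank_eq, hilbert_eq]
  push_cast
  ring

theorem weight_nonneg (hx : algebraMap (ConvergentSeries 1) O (coord 0) ∈ O⁰)
    (hxm : algebraMap (ConvergentSeries 1) O (coord 0) ∈ maximalIdeal O)
    (he : Module.finrank ℂ (O ⧸ Ideal.span {algebraMap (ConvergentSeries 1) O (coord 0)}) ≤ 2)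
    (l : Lattice O) : 0 ≤ weight O l := by
  have := finite_normalization_of_coord_mem_nonZeroDivisors hx
  have := finite_quotient_normFiltration hx hxm l
  have hne := span_algebraMap_normalization_ne_top hxm
  rw [finrank_quotient_span_singleton hx hx, ← IsScalarTower.algebraMap_apply] at he
  rw [← IsScalarTower.algebraMap_apply] at hne
  have : Module.Finite ℂ (Normalization O ⧸
      Ideal.span {algebraMap (ConvergentSeries 1) (Normalization O) (coord 0)}) :=
    finite_quotient_of_coord_pow_mem (K := 1) (by
      rw [pow_one]; exact Ideal.mem_span_singleton_self _)
  obtain ⟨w, hw⟩ := exists_forall_exists_eq_add_mul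
    (mem_maximalIdeal_iff.2 (evalZero_coord (0 : Fin 1))) hne he
  set F := (normFiltration O l).restrictScalars ℂ with hF
  let j : ConvergentSeries 1 →ₗ[ℂ] Normalization O :=
    (IsScalarTower.toAlgHom ℂ (ConvergentSeries 1) (Normalization O)).toLinearMap
  have finrank_eq := finrank_quotient_normFiltration hx hxm l
  rw [← hF, finrank_quotient_eq_add j F] at finrank_eq
  have normHilbert_le :
      normHilbert O l ≤ Module.finrank ℂ (Normalization O ⧸ (F ⊔ LinearMap.range j)) := by
    have : Module.Finite ℂ (Normalization O ⧸ (F ⊔ LinearMap.range j)) :=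
      Module.Finite.of_surjective _ (Submodule.factor_surjective
        (le_sup_left : F ≤ F ⊔ LinearMap.range j))
    refine finrank_quotient_le_of_le (sup_le_sup le_rfl ?_)
    rintro _ ⟨d, rfl⟩
    exact ⟨algebraMap _ O d, (IsScalarTower.algebraMap_apply (ConvergentSeries 1) O _ d).symm⟩
  have finrank_le : Module.finrank ℂ (Normalization O ⧸ (F ⊔ LinearMap.range j)) ≤
      Module.finrank ℂ (ConvergentSeries 1 ⧸ F.comap j) :=
    finrank_quotient_sup_range_le hw (normFiltration O l)
  rw [weight]
  omega

theorem IsGoodParameter.isLeast_weight_iff (hO : IsAnalytic O)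
    (hx : IsGoodParameter O (algebraMap (ConvergentSeries 1) O (coord 0))) :
    IsLeast (Set.range (weight O)) 0 ↔ Module.finrank ℂ
      (O ⧸ Ideal.span {algebraMap (ConvergentSeries 1) O (coord 0)}) ≤ 2 := by
  constructor
  · rintro ⟨-, h⟩
    obtain ⟨l, hl⟩ := hx.exists_filtration
    have weight_nonneg := h ⟨l, rfl⟩
    rw [hx.weight_eq hO hl] at weight_nonneg
    omega
  · refine fun he => ⟨⟨0, weight_zero⟩, ?_⟩
    rintro _ ⟨l, rfl⟩
    exact weight_nonneg hx.mem_nonZeroDivisors hx.mem he l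

end Weight

section MaximalIdealPair

variable {A : Type*} [CommRing A] [IsLocalRing A] {x y : A}

theorem mul_mem_of_maximalIdeal_eq_span_pair (hm : maximalIdeal A = Ideal.span {x, y})
    (hy : y ^ 2 ∈ Ideal.span {x}) {a : A} (ha : a ∈ maximalIdeal A) :
    y * a ∈ Ideal.span {x} := by
  rw [hm, Ideal.mem_span_pair] at ha
  obtain ⟨b, c, rfl⟩ := ha
  have mem := add_mem (Ideal.mul_mem_left _ (y * b) (Ideal.mem_span_singleton_self x))
    (Ideal.mul_mem_left _ c hy)
  convert mem using 1
  ring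

theorem maximalIdeal_sq_le_of_eq_span_pair (hm : maximalIdeal A = Ideal.span {x, y})
    (hy : y ^ 2 ∈ Ideal.span {x}) : maximalIdeal A ^ 2 ≤ Ideal.span {x} := by
  rw [pow_two, Ideal.mul_le]
  intro a ha b hb
  rw [hm, Ideal.mem_span_pair] at ha
  obtain ⟨c, d, rfl⟩ := ha
  have mem := add_mem (Ideal.mul_mem_left _ (c * b) (Ideal.mem_span_singleton_self x))
    (Ideal.mul_mem_left _ d (mul_mem_of_maximalIdeal_eq_span_pair hm hy hb))
  convert mem using 1
  ring

theorem IsAnalytic.exists_sub_mem_of_maximalIdeal_eq_span_pair [Algebra ℂ A] (hA : IsAnalytic A)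
    (hm : maximalIdeal A = Ideal.span {x, y}) (hy : y ^ 2 ∈ Ideal.span {x}) (a : A) :
    ∃ c d : ℂ, a - (algebraMap ℂ A c + algebraMap ℂ A d * y) ∈ Ideal.span {x} := by
  obtain ⟨c, hc⟩ := hA.exists_sub_mem a
  rw [hm, Ideal.mem_span_pair] at hc
  obtain ⟨f, g, hfg⟩ := hc
  obtain ⟨d, hd⟩ := hA.exists_sub_mem g
  have mem := add_mem (Ideal.mul_mem_left _ f (Ideal.mem_span_singleton_self x))
    (mul_mem_of_maximalIdeal_eq_span_pair hm hy hd)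
  refine ⟨c, d, ?_⟩
  convert mem using 1
  linear_combination -hfg

end MaximalIdealPair

section NormalForm

theorem coord_zero_dvd_of_dvd_coord_one_sq_mul {f : ConvergentSeries 2}
    (h : coord 0 ∣ coord 1 ^ 2 * f) : coord 0 ∣ f := by
  rw [coord_dvd_iff] at h ⊢
  intro d hd
  have coeff_eq_zero := h (Finsupp.single 1 2 + d) (by simp [hd])
  rw [← coeff_eq_zero]
  change _ = MvPowerSeries.coeff _ (MvPowerSeries.X 1 ^ 2 * f.1)
  rw [MvPowerSeries.X_pow_eq, MvPowerSeries.coeff_add_monomial_mul, one_mul]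

variable {A : Type*} [CommRing A] [Algebra ℂ A] {n : ℕ}

theorem isAType_iff_exists_algHom : IsAType A n ↔
    ∃ π : ConvergentSeries 2 →ₐ[ℂ] A, Function.Surjective π ∧
      RingHom.ker π = Ideal.span {coord 0 ^ (n + 1) + coord 1 ^ 2} := by
  constructor
  · rintro ⟨e⟩
    refine ⟨e.symm.toAlgHom.comp (Ideal.Quotient.mkₐ ℂ _),
      e.symm.surjective.comp (Ideal.Quotient.mkₐ_surjective ℂ _), ?_⟩
    ext f
    rw [RingHom.mem_ker, ← Ideal.Quotient.eq_zero_iff_mem]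
    exact e.symm.map_eq_zero_iff
  · rintro ⟨π, hπ, hker⟩
    exact ⟨((Ideal.quotientEquivAlgOfEq ℂ hker.symm).trans
      (Ideal.quotientKerAlgEquivOfSurjective hπ)).symm⟩

theorem IsAType.isLocalRing (h : IsAType A n) : IsLocalRing A := by
  obtain ⟨π, hπ, hker⟩ := isAType_iff_exists_algHom.1 h
  have : Nontrivial A := (subsingleton_or_nontrivial A).resolve_left fun _ => by
    have hone : (1 : ConvergentSeries 2) ∈ RingHom.ker π := Subsingleton.elim _ _
    rw [hker, Ideal.mem_span_singleton, ← isUnit_iff_dvd_one, isUnit_iff] at hone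
    exact hone (by simp)
  exact IsLocalRing.of_surjective' π.toRingHom hπ

variable {π : ConvergentSeries 2 →ₐ[ℂ] A}

theorem map_coord_one_sq_eq
    (hker : RingHom.ker π = Ideal.span {coord 0 ^ (n + 1) + coord 1 ^ 2}) :
    π (coord 1) ^ 2 = -π (coord 0) ^ (n + 1) := by
  rw [eq_neg_iff_add_eq_zero, add_comm, ← map_pow, ← map_pow, ← map_add, ← RingHom.mem_ker, hker]
  exact Ideal.mem_span_singleton_self _

theorem map_coord_zero_mem_nonZeroDivisors (hπ : Function.Surjective π)
    (hker : RingHom.ker π = Ideal.span {coord 0 ^ (n + 1) + coord 1 ^ 2}) :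
    π (coord 0) ∈ A⁰ := by
  rw [mem_nonZeroDivisors_iff_right]
  intro g hg
  obtain ⟨g, rfl⟩ := hπ g
  rw [← map_mul, ← RingHom.mem_ker, hker, Ideal.mem_span_singleton] at hg
  obtain ⟨r, hr⟩ := hg
  obtain ⟨r, rfl⟩ : coord 0 ∣ r := coord_zero_dvd_of_dvd_coord_one_sq_mul
    ⟨g - coord 0 ^ n * r, by linear_combination -hr⟩
  rw [← RingHom.mem_ker, hker, Ideal.mem_span_singleton]
  exact ⟨r, mul_left_cancel₀ (coord_ne_zero 0) (by linear_combination hr)⟩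

section IsLocalRing

variable [IsLocalRing A]

theorem maximalIdeal_eq_span_pair (hπ : Function.Surjective π) :
    maximalIdeal A = Ideal.span {π (coord 0), π (coord 1)} := by
  rw [← map_maximalIdeal_of_surjective π.toRingHom hπ]
  refine (map_maximalIdeal_eq_span π).trans ?_
  congr 1
  ext z
  simp only [Set.mem_range, Fin.exists_fin_two, Set.mem_insert_iff, Set.mem_singleton_iff,
    eq_comm (a := z)]

theorem exists_finite_algebra_of_ker_eq (hπ : Function.Surjective π)
    (hker : RingHom.ker π = Ideal.span {coord 0 ^ (n + 1) + coord 1 ^ 2}) :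
    ∃ (_ : Algebra (ConvergentSeries 1) A) (_ : IsScalarTower ℂ (ConvergentSeries 1) A),
      Module.Finite (ConvergentSeries 1) A ∧
      algebraMap (ConvergentSeries 1) A (coord 0) = π (coord 0) ∧
      ∀ a, ∃ c d : ℂ, a - (algebraMap ℂ A c + algebraMap ℂ A d * π (coord 1)) ∈
        Ideal.span {π (coord 0)} := by
  have hA : IsAnalytic A := ⟨2, π, hπ⟩
  have hm := maximalIdeal_eq_span_pair hπ
  have y_sq_mem : π (coord 1) ^ 2 ∈ Ideal.span {π (coord 0)} := by
    rw [map_coord_one_sq_eq hker, pow_succ]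
    exact neg_mem (Ideal.mul_mem_left _ _ (Ideal.mem_span_singleton_self _))
  obtain ⟨i, j, hfinite, coord_eq⟩ := hA.exists_finite_algebra (hA.map_coord_mem π 0)
    (maximalIdeal_sq_le_of_eq_span_pair hm y_sq_mem)
  exact ⟨i, j, hfinite, coord_eq, hA.exists_sub_mem_of_maximalIdeal_eq_span_pair hm y_sq_mem⟩

theorem IsAType.exists_finite_algebra (h : IsAType A n) :
    ∃ (_ : Algebra (ConvergentSeries 1) A) (_ : IsScalarTower ℂ (ConvergentSeries 1) A),
      Module.Finite (ConvergentSeries 1) A ∧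
      algebraMap (ConvergentSeries 1) A (coord 0) ∈ A⁰ ∧
      algebraMap (ConvergentSeries 1) A (coord 0) ∈ maximalIdeal A ∧
      Module.finrank ℂ
        (A ⧸ Ideal.span {algebraMap (ConvergentSeries 1) A (coord 0)}) ≤ 2 := by
  obtain ⟨π, hπ, hker⟩ := isAType_iff_exists_algHom.1 h
  obtain ⟨i, j, hfinite, coord_eq, hsub⟩ := exists_finite_algebra_of_ker_eq hπ hker
  refine ⟨i, j, hfinite, ?_⟩
  rw [coord_eq]
  exact ⟨map_coord_zero_mem_nonZeroDivisors hπ hker, IsAnalytic.map_coord_mem ⟨2, π, hπ⟩ π 0,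
    finrank_quotient_le_two hsub⟩

end IsLocalRing

/-- The inclusion of `ℂ{x}` into `ℂ{x, y}`. -/
def inclX : ConvergentSeries 1 →ₐ[ℂ] ConvergentSeries 2 :=
  substHom (fun _ => coord 0) fun _ => evalZero_coord 0

theorem inclX_coord : inclX (coord 0) = coord 0 :=
  substHom_coord _ _ _

theorem IsAType.exists_dvd_sub (h : IsAType A n) (f : ConvergentSeries 2) :
    ∃ p q, coord 0 ^ (n + 1) + coord 1 ^ 2 ∣ f - (inclX p + inclX q * coord 1) := by
  have := h.isLocalRing
  obtain ⟨π, hπ, hker⟩ := isAType_iff_exists_algHom.1 h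
  obtain ⟨_, _, _, coord_eq, hsub⟩ := exists_finite_algebra_of_ker_eq hπ hker
  have comp_inclX : π.comp inclX = IsScalarTower.toAlgHom ℂ (ConvergentSeries 1) A :=
    IsAnalytic.algHom_ext ⟨2, π, hπ⟩ fun i => by
      rw [Subsingleton.elim i 0, AlgHom.comp_apply, inclX_coord]
      exact coord_eq.symm
  have map_inclX (p : ConvergentSeries 1) : π (inclX p) = algebraMap _ A p :=
    DFunLike.congr_fun comp_inclX p
  obtain ⟨p, q, hpq⟩ := forall_exists_eq_add_mul
    (mem_maximalIdeal_iff.2 (evalZero_coord (0 : Fin 1))) (coord_eq ▸ hsub) (π f)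
  refine ⟨p, q, Ideal.mem_span_singleton.1 (hker ▸ RingHom.mem_ker.2 ?_)⟩
  rw [map_sub, map_add, map_mul, map_inclX, map_inclX, hpq, sub_self]

theorem exists_dvd_sub_inclX_add_mul (n : ℕ) (f : ConvergentSeries 2) :
    ∃ p q, coord 0 ^ (n + 1) + coord 1 ^ 2 ∣ f - (inclX p + inclX q * coord 1) :=
  IsAType.exists_dvd_sub (A := AType n) ⟨AlgEquiv.refl⟩ f

theorem IsAnalytic.isAType_of_sq_eq {O : Type*} [CommRing O] [IsLocalRing O] [Algebra ℂ O]
    (hO : IsAnalytic O) [Algebra (ConvergentSeries 1) O] [IsScalarTower ℂ (ConvergentSeries 1) O]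
    (hx : algebraMap (ConvergentSeries 1) O (coord 0) ∈ maximalIdeal O) {y : O} {n : ℕ}
    (hy : y ^ 2 = -algebraMap (ConvergentSeries 1) O (coord 0) ^ (n + 1))
    (hgen : ∀ a, ∃ p q : ConvergentSeries 1,
      a = algebraMap (ConvergentSeries 1) O p + algebraMap (ConvergentSeries 1) O q * y)
    (hind : ∀ p q : ConvergentSeries 1,
      algebraMap (ConvergentSeries 1) O p + algebraMap (ConvergentSeries 1) O q * y = 0 →
        p = 0 ∧ q = 0) :
    IsAType O n := by
  have hym : y ∈ maximalIdeal O := by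
    refine Ideal.IsPrime.mem_of_pow_mem inferInstance 2 ?_
    rw [hy]
    exact neg_mem (Ideal.pow_mem_of_mem _ hx _ n.succ_pos)
  obtain ⟨π, hπ⟩ := hO.exists_algHom_coord_eq
    ![algebraMap (ConvergentSeries 1) O (coord 0), y] (Fin.forall_fin_two.2 ⟨hx, hym⟩)
  obtain ⟨hπx, hπy⟩ : π (coord 0) = algebraMap (ConvergentSeries 1) O (coord 0) ∧
    π (coord 1) = y := ⟨hπ 0, hπ 1⟩
  have comp_inclX : π.comp inclX = IsScalarTower.toAlgHom ℂ (ConvergentSeries 1) O :=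
    hO.algHom_ext fun i => by
      rw [Subsingleton.elim i 0, AlgHom.comp_apply, inclX_coord]
      exact hπx
  have map_inclX (p : ConvergentSeries 1) : π (inclX p) = algebraMap _ O p :=
    DFunLike.congr_fun comp_inclX p
  have map_eq_zero : π (coord 0 ^ (n + 1) + coord 1 ^ 2) = 0 := by
    rw [map_add, map_pow, map_pow, hπx, hπy, hy, add_neg_cancel]
  refine isAType_iff_exists_algHom.2 ⟨π, fun a => ?_, le_antisymm (fun f hf => ?_) ?_⟩
  · obtain ⟨p, q, rfl⟩ := hgen a
    exact ⟨inclX p + inclX q * coord 1, by rw [map_add, map_mul, map_inclX, map_inclX, hπy]⟩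
  · obtain ⟨p, q, r, hr⟩ := exists_dvd_sub_inclX_add_mul n f
    have map_eq := congrArg π hr
    rw [map_sub, map_add, map_mul, map_mul, map_inclX, map_inclX, hπy, RingHom.mem_ker.1 hf,
      map_eq_zero, zero_mul, zero_sub, neg_eq_zero] at map_eq
    obtain ⟨rfl, rfl⟩ := hind p q map_eq
    rw [map_zero, zero_mul, add_zero, sub_zero] at hr
    exact Ideal.mem_span_singleton.2 ⟨r, hr⟩
  · exact (Ideal.span_singleton_le_iff_mem _).2 (RingHom.mem_ker.2 map_eq_zero)

end NormalForm

section Domination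

theorem BirationallyDominates.exists_finrank_quotient_eq {O A : Type*} [CommRing O]
    [IsLocalRing O] [Algebra ℂ O] [CommRing A] [IsLocalRing A] [IsReduced A] [Algebra ℂ A]
    [Algebra (ConvergentSeries 1) A] [IsScalarTower ℂ (ConvergentSeries 1) A]
    [Module.Finite (ConvergentSeries 1) A] (h : BirationallyDominates O A)
    (hx : algebraMap (ConvergentSeries 1) A (coord 0) ∈ A⁰)
    (hxm : algebraMap (ConvergentSeries 1) A (coord 0) ∈ maximalIdeal A) :
    ∃ y ∈ maximalIdeal O, y ∈ O⁰ ∧ Module.finrank ℂ (O ⧸ Ideal.span {y}) =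
      Module.finrank ℂ (A ⧸ Ideal.span {algebraMap (ConvergentSeries 1) A (coord 0)}) := by
  obtain ⟨φ, ψ, -, hψ, hψφ⟩ := h
  replace hψφ (a : A) : ψ (φ a) = algebraMap A (Normalization A) a := DFunLike.congr_fun hψφ a
  set x := algebraMap (ConvergentSeries 1) A (coord 0)
  have hψx : ψ (φ x) ∈ (Normalization A)⁰ := by
    rw [hψφ]
    exact algebraMap_normalization_mem_nonZeroDivisors hx
  refine ⟨φ x, fun hunit => ?_, mem_nonZeroDivisors_of_injective hψ hψx, ?_⟩
  · refine span_algebraMap_normalization_ne_top hxm (Ideal.span_singleton_eq_top.2 ?_)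
    exact hψφ x ▸ hunit.map ψ
  · have map_le : ((Ideal.span {x}).restrictScalars ℂ).map (normMap A) ≤
        ((Ideal.span {φ x}).restrictScalars ℂ).map ψ.toLinearMap := by
      rintro _ ⟨a, ha, rfl⟩
      exact ⟨φ a, Ideal.mem_span_singleton.2 (map_dvd φ (Ideal.mem_span_singleton.1 ha)), hψφ a⟩
    have := finite_quotient_map_normMap hx (n := 1) <| by
      rw [pow_one]
      exact Ideal.mem_span_singleton_self x
    have : Module.Finite ℂ
        (Normalization A ⧸ ((Ideal.span {φ x}).restrictScalars ℂ).map ψ.toLinearMap) :=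
      Module.Finite.of_surjective _ (Submodule.factor_surjective map_le)
    rw [finrank_quotient_span_singleton_of_injective hψ hψx, hψφ,
      finrank_quotient_span_singleton hx hx]

theorem BirationallyDominates.exists_finrank_quotient_le_two {O A : Type*} [CommRing O]
    [IsLocalRing O] [Algebra ℂ O] [IsReduced O] [CommRing A] [Algebra ℂ A] {n : ℕ}
    (h : BirationallyDominates O A) (hA : IsAType A n) :
    ∃ y ∈ maximalIdeal O, y ∈ O⁰ ∧ Module.finrank ℂ (O ⧸ Ideal.span {y}) ≤ 2 := by
  have := hA.isLocalRing
  have : IsReduced A := h.elim fun φ ⟨_, hφ, _⟩ => isReduced_of_injective φ hφ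
  obtain ⟨_, _, _, hx, hxm, hfinrank⟩ := hA.exists_finite_algebra
  obtain ⟨y, hym, hy, finrank_eq⟩ := h.exists_finrank_quotient_eq hx hxm
  exact ⟨y, hym, hy, finrank_eq.trans_le hfinrank⟩

theorem BirationallyDominates.of_isAType {O : Type*} [CommRing O] [Algebra ℂ O] {n : ℕ}
    (h : IsAType O n) : BirationallyDominates O (AType n) := by
  obtain ⟨e⟩ := h
  refine ⟨e.symm.toAlgHom, (IsScalarTower.toAlgHom ℂ (AType n) _).comp e.toAlgHom,
    e.symm.injective, injective_algebraMap_normalization.comp e.injective, ?_⟩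
  ext a
  simp

end Domination

section MultiplicityTwo

theorem eq_or_eq_neg_of_sq_eq_sq_of_isUnit {A : Type*} [CommRing A] [IsLocalRing A] {a b : A}
    (htwo : IsUnit (2 : A)) (hb : IsUnit b) (h : a ^ 2 = b ^ 2) : a = b ∨ a = -b := by
  have mul_eq_zero : (a - b) * (a + b) = 0 := by linear_combination h
  have isUnit_add : IsUnit ((a + b) + -(a - b)) := by
    convert htwo.mul hb using 1
    ring
  rcases isUnit_or_isUnit_of_isUnit_add isUnit_add with hunit | hunit
  · exact .inl (sub_eq_zero.1 (hunit.mul_left_eq_zero.1 mul_eq_zero))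
  · exact .inr (eq_neg_of_add_eq_zero_left
      (((IsUnit.neg_iff _).1 hunit).mul_right_eq_zero.1 mul_eq_zero))

section CompleteSquare

variable {D A : Type*} [CommRing D] [CommRing A] [Algebra D A] {w : A}

theorem exists_sub_algebraMap_sq_eq (htwo : IsUnit (2 : D))
    (hw : ∀ a, ∃ p q : D, a = algebraMap D A p + algebraMap D A q * w) :
    ∃ b c : D, (w - algebraMap D A b) ^ 2 = algebraMap D A c := by
  obtain ⟨p, q, hpq⟩ := hw (w ^ 2)
  obtain ⟨r, hr⟩ := htwo.exists_right_inv
  replace hr := congrArg (algebraMap D A) hr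
  rw [map_mul, map_ofNat, map_one] at hr
  refine ⟨r * q, p + (r * q) ^ 2, ?_⟩
  rw [map_add, map_pow, map_mul]
  linear_combination hpq - w * algebraMap D A q * hr

theorem eq_algebraMap_add_inv_mul (w : A) (b : D) (s : Dˣ) :
    w = algebraMap D A b +
      algebraMap D A (s⁻¹ : Dˣ) * (algebraMap D A s * (w - algebraMap D A b)) := by
  rw [← mul_assoc, ← map_mul, Units.inv_mul, map_one]
  ring

variable {b : D} {s : Dˣ}

theorem unit_mul_sub_notMem_range (hw : w ∉ (algebraMap D A).range) :
    algebraMap D A s * (w - algebraMap D A b) ∉ (algebraMap D A).range :=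
  fun hmem =>
    hw (eq_algebraMap_add_inv_mul w b s ▸ add_mem ⟨b, rfl⟩ (mul_mem ⟨_, rfl⟩ hmem))

theorem forall_exists_eq_add_mul_unit_mul_sub
    (hw : ∀ a, ∃ p q : D, a = algebraMap D A p + algebraMap D A q * w) (a : A) :
    ∃ p q : D, a = algebraMap D A p +
      algebraMap D A q * (algebraMap D A s * (w - algebraMap D A b)) := by
  obtain ⟨p, q, rfl⟩ := hw a
  refine ⟨p + q * b, q * (s⁻¹ : Dˣ), ?_⟩
  rw [map_add, map_mul, map_mul]
  linear_combination algebraMap D A q * eq_algebraMap_add_inv_mul w b s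

theorem eq_zero_of_add_mul_eq_zero [IsDomain D] [ValuationRing D] [IsLocalHom (algebraMap D A)]
    (hD : ∀ d : D, d ≠ 0 → algebraMap D A d ∈ A⁰) (hw : w ∉ (algebraMap D A).range) {p q : D}
    (h : algebraMap D A p + algebraMap D A q * w = 0) : p = 0 ∧ q = 0 := by
  have eq_zero {d : D} (hd : d ≠ 0) {a : A} (ha : algebraMap D A d * a = 0) : a = 0 :=
    (mem_nonZeroDivisors_iff.1 (hD d hd)).1 a ha
  rcases ValuationRing.dvd_total q p with ⟨r, rfl⟩ | ⟨r, rfl⟩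
  · by_contra hq
    have add_eq_zero : algebraMap D A r + w = 0 :=
      eq_zero (d := q) (fun h0 => hq (by simp [h0])) (by rw [map_mul] at h; linear_combination h)
    exact hw ⟨-r, by rw [map_neg]; linear_combination -add_eq_zero⟩
  · by_contra hp
    have one_add_eq_zero : 1 + algebraMap D A r * w = 0 :=
      eq_zero (d := p) (fun h0 => hp (by simp [h0])) (by rw [map_mul] at h; linear_combination h)
    have hr : IsUnit (algebraMap D A r) :=
      IsUnit.of_mul_eq_one (-w) (by linear_combination -one_add_eq_zero)
    obtain ⟨s, hs⟩ := (isUnit_of_map_unit _ _ hr).exists_right_inv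
    replace hs := congrArg (algebraMap D A) hs
    rw [map_mul, map_one] at hs
    refine hw ⟨-s, ?_⟩
    rw [map_neg]
    linear_combination (-algebraMap D A s) * one_add_eq_zero + w * hs

end CompleteSquare

variable {O : Type*} [CommRing O] [IsLocalRing O] [Algebra (ConvergentSeries 1) O]

theorem isLocalHom_algebraMap
    (hxm : algebraMap (ConvergentSeries 1) O (coord 0) ∈ maximalIdeal O) :
    IsLocalHom (algebraMap (ConvergentSeries 1) O) := by
  refine ⟨fun d hd => by_contra fun hnonunit => hxm (isUnit_of_dvd_unit (map_dvd _ ?_) hd)⟩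
  rwa [← Ideal.mem_span_singleton, ← maximalIdeal_eq_span_singleton]

theorem isUnit_two (N : ℕ) : IsUnit (2 : ConvergentSeries N) := by
  rw [← map_ofNat (algebraMap ℂ (ConvergentSeries N)) 2]
  exact (isUnit_iff_ne_zero.2 two_ne_zero).map _

theorem mem_range_of_sq_eq_neg_one {y : O} (hy : y ^ 2 = -1) :
    y ∈ (algebraMap (ConvergentSeries 1) O).range := by
  let i : ConvergentSeries 1 := algebraMap ℂ _ Complex.I
  have sq_eq : y ^ 2 = algebraMap _ O i ^ 2 := by
    rw [hy, ← map_pow, ← map_pow, Complex.I_sq, map_neg, map_neg, map_one, map_one]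
  have htwo : IsUnit (2 : O) := by
    rw [← map_ofNat (algebraMap (ConvergentSeries 1) O) 2]
    exact (isUnit_two 1).map _
  have hi : IsUnit (algebraMap _ O i) :=
    ((isUnit_iff_ne_zero.2 Complex.I_ne_zero).map _).map _
  rcases eq_or_eq_neg_of_sq_eq_sq_of_isUnit htwo hi sq_eq with rfl | rfl
  · exact ⟨i, rfl⟩
  · exact ⟨-i, map_neg _ i⟩

theorem exists_unit_mul_sub_sq_eq_neg_pow [IsReduced O] {w : O}
    (hw : w ∉ (algebraMap (ConvergentSeries 1) O).range)
    (hgen : ∀ a, ∃ p q : ConvergentSeries 1,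
      a = algebraMap (ConvergentSeries 1) O p + algebraMap (ConvergentSeries 1) O q * w) :
    ∃ (n : ℕ) (b : ConvergentSeries 1) (s : (ConvergentSeries 1)ˣ),
      (algebraMap (ConvergentSeries 1) O s * (w - algebraMap (ConvergentSeries 1) O b)) ^ 2 =
        -algebraMap (ConvergentSeries 1) O (coord 0) ^ (n + 1) := by
  obtain ⟨b, c, hbc⟩ := exists_sub_algebraMap_sq_eq (isUnit_two 1) hgen
  have hc : c ≠ 0 := by
    rintro rfl
    rw [map_zero, sq_eq_zero_iff, sub_eq_zero] at hbc
    exact hw ⟨b, hbc.symm⟩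
  obtain ⟨m, u, rfl⟩ :=
    IsDiscreteValuationRing.eq_unit_mul_pow_irreducible hc irreducible_coord
  obtain ⟨s, hs⟩ := exists_sq_eq_of_isUnit (-u⁻¹).isUnit
  obtain ⟨s, rfl⟩ : IsUnit s := (isUnit_pow_iff two_ne_zero).1 (hs ▸ (-u⁻¹).isUnit)
  have sq_eq : (algebraMap _ O (s : ConvergentSeries 1) * (w - algebraMap _ O b)) ^ 2 =
      -algebraMap (ConvergentSeries 1) O (coord 0) ^ m := by
    rw [mul_pow, hbc, ← map_pow, ← map_mul, hs, ← mul_assoc, Units.val_neg, neg_mul,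
      Units.inv_mul, neg_one_mul, map_neg, map_pow]
  cases m with
  | zero =>
    rw [pow_zero] at sq_eq
    exact absurd (mem_range_of_sq_eq_neg_one sq_eq) (unit_mul_sub_notMem_range hw)
  | succ n => exact ⟨n, b, s, sq_eq⟩

end MultiplicityTwo

section Classification

variable {O : Type*} [CommRing O] [IsLocalRing O] [Algebra ℂ O]

theorem IsAnalytic.nonempty_algEquiv_of_maximalIdeal_eq_span (hO : IsAnalytic O) {x : O}
    (hx : x ∈ O⁰) (hm : maximalIdeal O = Ideal.span {x}) :
    Nonempty (ConvergentSeries 1 ≃ₐ[ℂ] O) := by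
  obtain ⟨_, _, _, rfl⟩ := hO.exists_finite_algebra (x := x) (K := 1)
    (hm ▸ Ideal.mem_span_singleton_self x) (by rw [pow_one, hm])
  refine ⟨AlgEquiv.ofBijective (IsScalarTower.toAlgHom ℂ _ O) ⟨?_, fun a => ?_⟩⟩
  · refine (injective_iff_map_eq_zero _).2 fun d hd => by_contra fun hd0 => ?_
    exact nonZeroDivisors.ne_zero (algebraMap_mem_nonZeroDivisors hx hd0) hd
  · have sub_mem (a : O) : ∃ c d : ℂ, a - (algebraMap ℂ O c + algebraMap ℂ O d * 0) ∈
        Ideal.span {algebraMap (ConvergentSeries 1) O (coord 0)} := by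
      obtain ⟨c, hc⟩ := hO.exists_sub_mem a
      exact ⟨c, 0, by rwa [mul_zero, add_zero, ← hm]⟩
    obtain ⟨p, q, rfl⟩ := forall_exists_eq_add_mul
      (mem_maximalIdeal_iff.2 (evalZero_coord (0 : Fin 1))) sub_mem a
    exact ⟨p, by rw [mul_zero, add_zero]; rfl⟩

theorem IsAType.nonempty_algEquiv {A : Type*} [CommRing A] [Algebra ℂ A] (hA : IsAType A 0) :
    Nonempty (ConvergentSeries 1 ≃ₐ[ℂ] A) := by
  have := hA.isLocalRing
  obtain ⟨π, hπ, hker⟩ := isAType_iff_exists_algHom.1 hA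
  have coord_zero_eq : π (coord 0) = -π (coord 1) ^ 2 := by
    rw [map_coord_one_sq_eq hker, zero_add, pow_one, neg_neg]
  have hy : π (coord 1) ∈ A⁰ := by
    have hx := map_coord_zero_mem_nonZeroDivisors hπ hker
    rw [coord_zero_eq, pow_two, ← neg_mul, mul_mem_nonZeroDivisors] at hx
    exact hx.2
  refine IsAnalytic.nonempty_algEquiv_of_maximalIdeal_eq_span ⟨2, π, hπ⟩ hy ?_
  rw [maximalIdeal_eq_span_pair hπ, Ideal.span_insert, sup_eq_right,
    Ideal.span_singleton_le_span_singleton, coord_zero_eq, dvd_neg]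
  exact dvd_pow_self _ two_ne_zero

theorem IsAnalytic.isAType_zero_of_maximalIdeal_eq_span (hO : IsAnalytic O) {x : O}
    (hx : x ∈ O⁰) (hm : maximalIdeal O = Ideal.span {x}) : IsAType O 0 := by
  obtain ⟨e⟩ := hO.nonempty_algEquiv_of_maximalIdeal_eq_span hx hm
  obtain ⟨e'⟩ := IsAType.nonempty_algEquiv (A := AType 0) ⟨AlgEquiv.refl⟩
  exact ⟨e.symm.trans e'⟩

theorem IsAnalytic.exists_isAType_of_finrank_le_two (hO : IsAnalytic O) [IsReduced O]
    [Algebra (ConvergentSeries 1) O] [IsScalarTower ℂ (ConvergentSeries 1) O]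
    [Module.Finite (ConvergentSeries 1) O]
    (hx : algebraMap (ConvergentSeries 1) O (coord 0) ∈ O⁰)
    (hxm : algebraMap (ConvergentSeries 1) O (coord 0) ∈ maximalIdeal O)
    (he : Module.finrank ℂ (O ⧸ Ideal.span {algebraMap (ConvergentSeries 1) O (coord 0)}) ≤ 2) :
    ∃ n, IsAType O n := by
  have : Module.Finite ℂ (O ⧸ Ideal.span {algebraMap (ConvergentSeries 1) O (coord 0)}) :=
    finite_quotient_of_coord_pow_mem (K := 1) <| by
      rw [pow_one]
      exact Ideal.mem_span_singleton_self _
  obtain ⟨w, hgen⟩ := exists_forall_exists_eq_add_mul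
    (mem_maximalIdeal_iff.2 (evalZero_coord (0 : Fin 1)))
    (fun htop => hxm (Ideal.span_singleton_eq_top.1 htop)) he
  by_cases hw : w ∈ (algebraMap (ConvergentSeries 1) O).range
  · have surjective : Function.Surjective (algebraMap (ConvergentSeries 1) O) := by
      obtain ⟨r, rfl⟩ := hw
      intro a
      obtain ⟨p, q, rfl⟩ := hgen a
      exact ⟨p + q * r, by rw [map_add, map_mul]⟩
    refine ⟨0, hO.isAType_zero_of_maximalIdeal_eq_span hx ?_⟩
    rw [← map_maximalIdeal_of_surjective _ surjective, maximalIdeal_eq_span_singleton,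
      Ideal.map_span, Set.image_singleton]
  · have := isLocalHom_algebraMap hxm
    obtain ⟨n, b, s, sq_eq⟩ := exists_unit_mul_sub_sq_eq_neg_pow hw hgen
    exact ⟨n, hO.isAType_of_sq_eq hxm sq_eq (forall_exists_eq_add_mul_unit_mul_sub hgen)
      fun p q => eq_zero_of_add_mul_eq_zero (fun d => algebraMap_mem_nonZeroDivisors hx)
        (unit_mul_sub_notMem_range hw)⟩

end Classification

end

end CurveGerm

theorem mainTheorem7 {O : Type*} [CommRing O] [IsLocalRing O] [Algebra ℂ O]
    (hO : CurveGerm.IsReducedCurveGerm O) :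
    List.TFAE [
      ∃ e : ℕ, e ≤ 2 ∧ CurveGerm.HasMultiplicity O e,
      IsLeast (Set.range (CurveGerm.weight O)) 0,
      ∃ n : ℕ, CurveGerm.BirationallyDominates O (CurveGerm.AType n),
      ∃ n : ℕ, CurveGerm.IsAType O n] := by
  have := hO.reduced
  have hA := hO.isAnalytic
  obtain ⟨x, hx⟩ := hO.exists_isGoodParameter
  obtain ⟨K, hK⟩ := hx.exists_pow_le
  obtain ⟨_, _, _, rfl⟩ := hA.exists_finite_algebra hx.mem hK
  tfae_have 1 ↔ 2 := by
    rw [hx.isLeast_weight_iff hA]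
    exact ⟨fun ⟨e, he, h⟩ => by rwa [hx.hasMultiplicity.unique h],
      fun h => ⟨_, h, hx.hasMultiplicity⟩⟩
  tfae_have 2 → 4 := fun h =>
    hA.exists_isAType_of_finrank_le_two hx.mem_nonZeroDivisors hx.mem
      ((hx.isLeast_weight_iff hA).1 h)
  tfae_have 4 → 3 := fun ⟨n, h⟩ => ⟨n, .of_isAType h⟩
  tfae_have 3 → 2 := by
    rintro ⟨n, h⟩
    obtain ⟨y, hym, hy, hy2⟩ := h.exists_finrank_quotient_le_two ⟨AlgEquiv.refl⟩
    exact (hx.isLeast_weight_iff hA).2 ((hx.finrank_quotient_le hy hym).trans hy2)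
  tfae_finish
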